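/- **Setting.** A parity game is $\mathcal G=(V,V_{\mathsf E},E,\pi)$ with $(V,E)$ a finite directed graph without self-loops in which every vertex has a successor, $V_{\mathsf O}=V\setminus V_{\mathsf E}$, and priorities $\pi(v)\ge 1$. A play (infinite path) is won by Even if the highest priority occurring infinitely often is even, and by Odd otherwise. A strategy of a player $\wp\in\{\mathsf E,\mathsf O\}$ may depend on the whole prefix of the play. A set $G\subseteq V$ induces a subgame if each of its vertices has a successor in $G$; a dominion of $\wp$ in $G$ is a set $D\subseteq G$ such that from every $v\in D$ the player $\wp$ has, in $G$, a winning strategy that agrees only with plays staying in $D$; $\mathrm{Attr}_\wp(S,G)$ is the set of vertices of $G$ from which $\wp$ has a strategy in $G$ that agrees only with plays reaching $S$. Write $\bar\wp$ for the opponent of $\wp$, and $\log$ for the binary logarithm. **Algorithm.** $\mathrm{Solve}_\wp(G,d,p,q)$, where $d$ has the parity of $\wp$ (even for $\mathsf E$, odd for $\mathsf O$), $p$ is the precision parameter for $\wp$ and $q$ the one for $\bar\wp$: 1. if $G=\emptyset$ or $p\le 1$, return $\emptyset$; 2. repeat: $N_d:=\{v\in G\mid \pi(v)=d\}$; $H:=G\setminus\mathrm{Attr}_\wp(N_d,G)$;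 $W:=\mathrm{Solve}_{\bar\wp}(H,d-1,\lfloor q/2\rfloor,p)$; $G:=G\setminus\mathrm{Attr}_{\bar\wp}(W,G)$; until $W=\emptyset$; 3. $W:=\mathrm{Solve}_{\bar\wp}(H,d-1,q,p)$; $G:=G\setminus\mathrm{Attr}_{\bar\wp}(W,G)$; 4. while $W\neq\emptyset$, execute once more the body of the loop of step 2; 5. return $G$. **Theorem.** (a) Let $G$ induce a subgame of a parity game, let all priorities in $G$ be at most $d$, and let $\wp$ be the player with the parity of $d$. For all $p,q\in\mathbb N$, the set returned by $\mathrm{Solve}_\wp(G,d,p,q)$ contains every dominion of $\wp$ in $G$ of size at most $p$ and is disjoint from every dominion of $\bar\wp$ in $G$ of size at most $q$. (b) In the same situation, $\mathrm{Solve}_\wp(G,d,|G|,|G|)$ returns the winning region of $\wp$ in the subgame $G$, and its complement in $G$ is the winning region of $\bar\wp$. (c) In the same situation, if $p,q\ge1$, $\ell=\lfloor\log p\rfloor+\lfloor\log q\rfloor$ and $n=|V|\ge1$, then the execution of $\mathrm{Solve}_\wp(G,d,p,q)$ makes at most $2\cdot n^{\ell}\cdot\binom{d+\ell}{\ell}-1$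 calls (to $\mathrm{Solve}_{\mathsf E}$ and $\mathrm{Solve}_{\mathsf O}$, including the main one). (d) For games with $n\ge1$ vertices, $m$ edges and priorities at most $d$, the algorithm, started with $\mathrm{Solve}_\wp(V,d,n,n)$, can be implemented on a unit-cost random access machine with words of $O(\log(n+d))$ bits (the input being given in memory as the list of owners, the list of priorities and the list of edges) so that it uses a memory of $O(m+n\log n)$ words, including the input, and runs in time $$O\!\left(m\cdot n^{2.9+2\log n+2\log\left(1+\frac{d}{2\log n}\right)}\right)=n^{O\left(\log n+\log\left(1+\frac{d}{\log n}\right)\right)},$$ which is $n^{O(\log n)}$ if $d\le n$. Here "implemented" means that one fixed program, on every such game, makes the same sequence of procedure calls as the algorithm (it writes every call with its arguments to a write-only output that is not counted as memory) and then outputs the returned set; all implied constants are absolute. -/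

import Mathlib

/-! ## Parity games -/

/-- The two players. -/
inductive Player where
  | even
  | odd
deriving DecidableEq

/-- The opponent of a player. -/
def Player.opp : Player → Player
  | .even => .odd
  | .odd => .even

/-- `℘.HasParity k`: the number `k` has the parity of the player `℘`. -/
def Player.HasParity : Player → ℕ → Prop
  | .even, k => Even k
  | .odd, k => Odd k

/-- The player whose parity is that of `d`. -/
def Player.ofParity (d : ℕ) : Player := if d % 2 = 0 then .even else .odd

/-- A game graph: every vertex has a successor, there are no self-loops, and the priorities
are positive integers. -/
structure ParityGame (V : Type*) where
  Adj : V → V → Prop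
  owner : V → Player
  priority : V → ℕ
  exists_succ : ∀ v, ∃ w, Adj v w
  irrefl : ∀ v, ¬ Adj v v
  priority_pos : ∀ v, 1 ≤ priority v

namespace ParityGame

variable {V : Type*} (𝒢 : ParityGame V)

/-- The set `G` induces a subgame: every vertex of `G` has a successor in `G`. -/
def IsSubgame (G : Finset V) : Prop := ∀ v ∈ G, ∃ w ∈ G, 𝒢.Adj v w

/-- A play in the subgame `G`: an infinite path through `G`. -/
def IsPlay (G : Finset V) (ρ : ℕ → V) : Prop :=
  ∀ i, ρ i ∈ G ∧ 𝒢.Adj (ρ i) (ρ (i + 1))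

/-- The play `ρ` is winning for `℘`: the highest priority that occurs infinitely often has
the parity of `℘`. -/
def IsWonBy (℘ : Player) (ρ : ℕ → V) : Prop :=
  ∃ k, IsGreatest {k | ∃ᶠ i in Filter.atTop, 𝒢.priority (ρ i) = k} k ∧ ℘.HasParity k

/-- The prefix `ρ[0,j]`, of length `j + 1`. -/
def playPrefix (ρ : ℕ → V) (j : ℕ) : List V := (List.range (j + 1)).map ρ

/-- `σ` is a strategy of `℘` from `v` in the subgame `G`: on every prefix of a play from `v`
that ends in a vertex of `℘`, it returns a successor (in `G`) of that vertex. Its values on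
other lists are irrelevant. -/
def IsStrategy (G : Finset V) (℘ : Player) (v : V) (σ : List V → V) : Prop :=
  ∀ ρ, 𝒢.IsPlay G ρ → ρ 0 = v → ∀ i, 𝒢.owner (ρ i) = ℘ →
    σ (playPrefix ρ i) ∈ G ∧ 𝒢.Adj (ρ i) (σ (playPrefix ρ i))

/-- The strategy `σ` of `℘` from `v` agrees with the play `ρ` of the subgame `G`. -/
def Agrees (G : Finset V) (℘ : Player) (v : V) (σ : List V → V) (ρ : ℕ → V) : Prop :=
  𝒢.IsPlay G ρ ∧ ρ 0 = v ∧ ∀ i, 𝒢.owner (ρ i) = ℘ → ρ (i + 1) = σ (playPrefix ρ i)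

/-- The winning region of `℘` in the subgame `G`. -/
def winningRegion (G : Finset V) (℘ : Player) : Set V :=
  {v | v ∈ G ∧ ∃ σ, 𝒢.IsStrategy G ℘ v σ ∧ ∀ ρ, 𝒢.Agrees G ℘ v σ ρ → 𝒢.IsWonBy ℘ ρ}

/-- `D` is a dominion of `℘` in the subgame `G`. -/
def IsDominion (G : Finset V) (℘ : Player) (D : Finset V) : Prop :=
  D ⊆ G ∧ ∀ v ∈ D, ∃ σ, 𝒢.IsStrategy G ℘ v σ ∧
    ∀ ρ, 𝒢.Agrees G ℘ v σ ρ → 𝒢.IsWonBy ℘ ρ ∧ ∀ i, ρ i ∈ D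

open Classical in
/-- The `℘`-attractor of `S` in the subgame `G`. -/
noncomputable def attr (℘ : Player) (S G : Finset V) : Finset V :=
  G.filter fun v => ∃ σ, 𝒢.IsStrategy G ℘ v σ ∧ ∀ ρ, 𝒢.Agrees G ℘ v σ ρ → ∃ i, ρ i ∈ S

theorem subset_attr (℘ : Player) {S G : Finset V} (h : S ⊆ G) : S ⊆ 𝒢.attr ℘ S G := by
  classical
  intro v hv
  have key : ∀ l : List V, ∃ x : V, ∀ u y, l.getLast? = some u → y ∈ G → 𝒢.Adj u y →
      x ∈ G ∧ 𝒢.Adj u x := by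
    intro l
    by_cases hl : ∃ u y, l.getLast? = some u ∧ y ∈ G ∧ 𝒢.Adj u y
    · obtain ⟨u, y, h1, h2, h3⟩ := hl
      refine ⟨y, fun u' y' hu' _ _ => ?_⟩
      rw [h1] at hu'
      cases hu'
      exact ⟨h2, h3⟩
    · exact ⟨v, fun u y h1 h2 h3 => (hl ⟨u, y, h1, h2, h3⟩).elim⟩
  choose σ hσ using key
  refine Finset.mem_filter.2 ⟨h hv, σ, ?_, ?_⟩
  · intro ρ hρ _ i _
    exact hσ _ (ρ i) (ρ (i + 1)) (by simp [playPrefix, List.range_succ]) (hρ (i + 1)).1 (hρ i).2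
  · intro ρ hρ
    exact ⟨0, by rw [hρ.2.1]; exact hv⟩

/-! ## The algorithm -/

/-- A procedure call `Solve_℘(G, d, p, q)`; here `p` is the precision parameter of `℘` and `q`
that of the opponent, as in `Solve_E(G, d, p_E, p_O)` and `Solve_O(G, d, p_O, p_E)`. -/
structure Call (V : Type*) where
  player : Player
  subgame : Finset V
  maxPriority : ℕ
  ownPrec : ℕ
  oppPrec : ℕ

variable [DecidableEq V]

/-- `H = G \ Attr_℘(N_d, G)`, where `N_d` is the set of vertices of `G` of priority `d`. -/
noncomputable def rest (℘ : Player) (d : ℕ) (G : Finset V) : Finset V :=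
  G \ 𝒢.attr ℘ (G.filter fun v => 𝒢.priority v = d) G

theorem rest_subset (℘ : Player) (d : ℕ) (G : Finset V) : 𝒢.rest ℘ d G ⊆ G :=
  Finset.sdiff_subset

theorem card_sdiff_attr_lt (℘ : Player) {W G : Finset V} (h : W ⊆ G) (hW : W ≠ ∅) :
    (G \ 𝒢.attr ℘ W G).card < G.card := by
  obtain ⟨v, hv⟩ := Finset.nonempty_iff_ne_empty.2 hW
  exact Finset.card_lt_card ⟨Finset.sdiff_subset, fun h' =>
    (Finset.mem_sdiff.1 (h' (h hv))).2 (𝒢.subset_attr ℘ h hv)⟩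

/-- The loop
  `repeat  H := G \ Attr_℘(N_d, G);  W := call H;  G := G \ Attr_℘'(W, G)  until W = ∅`
(`℘'` the opponent of `℘`), where `call H` returns a set together with the list of the
procedure calls made while computing it. The value is the final `G`, the final `H`, and the
list of all procedure calls made, in their order. The test of the cardinality is there only
to make the recursion well-founded: it always succeeds, see `repeatLoop_eq`. -/
noncomputable def repeatLoop (℘ : Player) (d : ℕ) (call : Finset V → Finset V × List (Call V))
    (G : Finset V) : Finset V × Finset V × List (Call V) :=
  let H := 𝒢.rest ℘ d G
  let W := (call H).1
  let G' := G \ 𝒢.attr ℘.opp W G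
  if W = ∅ then (G', H, (call H).2)
  else if _h : G'.card < G.card then
    let r := repeatLoop ℘ d call G'
    (r.1, r.2.1, (call H).2 ++ r.2.2)
  else (G', H, (call H).2)
termination_by G.card

theorem repeatLoop_eq (℘ : Player) (d : ℕ) (call : Finset V → Finset V × List (Call V))
    (hcall : ∀ X, (call X).1 ⊆ X) (G : Finset V) :
    𝒢.repeatLoop ℘ d call G =
      let H := 𝒢.rest ℘ d G
      let W := (call H).1
      let G' := G \ 𝒢.attr ℘.opp W G
      if W = ∅ then (G', H, (call H).2)
      else
        let r := 𝒢.repeatLoop ℘ d call G'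
        (r.1, r.2.1, (call H).2 ++ r.2.2) := by
  rw [repeatLoop]
  by_cases hW : (call (𝒢.rest ℘ d G)).1 = ∅
  · simp only [hW, if_true]
  · have := 𝒢.card_sdiff_attr_lt ℘.opp ((hcall _).trans (𝒢.rest_subset ℘ d G)) hW
    simp only [hW, if_false, this, dite_true]

/-- The execution of `Solve_℘(G, d, p, q)`: the returned set, and the list of all calls made
(this one and those made recursively), in their order. For `d = 0` a subgame with priorities
at most `d` is empty. A loop `while W ≠ ∅ do B` is written as
`if W ≠ ∅ then (repeat B until W = ∅)`. -/
noncomputable def run : (℘ : Player) → (G : Finset V) → (d p q : ℕ) →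
    Finset V × List (Call V)
  | ℘, G, 0, p, q => (∅, [⟨℘, G, 0, p, q⟩])
  | ℘, G, d + 1, p, q =>
    if G = ∅ ∨ p ≤ 1 then (∅, [⟨℘, G, d + 1, p, q⟩])
    else
      let half := fun X => run ℘.opp X d (q / 2) p
      let r₁ := 𝒢.repeatLoop ℘ (d + 1) half G
      let G₁ := r₁.1
      let H := r₁.2.1
      let c := run ℘.opp H d q p
      let W := c.1
      let G₂ := G₁ \ 𝒢.attr ℘.opp W G₁
      if W = ∅ then (G₂, ⟨℘, G, d + 1, p, q⟩ :: (r₁.2.2 ++ c.2))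
      else
        let r₂ := 𝒢.repeatLoop ℘ (d + 1) half G₂
        (r₂.1, ⟨℘, G, d + 1, p, q⟩ :: (r₁.2.2 ++ c.2 ++ r₂.2.2))

/-- The set returned by `Solve_℘(G, d, p, q)`. -/
noncomputable def solve (℘ : Player) (G : Finset V) (d p q : ℕ) : Finset V :=
  (𝒢.run ℘ G d p q).1

/-- The calls made during the execution of `Solve_℘(G, d, p, q)`, in their order. -/
noncomputable def calls (℘ : Player) (G : Finset V) (d p q : ℕ) : List (Call V) :=
  (𝒢.run ℘ G d p q).2

theorem repeatLoop_subset (℘ : Player) (d : ℕ) (call : Finset V → Finset V × List (Call V))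
    (G : Finset V) : (𝒢.repeatLoop ℘ d call G).1 ⊆ G := by
  induction hk : G.card using Nat.strong_induction_on generalizing G with
  | _ k ih =>
    rw [repeatLoop]
    dsimp only
    split_ifs with h1 h2
    · exact Finset.sdiff_subset
    · exact (ih _ (hk ▸ h2) _ rfl).trans Finset.sdiff_subset
    · exact Finset.sdiff_subset

/-- In particular the hypothesis of `repeatLoop_eq` holds for the calls made by `run`. -/
theorem run_subset (℘ : Player) (G : Finset V) (d p q : ℕ) : (𝒢.run ℘ G d p q).1 ⊆ G := by
  cases d with
  | zero => simp [run]
  | succ d =>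
    rw [run]
    dsimp only
    split_ifs with h1 h2
    · exact Finset.empty_subset _
    · exact Finset.sdiff_subset.trans (𝒢.repeatLoop_subset _ _ _ _)
    · exact (𝒢.repeatLoop_subset _ _ _ _).trans
        (Finset.sdiff_subset.trans (𝒢.repeatLoop_subset _ _ _ _))

end ParityGame

/-! ## A unit-cost random access machine with bounded words -/

namespace RAM

/-- Structured programs of the machine. It has registers, a memory of words, and a write-only
output. -/
inductive Prog where
  /-- do nothing -/
  | skip
  /-- `r := c` -/
  | const (r c : ℕ)
  /-- `r := a + b` -/
  | add (r a b : ℕ)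
  /-- `r := max (a - b) 0` -/
  | sub (r a b : ℕ)
  /-- `r := ⌊a / 2⌋` -/
  | half (r a : ℕ)
  /-- `r := mem[a]` -/
  | load (r a : ℕ)
  /-- `mem[a] := b` -/
  | store (a b : ℕ)
  /-- append `a` to the output -/
  | emit (a : ℕ)
  /-- `P; Q` -/
  | seq (P Q : Prog)
  /-- if `a ≠ 0` then `P` else `Q` -/
  | cond (a : ℕ) (P Q : Prog)
  /-- while `a ≠ 0` do `P` -/
  | loop (a : ℕ) (P : Prog)

/-- Configurations: contents of the registers and of the memory, and the output so far. -/
structure State where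
  reg : ℕ → ℕ
  mem : ℕ → ℕ
  out : List ℕ

/-- Assignment to a register. -/
def State.set (s : State) (r x : ℕ) : State := { s with reg := Function.update s.reg r x }

/-- `Exec w S P s t s'`: on a machine whose memory consists of the `S` cells `0, …, S - 1` and
whose words have `w` bits, the program `P` started in `s` halts in `s'` after `t` steps. Each
elementary instruction and each evaluation of a test is one step. An instruction that addresses a
cell outside the memory or produces a number not less than `2 ^ w` cannot be executed. -/
inductive Exec (w S : ℕ) : Prog → State → ℕ → State → Prop where
  | skip (s : State) : Exec w S .skip s 1 s
  | const (s : State) (r c : ℕ) (h : c < 2 ^ w) : Exec w S (.const r c) s 1 (s.set r c)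
  | add (s : State) (r a b : ℕ) (h : s.reg a + s.reg b < 2 ^ w) :
      Exec w S (.add r a b) s 1 (s.set r (s.reg a + s.reg b))
  | sub (s : State) (r a b : ℕ) : Exec w S (.sub r a b) s 1 (s.set r (s.reg a - s.reg b))
  | half (s : State) (r a : ℕ) : Exec w S (.half r a) s 1 (s.set r (s.reg a / 2))
  | load (s : State) (r a : ℕ) (h : s.reg a < S) :
      Exec w S (.load r a) s 1 (s.set r (s.mem (s.reg a)))
  | store (s : State) (a b : ℕ) (h : s.reg a < S) :
      Exec w S (.store a b) s 1 { s with mem := Function.update s.mem (s.reg a) (s.reg b) }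
  | emit (s : State) (a : ℕ) : Exec w S (.emit a) s 1 { s with out := s.out ++ [s.reg a] }
  | seq {P Q : Prog} {s s₁ s₂ : State} {t₁ t₂ : ℕ} (h₁ : Exec w S P s t₁ s₁)
      (h₂ : Exec w S Q s₁ t₂ s₂) : Exec w S (.seq P Q) s (t₁ + t₂) s₂
  | condTrue {a : ℕ} {P Q : Prog} {s s' : State} {t : ℕ} (ha : s.reg a ≠ 0)
      (h : Exec w S P s t s') : Exec w S (.cond a P Q) s (t + 1) s'
  | condFalse {a : ℕ} {P Q : Prog} {s s' : State} {t : ℕ} (ha : s.reg a = 0)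
      (h : Exec w S Q s t s') : Exec w S (.cond a P Q) s (t + 1) s'
  | loopStop {a : ℕ} {P : Prog} {s : State} (ha : s.reg a = 0) : Exec w S (.loop a P) s 1 s
  | loopStep {a : ℕ} {P : Prog} {s s₁ s₂ : State} {t₁ t₂ : ℕ} (ha : s.reg a ≠ 0)
      (h₁ : Exec w S P s t₁ s₁) (h₂ : Exec w S (.loop a P) s₁ t₂ s₂) :
      Exec w S (.loop a P) s (t₁ + 1 + t₂) s₂

/-- The initial configuration on an input: the input fills the first cells of the memory, all
other cells and all registers hold `0`, and the output is empty. -/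
def initial (input : List ℕ) : State where
  reg := fun _ => 0
  mem := fun i => input.getD i 0
  out := []

end RAM

namespace ParityGame

/-- A player as a number. -/
def encodePlayer : Player → ℕ
  | .even => 0
  | .odd => 1

/-- A set of vertices as a list of `n` bits. -/
def encodeSet {n : ℕ} (G : Finset (Fin n)) : List ℕ := List.ofFn fun v => if v ∈ G then 1 else 0

/-- A procedure call with its arguments as a list of numbers. -/
def encodeCall {n : ℕ} (c : Call (Fin n)) : List ℕ :=
  [encodePlayer c.player, c.maxPriority, c.ownPrec, c.oppPrec] ++ encodeSet c.subgame

/-- The input of the machine: the numbers of vertices and edges, the bound `d` on the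
priorities, the owners and the priorities of the vertices, and the list of edges. -/
def encodeGame {n : ℕ} (𝒢 : ParityGame (Fin n)) (d : ℕ) (edges : List (Fin n × Fin n)) :
    List ℕ :=
  [n, edges.length, d] ++ List.ofFn (fun v => encodePlayer (𝒢.owner v)) ++
    List.ofFn 𝒢.priority ++ edges.flatMap (fun e => [e.1.val, e.2.val])

/-- `edges` lists the edges of the game, in any order and without repetition. -/
def IsEdgeList {n : ℕ} (𝒢 : ParityGame (Fin n)) (edges : List (Fin n × Fin n)) : Prop :=
  edges.Nodup ∧ ∀ u v, (u, v) ∈ edges ↔ 𝒢.Adj u v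

/-- What an implementation of the algorithm has to output: the log of all procedure calls made by
`Solve_℘(V, d, n, n)`, where `℘` has the parity of `d`, each with its arguments and in the
order in which they are made, followed by the set returned by this execution. -/
noncomputable def expectedOutput {n : ℕ} (𝒢 : ParityGame (Fin n)) (d : ℕ) : List ℕ :=
  (𝒢.calls (Player.ofParity d) Finset.univ d n n).flatMap encodeCall ++
    encodeSet (𝒢.solve (Player.ofParity d) Finset.univ d n n)

end ParityGame

/-! Correctness. Dominions with history-dependent strategies coincide with closed sets carrying one
positional winning strategy (`isDominion_iff`). This follows from positional determinacy, proved by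
Zielonka's induction in `exists_posDominion_cover`, and from then on only positional dominions are
handled. Removing an opponent's attractor preserves a dominion of `℘` that avoids the target;
removing an attractor of `℘` itself costs the dominion only the attracted vertices.

In `solve_posDominion`, by induction on `d`, the sets returned by the subcalls avoid all dominions
of `℘` with at most `p` vertices, so these are never removed. Conversely, let a dominion `D` of the
opponent with at most `q` vertices meet the final set. What is left of `D` at any moment contains a
nonempty dominion avoiding the priority `d` (`PosDominion.exists_rest`). When the first loop stops,
such a dominion has more than `q / 2` vertices, since the halved call missed it. The one call with
full precision finds and removes it, so at most `q / 2` vertices of `D` remain, and for these the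
halved calls are precise enough. With both precisions equal to the number of vertices, the two
winning regions are themselves dominions of admissible size.

Number of calls. A nonempty returned set induces a subgame, and without self-loops it has at least
two vertices. Hence a call makes at most `h = n / 2 + 1` calls with halved precision and one with
full precision. Writing `ℓ` for the sum of the two logarithms, T(d+1, ℓ+1) ≤ 1 + h T(d, ℓ) + T(d,
ℓ+1), which Pascal's rule solves (`length_calls_le`).

Implementation. All sets of the recursion live in one array of levels: the current set of a call
with maximal priority `d` consists of the vertices of level at most `d`. Entering a subcall lowers
the vertices of `H` by one level below `d`; a vertex discarded by a call gets the level `d + 1`,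
which puts it back into the set of the caller, so a return restores nothing. Only a halved call
needs a stack entry, of three words, and at most logarithmically many of these are nested; a call
with full precision is undone by swapping the precisions, and is recognized because the top of the
stack belongs to another priority. `simulates` proves, by induction on `d`, that a single flat loop
performs the recursion.

Resources. A naive attractor computation costs O(n² m) per call. The factor n² is paid by using `h`
instead of `n` as base: h^ℓ is about n^ℓ / 2^ℓ, and 2^ℓ is about n² for ℓ = 2 ⌊log n⌋
(`half_add_one_pow_le`). With a = 2 log n the binomial coefficient is at most e^a (1 + d/a)^a, and
e^a = n^(2 / ln 2), where 2 / ln 2 < 2.9. -/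

/-! ## Attractors as least fixed points -/

section Attractor

variable {V : Type*} {own : V → Prop} {adj : V → V → Prop} {S G : Finset V}

/-- The vertices of `G` from which the owner of the vertices in `own` can force a visit of `S`
within `k` moves. -/
def AttN (own : V → Prop) (adj : V → V → Prop) (S G : Finset V) : ℕ → V → Prop
  | 0, v => v ∈ G ∧ v ∈ S
  | k + 1, v => v ∈ G ∧ (v ∈ S ∨ (own v ∧ ∃ w ∈ G, adj v w ∧ AttN own adj S G k w) ∨
      (¬ own v ∧ ∀ w ∈ G, adj v w → AttN own adj S G k w))

/-- The vertices of `G` from which the owner of the vertices in `own` can force a visit of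
`S`. -/
def Att (own : V → Prop) (adj : V → V → Prop) (S G : Finset V) (v : V) : Prop :=
  ∃ k, AttN own adj S G k v

theorem AttN.succ {k : ℕ} {v : V} (h : AttN own adj S G k v) : AttN own adj S G (k + 1) v := by
  induction k generalizing v with
  | zero => exact ⟨h.1, Or.inl h.2⟩
  | succ k ih =>
    refine ⟨h.1, ?_⟩
    rcases h.2 with h1 | ⟨h1, w, hw, h2, h3⟩ | ⟨h1, h2⟩
    · exact Or.inl h1
    · exact Or.inr (Or.inl ⟨h1, w, hw, h2, ih h3⟩)
    · exact Or.inr (Or.inr ⟨h1, fun w hw hvw => ih (h2 w hw hvw)⟩)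

theorem AttN.mono {j k : ℕ} (hjk : j ≤ k) {v : V} (h : AttN own adj S G j v) :
    AttN own adj S G k v := by
  induction hjk with
  | refl => exact h
  | step _ ih => exact ih.succ

theorem AttN.mem {k : ℕ} {v : V} (h : AttN own adj S G k v) : v ∈ G := by
  cases k <;> exact h.1

theorem Att.mem {v : V} (h : Att own adj S G v) : v ∈ G := h.choose_spec.mem

theorem Att.base {v : V} (hG : v ∈ G) (hS : v ∈ S) : Att own adj S G v := ⟨0, hG, hS⟩

theorem Att.of_own {v w : V} (hG : v ∈ G) (ho : own v) (hw : w ∈ G) (hvw : adj v w)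
    (h : Att own adj S G w) : Att own adj S G v := by
  obtain ⟨k, hk⟩ := h
  exact ⟨k + 1, hG, Or.inr (Or.inl ⟨ho, w, hw, hvw, hk⟩)⟩

/-- Finiteness of `G` enters here: the stages at which the successors appear have a common bound, so
the finite stages exhaust the least fixed point. -/
theorem Att.of_forall {v : V} (hG : v ∈ G) (ho : ¬ own v)
    (h : ∀ w ∈ G, adj v w → Att own adj S G w) : Att own adj S G v := by
  classical
  have h' : ∀ w, ∃ k, w ∈ G → adj v w → AttN own adj S G k w := by
    intro w
    by_cases hw : w ∈ G ∧ adj v w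
    · obtain ⟨k, hk⟩ := h w hw.1 hw.2
      exact ⟨k, fun _ _ => hk⟩
    · exact ⟨0, fun h1 h2 => (hw ⟨h1, h2⟩).elim⟩
  choose k hk using h'
  exact ⟨G.sup k + 1, hG, Or.inr (Or.inr ⟨ho, fun w hw hvw =>
    (hk w hw hvw).mono (Finset.le_sup hw)⟩)⟩

/-- The rank is the first stage at which a vertex appears. A vertex outside the target appears
because of successors from an earlier stage, so a single positional choice makes the rank drop
everywhere. -/
theorem Att.exists_strategy (own : V → Prop) (adj : V → V → Prop) (S G : Finset V) :
    ∃ (f : V → V) (r : V → ℕ), ∀ v, Att own adj S G v → v ∉ S →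
      (own v → f v ∈ G ∧ adj v (f v) ∧ Att own adj S G (f v) ∧ r (f v) < r v) ∧
      (¬ own v → ∀ w ∈ G, adj v w → Att own adj S G w ∧ r w < r v) := by
  classical
  let r : V → ℕ := fun v => sInf {k | AttN own adj S G k v}
  have key : ∀ v, ∃ u, Att own adj S G v → v ∉ S →
      (own v → u ∈ G ∧ adj v u ∧ Att own adj S G u ∧ r u < r v) ∧
      (¬ own v → ∀ w ∈ G, adj v w → Att own adj S G w ∧ r w < r v) := by
    intro v
    by_cases hv : Att own adj S G v ∧ v ∉ S
    · obtain ⟨hv, hS⟩ := hv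
      have h := Nat.sInf_mem (s := {k | AttN own adj S G k v}) hv
      change AttN own adj S G (r v) v at h
      obtain ⟨j, hj⟩ : ∃ j, r v = j + 1 := by
        refine Nat.exists_eq_succ_of_ne_zero fun h0 => ?_
        rw [h0] at h
        exact hS h.2
      rw [hj] at h
      have hlt : ∀ w, AttN own adj S G j w → r w < r v := fun w hw =>
        lt_of_le_of_lt (Nat.sInf_le hw) (by omega)
      rcases h.2 with h1 | ⟨h1, w, hw, h2, h3⟩ | ⟨h1, h2⟩
      · exact (hS h1).elim
      · exact ⟨w, fun _ _ => ⟨fun _ => ⟨hw, h2, ⟨j, h3⟩, hlt w h3⟩, fun h => (h h1).elim⟩⟩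
      · exact ⟨v, fun _ _ => ⟨fun h => (h1 h).elim, fun _ w hw hvw =>
          ⟨⟨j, h2 w hw hvw⟩, hlt w (h2 w hw hvw)⟩⟩⟩
    · exact ⟨v, fun h1 h2 => (hv ⟨h1, h2⟩).elim⟩
  choose f hf using key
  exact ⟨f, r, hf⟩

theorem Att.induction {P : V → Prop} (hbase : ∀ v ∈ G, v ∈ S → P v)
    (hown : ∀ v ∈ G, own v → ∀ w ∈ G, adj v w → P w → P v)
    (hopp : ∀ v ∈ G, ¬ own v → (∀ w ∈ G, adj v w → P w) → P v) {v : V}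
    (h : Att own adj S G v) : P v := by
  obtain ⟨k, hk⟩ := h
  induction k generalizing v with
  | zero => exact hbase v hk.1 hk.2
  | succ k ih =>
    rcases hk.2 with h1 | ⟨h1, w, hw, h2, h3⟩ | ⟨h1, h2⟩
    · exact hbase v hk.1 h1
    · exact hown v hk.1 h1 w hw h2 (ih h3)
    · exact hopp v hk.1 h1 fun w hw hvw => ih (h2 w hw hvw)

/-- A path that follows an attractor strategy reaches its target. -/
theorem Att.exists_hit {f : V → V} {r : V → ℕ}
    (hf : ∀ v, Att own adj S G v → v ∉ S →
      (own v → f v ∈ G ∧ adj v (f v) ∧ Att own adj S G (f v) ∧ r (f v) < r v) ∧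
      (¬ own v → ∀ w ∈ G, adj v w → Att own adj S G w ∧ r w < r v))
    {ρ : ℕ → V} (hρ : ∀ i, ρ i ∈ G ∧ adj (ρ i) (ρ (i + 1)))
    (hfρ : ∀ i, Att own adj S G (ρ i) → ρ i ∉ S → own (ρ i) → ρ (i + 1) = f (ρ i)) {i : ℕ}
    (hi : Att own adj S G (ρ i)) : ∃ j, i ≤ j ∧ ρ j ∈ S := by
  by_contra! hno
  -- As long as the target is avoided, the rank drops at every step, which is possible at most `r (ρ
  -- i)` times.
  have key : ∀ k, Att own adj S G (ρ (i + k)) ∧ r (ρ (i + k)) + k ≤ r (ρ i) := by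
    intro k
    induction k with
    | zero => exact ⟨hi, le_rfl⟩
    | succ k ih =>
      have hS := hno (i + k) (by omega)
      obtain ⟨h1, h2⟩ := hf _ ih.1 hS
      by_cases ho : own (ρ (i + k))
      · have := h1 ho
        rw [← hfρ _ ih.1 hS ho] at this
        exact ⟨this.2.2.1, by
          have h3 := this.2.2.2
          have h4 := ih.2
          change r (ρ (i + k + 1)) + (k + 1) ≤ _
          omega⟩
      · have := h2 ho _ (hρ (i + k + 1)).1 (hρ (i + k)).2
        exact ⟨this.1, by
          have h3 := this.2
          have h4 := ih.2
          change r (ρ (i + k + 1)) + (k + 1) ≤ _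
          omega⟩
  have := (key (r (ρ i) + 1)).2
  omega

end Attractor

/-! ### Opponents and parities. -/

theorem Player.opp_opp (℘ : Player) : ℘.opp.opp = ℘ := by cases ℘ <;> rfl

theorem Player.ne_iff {℘ ℘' : Player} : ℘' ≠ ℘ ↔ ℘' = ℘.opp := by
  cases ℘ <;> cases ℘' <;> simp [Player.opp]

theorem Player.opp_ne (℘ : Player) : ℘.opp ≠ ℘ := by cases ℘ <;> simp [Player.opp]

theorem Player.hasParity_opp {℘ : Player} {d : ℕ} : ℘.opp.HasParity d ↔ ¬ ℘.HasParity d := by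
  cases ℘ <;> simp [Player.opp, Player.HasParity]

theorem Player.ofParity_hasParity (d : ℕ) : (Player.ofParity d).HasParity d := by
  unfold Player.ofParity
  split_ifs with h
  · exact Nat.even_iff.2 h
  · exact Nat.odd_iff.2 (by omega)

theorem Player.HasParity.opp_pred {℘ : Player} {d : ℕ} (h : ℘.HasParity (d + 1)) :
    ℘.opp.HasParity d := by
  cases ℘ <;> simp only [Player.opp, Player.HasParity] at *
  · exact Nat.not_even_iff_odd.1 (Nat.even_add_one.1 h)
  · rw [Nat.odd_add_one] at h
    exact Nat.not_odd_iff_even.1 h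

namespace ParityGame

variable {V : Type*} {𝒢 : ParityGame V} {℘ : Player} {G S D : Finset V}

/-! ## Plays and strategies -/

/-- Only the tail of a play matters, so strategies may be analysed from the moment at which a play
settles in some region. -/
theorem isWonBy_shift {ρ : ℕ → V} (k : ℕ) :
    𝒢.IsWonBy ℘ (fun i => ρ (k + i)) ↔ 𝒢.IsWonBy ℘ ρ := by
  have : ∀ c, (∃ᶠ i in Filter.atTop, 𝒢.priority (ρ (k + i)) = c) ↔
      ∃ᶠ i in Filter.atTop, 𝒢.priority (ρ i) = c := by
    intro c
    simp only [Filter.frequently_atTop]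
    constructor
    · intro h a
      obtain ⟨b, hb, h'⟩ := h a
      exact ⟨k + b, by omega, h'⟩
    · intro h a
      obtain ⟨b, hb, h'⟩ := h (k + a)
      exact ⟨b - k, by omega, by rwa [Nat.add_sub_cancel' (by omega)]⟩
  simp only [IsWonBy, this]

theorem IsWonBy.not_opp {ρ : ℕ → V} (h : 𝒢.IsWonBy ℘ ρ) : ¬ 𝒢.IsWonBy ℘.opp ρ := by
  rintro ⟨k', hk', hp'⟩
  obtain ⟨k, hk, hp⟩ := h
  rw [hk'.unique hk] at hp'
  exact Player.hasParity_opp.1 hp' hp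

theorem isWonBy_of_frequently {d : ℕ} (hd : ℘.HasParity d) {ρ : ℕ → V}
    (hle : ∀ i, 𝒢.priority (ρ i) ≤ d) (h : ∃ᶠ i in Filter.atTop, 𝒢.priority (ρ i) = d) :
    𝒢.IsWonBy ℘ ρ := by
  refine ⟨d, ⟨h, ?_⟩, hd⟩
  intro k hk
  obtain ⟨i, hi⟩ := hk.exists
  exact hi ▸ hle i

theorem playPrefix_succ (ρ : ℕ → V) (j : ℕ) :
    playPrefix ρ (j + 1) = playPrefix ρ j ++ [ρ (j + 1)] := by
  simp [playPrefix, List.range_succ]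

theorem getLastD_playPrefix (ρ : ℕ → V) (j : ℕ) (v : V) : (playPrefix ρ j).getLastD v = ρ j := by
  simp [playPrefix, List.range_succ]

theorem playPrefix_congr {ρ ρ' : ℕ → V} {j : ℕ} (h : ∀ i ≤ j, ρ i = ρ' i) :
    playPrefix ρ j = playPrefix ρ' j := by
  refine List.map_congr_left fun i hi => h i ?_
  have := List.mem_range.1 hi
  omega

/-- Default moves, used to complete strategies that are meaningful only on part of `G`. -/
theorem IsSubgame.exists_succ_fun (hG : 𝒢.IsSubgame G) :
    ∃ g : V → V, ∀ v ∈ G, g v ∈ G ∧ 𝒢.Adj v (g v) := by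
  classical
  refine ⟨fun v => if h : v ∈ G then (hG v h).choose else v, fun v hv => ?_⟩
  simp only [hv, dite_true]
  exact (hG v hv).choose_spec

/-- The strategy that moves from the last vertex of the history by `g`. -/
theorem isStrategy_positional {g : V → V} (hg : ∀ v ∈ G, g v ∈ G ∧ 𝒢.Adj v (g v)) (v : V) :
    𝒢.IsStrategy G ℘ v (fun l => g (l.getLastD v)) := by
  intro ρ hρ _ i _
  simp only [getLastD_playPrefix]
  exact hg _ (hρ i).1

/-- A strategy of each player together determine a play. -/
theorem exists_outcome (hG : 𝒢.IsSubgame G) {v : V} (hv : v ∈ G) {σ τ : List V → V}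
    (hσ : 𝒢.IsStrategy G ℘ v σ) (hτ : 𝒢.IsStrategy G ℘.opp v τ) :
    ∃ ρ, 𝒢.Agrees G ℘ v σ ρ ∧ 𝒢.Agrees G ℘.opp v τ ρ := by
  classical
  obtain ⟨g, hg⟩ := hG.exists_succ_fun
  let next : List V → V := fun l => if 𝒢.owner (l.getLastD v) = ℘ then σ l else τ l
  let hist : ℕ → List V := fun k => Nat.rec [v] (fun _ l => l ++ [next l]) k
  have hist_succ : ∀ k, hist (k + 1) = hist k ++ [next (hist k)] := fun k => rfl
  let ρ : ℕ → V := fun k => (hist k).getLastD v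
  have hρ0 : ρ 0 = v := rfl
  have hρs : ∀ k, ρ (k + 1) = next (hist k) := by
    intro k
    simp only [ρ, hist_succ]
    simp
  have hpre : ∀ k, playPrefix ρ k = hist k := by
    intro k
    induction k with
    | zero => simp [playPrefix, hρ0, hist]
    | succ k ih => rw [playPrefix_succ, ih, hρs, hist_succ]
  have hstep : ∀ k, ρ k ∈ G ∧ 𝒢.Adj (ρ k) (ρ (k + 1)) ∧ ρ (k + 1) ∈ G := by
    intro k
    induction k using Nat.strong_induction_on with
    | _ k ih =>
      have hk : ρ k ∈ G := by
        cases k with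
        | zero => exact hv
        | succ k => exact (ih k (by omega)).2.2
      -- Strategies are known to move legally only along prefixes of infinite plays. The history
      -- built so far is therefore continued arbitrarily, by default moves, before the strategies
      -- are consulted.
      let ρ' : ℕ → V := fun i => if i ≤ k then ρ i else g^[i - k] (ρ k)
      have hit : ∀ i, g^[i] (ρ k) ∈ G := by
        intro i
        induction i with
        | zero => exact hk
        | succ i ih => rw [Function.iterate_succ_apply']; exact (hg _ ih).1
      have hplay : 𝒢.IsPlay G ρ' := by
        intro i
        rcases lt_trichotomy i k with h | h | h
        · have := ih i h
          simp only [ρ', h.le, if_true, Nat.succ_le_of_lt h]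
          exact ⟨this.1, this.2.1⟩
        · subst h
          simp only [ρ', le_refl, if_true, Nat.not_succ_le_self, if_false]
          simp only [Nat.add_sub_cancel_left, Function.iterate_one]
          exact ⟨hk, (hg _ hk).2⟩
        · simp only [ρ', not_le.2 h, not_le.2 (h.trans (Nat.lt_succ_self i)), if_false]
          rw [Nat.succ_sub h.le, Function.iterate_succ_apply']
          exact ⟨hit _, (hg _ (hit _)).2⟩
      have hcongr : playPrefix ρ' k = hist k := by
        rw [← hpre]
        exact playPrefix_congr fun i hi => by simp [ρ', hi]
      have hk' : ρ' k = ρ k := by simp [ρ']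
      have h0' : ρ' 0 = v := by simp [ρ', hρ0]
      have hlast : (hist k).getLastD v = ρ k := rfl
      by_cases ho : 𝒢.owner (ρ k) = ℘
      · have := hσ ρ' hplay h0' k (by rw [hk']; exact ho)
        rw [hcongr, hk'] at this
        have hn : ρ (k + 1) = σ (hist k) := by rw [hρs]; simp only [next, hlast, ho, if_true]
        rw [hn]
        exact ⟨hk, this.2, this.1⟩
      · have := hτ ρ' hplay h0' k (by rw [hk']; exact Player.ne_iff.1 ho)
        rw [hcongr, hk'] at this
        have hn : ρ (k + 1) = τ (hist k) := by rw [hρs]; simp only [next, hlast, ho, if_false]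
        rw [hn]
        exact ⟨hk, this.2, this.1⟩
  have hplay : 𝒢.IsPlay G ρ := fun i => ⟨(hstep i).1, (hstep i).2.1⟩
  refine ⟨ρ, ⟨hplay, hρ0, fun i ho => ?_⟩, ⟨hplay, hρ0, fun i ho => ?_⟩⟩
  · rw [hρs, hpre]
    exact if_pos ho
  · rw [hρs, hpre]
    refine if_neg ?_
    change 𝒢.owner (ρ i) ≠ ℘
    rw [ho]
    exact ℘.opp_ne

/-- Outside the fixed point the opponent has a positional counter-strategy: his vertices there have
a successor outside, and those of `℘` have no successor inside. Played against any strategy of `℘`,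
it avoids `S` forever. Inside, moving by decreasing rank reaches `S`. History therefore gives no
advantage. -/
theorem mem_attr (hG : 𝒢.IsSubgame G) {v : V} :
    v ∈ 𝒢.attr ℘ S G ↔ Att (fun v => 𝒢.owner v = ℘) 𝒢.Adj S G v := by
  classical
  obtain ⟨g, hg⟩ := hG.exists_succ_fun
  unfold attr
  rw [Finset.mem_filter]
  constructor
  · rintro ⟨hv, σ, hσ, hreach⟩
    by_contra hno
    let A := Att (fun v => 𝒢.owner v = ℘) 𝒢.Adj S G
    let t : V → V := fun u => if h : ∃ w ∈ G, 𝒢.Adj u w ∧ ¬ A w then h.choose else g u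
    have ht : ∀ u ∈ G, t u ∈ G ∧ 𝒢.Adj u (t u) := by
      intro u hu
      by_cases h : ∃ w ∈ G, 𝒢.Adj u w ∧ ¬ A w
      · simp only [t, h, dite_true]
        exact ⟨h.choose_spec.1, h.choose_spec.2.1⟩
      · simp only [t, h, dite_false]
        exact hg u hu
    obtain ⟨ρ, h1, h2⟩ := exists_outcome hG hv hσ (isStrategy_positional ht v)
    have key : ∀ i, ¬ A (ρ i) := by
      intro i
      induction i with
      | zero => rw [h1.2.1]; exact hno
      | succ i ih =>
        by_cases ho : 𝒢.owner (ρ i) = ℘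
        · exact fun h => ih (Att.of_own (h1.1 i).1 ho (h1.1 (i + 1)).1 (h1.1 i).2 h)
        · have := h2.2.2 i (Player.ne_iff.1 ho)
          simp only [getLastD_playPrefix] at this
          have h : ∃ w ∈ G, 𝒢.Adj (ρ i) w ∧ ¬ A w := by
            by_contra! h
            exact ih (Att.of_forall (h1.1 i).1 ho h)
          simp only [t, h, dite_true] at this
          rw [this]
          exact h.choose_spec.2.2
    obtain ⟨i, hi⟩ := hreach ρ h1
    exact key i (Att.base (h1.1 i).1 hi)
  · intro hv
    refine ⟨hv.mem, ?_⟩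
    obtain ⟨f, r, hf⟩ := Att.exists_strategy (fun v => 𝒢.owner v = ℘) 𝒢.Adj S G
    let A := Att (fun v => 𝒢.owner v = ℘) 𝒢.Adj S G
    let t : V → V := fun u => if A u ∧ u ∉ S ∧ 𝒢.owner u = ℘ then f u else g u
    have ht : ∀ u ∈ G, t u ∈ G ∧ 𝒢.Adj u (t u) := by
      intro u hu
      by_cases h : A u ∧ u ∉ S ∧ 𝒢.owner u = ℘
      · simp only [t, h, not_false_eq_true, and_self, if_true]
        have := (hf u h.1 h.2.1).1 h.2.2
        exact ⟨this.1, this.2.1⟩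
      · simp only [t, h, if_false]
        exact hg u hu
    refine ⟨_, isStrategy_positional ht v, fun ρ hρ => ?_⟩
    obtain ⟨j, -, hj⟩ := Att.exists_hit hf hρ.1 (i := 0) (fun i h1 h2 h3 => by
      have := hρ.2.2 i h3
      simp only [getLastD_playPrefix] at this
      rw [this]
      exact if_pos ⟨h1, h2, h3⟩) (by rw [hρ.2.1]; exact hv)
    exact ⟨j, hj⟩

theorem attr_subset : 𝒢.attr ℘ S G ⊆ G := by
  classical
  exact Finset.filter_subset _ _

/-- An opponent's vertex without successors would be attracted vacuously; a subgame has none. -/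
theorem attr_empty (hG : 𝒢.IsSubgame G) : 𝒢.attr ℘ ∅ G = ∅ := by
  refine Finset.eq_empty_of_forall_notMem fun v hv => ?_
  rw [mem_attr hG] at hv
  refine Att.induction (P := fun _ => False) (by simp) (by simp) ?_ hv
  intro u hu _ h
  obtain ⟨w, hw, huw⟩ := hG u hu
  exact h w hw huw

theorem mem_attr_of_own (hG : 𝒢.IsSubgame G) {v w : V} (hv : v ∈ G) (ho : 𝒢.owner v = ℘)
    (hvw : 𝒢.Adj v w) (h : w ∈ 𝒢.attr ℘ S G) : v ∈ 𝒢.attr ℘ S G :=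
  (mem_attr hG).2 (Att.of_own (own := fun v => 𝒢.owner v = ℘) hv ho (attr_subset h) hvw
    ((mem_attr hG).1 h))

theorem mem_attr_of_forall (hG : 𝒢.IsSubgame G) {v : V} (hv : v ∈ G) (ho : 𝒢.owner v ≠ ℘)
    (h : ∀ w ∈ G, 𝒢.Adj v w → w ∈ 𝒢.attr ℘ S G) : v ∈ 𝒢.attr ℘ S G :=
  (mem_attr hG).2 (Att.of_forall (own := fun v => 𝒢.owner v = ℘) hv ho fun w hw hvw =>
    (mem_attr hG).1 (h w hw hvw))

/-- No dead end arises: a vertex outside the attractor keeps all its successors if `℘` owns it, and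
at least one otherwise, as it would have been attracted in any other case. -/
theorem IsSubgame.sdiff_attr [DecidableEq V] (hG : 𝒢.IsSubgame G) :
    𝒢.IsSubgame (G \ 𝒢.attr ℘ S G) := by
  intro v hv
  rw [Finset.mem_sdiff] at hv
  by_cases ho : 𝒢.owner v = ℘
  · obtain ⟨w, hw, hvw⟩ := hG v hv.1
    exact ⟨w, Finset.mem_sdiff.2 ⟨hw, fun h => hv.2 (mem_attr_of_own hG hv.1 ho hvw h)⟩, hvw⟩
  · by_contra! hno
    refine hv.2 (mem_attr_of_forall hG hv.1 ho fun w hw hvw => ?_)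
    by_contra h
    exact hno w (Finset.mem_sdiff.2 ⟨hw, h⟩) hvw

/-- Attractors from `T` are empty on a set disjoint from `T` which the opponent can keep. -/
theorem disjoint_attr (hG : 𝒢.IsSubgame G) (hS : Disjoint D S)
    (hown : ∀ v ∈ D, 𝒢.owner v = ℘ → ∀ w ∈ G, 𝒢.Adj v w → w ∈ D)
    (hopp : ∀ v ∈ D, 𝒢.owner v ≠ ℘ → ∃ w ∈ G, 𝒢.Adj v w ∧ w ∈ D) :
    Disjoint D (𝒢.attr ℘ S G) := by
  refine Finset.disjoint_right.2 fun v hv => ?_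
  rw [mem_attr hG] at hv
  refine Att.induction (P := fun v => v ∉ D) ?_ ?_ ?_ hv
  · exact fun v _ hvS hvD => Finset.disjoint_left.1 hS hvD hvS
  · exact fun v _ ho w hw hvw h hvD => h (hown v hvD ho w hw hvw)
  · intro v _ ho h hvD
    obtain ⟨w, hw, hvw, hwD⟩ := hopp v hvD ho
    exact h w hw hvw hwD

/-! ## Positional dominions and determinacy -/

/-- An infinite path in `D` in which `℘` moves by `f`. -/
def Conforms (𝒢 : ParityGame V) (℘ : Player) (f : V → V) (D : Finset V) (ρ : ℕ → V) : Prop :=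
  ∀ i, ρ i ∈ D ∧ 𝒢.Adj (ρ i) (ρ (i + 1)) ∧ (𝒢.owner (ρ i) = ℘ → ρ (i + 1) = f (ρ i))

/-- A dominion with a positional winning strategy common to all its vertices. -/
structure PosDominion (𝒢 : ParityGame V) (G : Finset V) (℘ : Player) (D : Finset V) : Prop where
  subset : D ⊆ G
  closed : ∀ v ∈ D, 𝒢.owner v ≠ ℘ → ∀ w ∈ G, 𝒢.Adj v w → w ∈ D
  exists_strategy : ∃ f : V → V, (∀ v ∈ D, 𝒢.owner v = ℘ → f v ∈ D ∧ 𝒢.Adj v (f v)) ∧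
    ∀ ρ, 𝒢.Conforms ℘ f D ρ → 𝒢.IsWonBy ℘ ρ

theorem PosDominion.empty (G : Finset V) (℘ : Player) : 𝒢.PosDominion G ℘ ∅ where
  subset := Finset.empty_subset _
  closed := by simp
  exists_strategy := ⟨id, by simp, fun ρ hρ => by simpa using (hρ 0).1⟩

theorem PosDominion.isDominion (hG : 𝒢.IsSubgame G) (h : 𝒢.PosDominion G ℘ D) :
    𝒢.IsDominion G ℘ D := by
  classical
  obtain ⟨g, hg⟩ := hG.exists_succ_fun
  obtain ⟨f, hf, hwin⟩ := h.exists_strategy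
  let t : V → V := fun u => if u ∈ D ∧ 𝒢.owner u = ℘ then f u else g u
  have ht : ∀ u ∈ G, t u ∈ G ∧ 𝒢.Adj u (t u) := by
    intro u hu
    by_cases hc : u ∈ D ∧ 𝒢.owner u = ℘
    · simp only [t, hc, and_self, if_true]
      exact ⟨h.subset (hf u hc.1 hc.2).1, (hf u hc.1 hc.2).2⟩
    · simp only [t, hc, if_false]
      exact hg u hu
  refine ⟨h.subset, fun v hv => ⟨_, isStrategy_positional ht v, fun ρ hρ => ?_⟩⟩
  have hD : ∀ i, ρ i ∈ D := by
    intro i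
    induction i with
    | zero => rw [hρ.2.1]; exact hv
    | succ i ih =>
      by_cases ho : 𝒢.owner (ρ i) = ℘
      · have := hρ.2.2 i ho
        simp only [getLastD_playPrefix] at this
        rw [this]
        simp only [t, ih, ho, and_self, if_true]
        exact (hf _ ih ho).1
      · exact h.closed _ ih ho _ (hρ.1 (i + 1)).1 (hρ.1 i).2
  refine ⟨hwin ρ fun i => ⟨hD i, (hρ.1 i).2, fun ho => ?_⟩, hD⟩
  have := hρ.2.2 i ho
  simp only [getLastD_playPrefix] at this
  rw [this]
  exact if_pos ⟨hD i, ho⟩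

section

variable [DecidableEq V]

/-- The complement of an opponent's attractor is a trap for the opponent: one of his vertices with
an edge into the attractor would belong to it. -/
theorem PosDominion.of_sdiff_attr (hG : 𝒢.IsSubgame G)
    (h : 𝒢.PosDominion (G \ 𝒢.attr ℘.opp S G) ℘ D) : 𝒢.PosDominion G ℘ D where
  subset := h.subset.trans Finset.sdiff_subset
  closed := fun v hv ho w hw hvw => h.closed v hv ho w (Finset.mem_sdiff.2 ⟨hw, fun hA =>
    (Finset.mem_sdiff.1 (h.subset hv)).2 (mem_attr_of_own hG
      (Finset.mem_sdiff.1 (h.subset hv)).1 (Player.ne_iff.1 ho) hvw hA)⟩) hvw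
  exists_strategy := h.exists_strategy

/-- The strategies of `D`, of the attractor and of `D'` are glued with this priority. A play that
ever meets the attractor is led into `D` and stays there; any other play stays in `D'` forever. -/
theorem PosDominion.attr_union {D' : Finset V} (hG : 𝒢.IsSubgame G)
    (h : 𝒢.PosDominion G ℘ D) (h' : 𝒢.PosDominion (G \ 𝒢.attr ℘ D G) ℘ D') :
    𝒢.PosDominion G ℘ (𝒢.attr ℘ D G ∪ D') := by
  obtain ⟨f, hf, hwin⟩ := h.exists_strategy
  obtain ⟨f', hf', hwin'⟩ := h'.exists_strategy
  obtain ⟨fa, r, hfa⟩ := Att.exists_strategy (fun v => 𝒢.owner v = ℘) 𝒢.Adj D G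
  have hDA : D ⊆ 𝒢.attr ℘ D G := 𝒢.subset_attr ℘ h.subset
  have hsub : 𝒢.attr ℘ D G ∪ D' ⊆ G :=
    Finset.union_subset attr_subset (h'.subset.trans Finset.sdiff_subset)
  refine ⟨hsub, ?_, fun v => if v ∈ D then f v else if v ∈ 𝒢.attr ℘ D G then fa v else f' v,
    ?_, ?_⟩
  · intro v hv ho w hw hvw
    rw [Finset.mem_union] at hv ⊢
    by_cases hwA : w ∈ 𝒢.attr ℘ D G
    · exact Or.inl hwA
    rcases hv with hv | hv
    · by_cases hvD : v ∈ D
      · exact (hwA (hDA (h.closed v hvD ho w hw hvw))).elim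
      · exact (hwA ((mem_attr hG).2 ((hfa v ((mem_attr hG).1 hv) hvD).2 ho w hw hvw).1)).elim
    · exact Or.inr (h'.closed v hv ho w (Finset.mem_sdiff.2 ⟨hw, hwA⟩) hvw)
  · intro v hv ho
    rw [Finset.mem_union] at hv ⊢
    dsimp only
    split_ifs with h1 h2
    · exact ⟨Or.inl (hDA (hf v h1 ho).1), (hf v h1 ho).2⟩
    · have := (hfa v ((mem_attr hG).1 h2) h1).1 ho
      exact ⟨Or.inl ((mem_attr hG).2 this.2.2.1), this.2.1⟩
    · have := hf' v (hv.resolve_left h2) ho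
      exact ⟨Or.inr this.1, this.2⟩
  · intro ρ hρ
    by_cases hA : ∃ i, ρ i ∈ 𝒢.attr ℘ D G
    · obtain ⟨i, hi⟩ := hA
      obtain ⟨j, -, hj⟩ := Att.exists_hit hfa (ρ := ρ) (i := i)
        (fun i => ⟨hsub (hρ i).1, (hρ i).2.1⟩) (fun i h1 h2 h3 => by
          have := (hρ i).2.2 h3
          rw [this]
          simp only [h2, if_false, (mem_attr hG).2 h1, if_true]) ((mem_attr hG).1 hi)
      have hD : ∀ k, ρ (j + k) ∈ D := by
        intro k
        induction k with
        | zero => exact hj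
        | succ k ih =>
          by_cases ho : 𝒢.owner (ρ (j + k)) = ℘
          · have := (hρ (j + k)).2.2 ho
            rw [← add_assoc, this]
            simp only [ih, if_true]
            exact (hf _ ih ho).1
          · exact h.closed _ ih ho _ (hsub (hρ (j + k + 1)).1) (hρ (j + k)).2.1
      rw [← isWonBy_shift j]
      refine hwin _ fun i => ⟨hD i, (hρ (j + i)).2.1, fun ho => ?_⟩
      have := (hρ (j + i)).2.2 ho
      simp only [hD i, if_true] at this
      exact this
    · push Not at hA
      refine hwin' ρ fun i => ?_
      have hi : ρ i ∈ D' := (Finset.mem_union.1 (hρ i).1).resolve_left (hA i)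
      refine ⟨hi, (hρ i).2.1, fun ho => ?_⟩
      have := (hρ i).2.2 ho
      simp only [hA i, if_false] at this
      rw [this]
      refine if_neg fun h => hA i (hDA h)

/-- A player wins everywhere if he wins everywhere outside his attractor of the vertices with
the highest priority, which has his parity. -/
theorem PosDominion.of_rest {d : ℕ} (hG : 𝒢.IsSubgame G) (hd : ℘.HasParity d)
    (hle : ∀ v ∈ G, 𝒢.priority v ≤ d)
    (h : 𝒢.PosDominion (𝒢.rest ℘ d G) ℘ (𝒢.rest ℘ d G)) : 𝒢.PosDominion G ℘ G := by
  unfold rest at h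
  set N := G.filter fun v => 𝒢.priority v = d with hN
  obtain ⟨g, hg⟩ := hG.exists_succ_fun
  obtain ⟨f, hf, hwin⟩ := h.exists_strategy
  obtain ⟨fa, r, hfa⟩ := Att.exists_strategy (fun v => 𝒢.owner v = ℘) 𝒢.Adj N G
  have hNA : N ⊆ 𝒢.attr ℘ N G := 𝒢.subset_attr ℘ (Finset.filter_subset _ _)
  refine ⟨subset_rfl, fun v _ _ w hw _ => hw,
    fun v => if v ∈ N then g v else if v ∈ 𝒢.attr ℘ N G then fa v else f v, ?_, ?_⟩
  · intro v hv ho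
    dsimp only
    split_ifs with h1 h2
    · exact hg v hv
    · have := (hfa v ((mem_attr hG).1 h2) h1).1 ho
      exact ⟨this.1, this.2.1⟩
    · have := hf v (Finset.mem_sdiff.2 ⟨hv, h2⟩) ho
      exact ⟨(Finset.mem_sdiff.1 this.1).1, this.2⟩
  · intro ρ hρ
    -- Infinitely many visits to the attractor force infinitely many occurrences of `d`; otherwise
    -- the play finally stays in the rest, where `f` wins.
    by_cases hA : ∃ᶠ i in Filter.atTop, ρ i ∈ 𝒢.attr ℘ N G
    · refine isWonBy_of_frequently hd (fun i => hle _ (hρ i).1) ?_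
      rw [Filter.frequently_atTop] at hA ⊢
      intro a
      obtain ⟨i, hai, hi⟩ := hA a
      obtain ⟨j, hij, hj⟩ := Att.exists_hit hfa (ρ := ρ) (i := i)
        (fun i => ⟨(hρ i).1, (hρ i).2.1⟩) (fun i h1 h2 h3 => by
          have := (hρ i).2.2 h3
          rw [this]
          simp only [h2, if_false, (mem_attr hG).2 h1, if_true]) ((mem_attr hG).1 hi)
      exact ⟨j, hai.trans hij, (Finset.mem_filter.1 hj).2⟩
    · rw [Filter.not_frequently, Filter.eventually_atTop] at hA
      obtain ⟨k, hk⟩ := hA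
      rw [← isWonBy_shift k]
      refine hwin _ fun i => ?_
      have hi := hk (k + i) (by omega)
      refine ⟨Finset.mem_sdiff.2 ⟨(hρ _).1, hi⟩, (hρ (k + i)).2.1, fun ho => ?_⟩
      have := (hρ (k + i)).2.2 ho
      simp only [hi, if_false] at this
      rw [← add_assoc, this]
      exact if_neg fun h => hi (hNA h)

/-- Zielonka's induction on the number of vertices. Let `℘` have the parity of the maximal priority,
and remove his attractor of the vertices carrying it. If the opponent wins nowhere in the rest, then
`℘` wins everywhere. Otherwise the opponent's region of the rest is a dominion in `G`; its attractor
is removed and the induction is applied a second time. -/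
theorem exists_posDominion_cover (hG : 𝒢.IsSubgame G) :
    ∃ W : Player → Finset V, (∀ ℘, 𝒢.PosDominion G ℘ (W ℘)) ∧ ∀ v ∈ G, ∃ ℘, v ∈ W ℘ := by
  induction hk : G.card using Nat.strong_induction_on generalizing G with
  | _ k ih =>
    subst hk
    rcases G.eq_empty_or_nonempty with rfl | hne
    · exact ⟨fun _ => ∅, fun ℘ => PosDominion.empty _ _, by simp⟩
    obtain ⟨u, hu, hmax⟩ := G.exists_max_image 𝒢.priority hne
    set d := 𝒢.priority u
    obtain ⟨℘, h℘⟩ : ∃ ℘ : Player, ℘.HasParity d := ⟨_, Player.ofParity_hasParity d⟩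
    have hN : (G.filter fun v => 𝒢.priority v = d) ≠ ∅ :=
      Finset.nonempty_iff_ne_empty.1 ⟨u, Finset.mem_filter.2 ⟨hu, rfl⟩⟩
    obtain ⟨W, hW, hcov⟩ := ih _ (𝒢.card_sdiff_attr_lt ℘ (Finset.filter_subset _ _) hN)
      hG.sdiff_attr rfl
    by_cases hemp : W ℘.opp = ∅
    · have hall : W ℘ = 𝒢.rest ℘ d G := by
        refine Finset.Subset.antisymm (hW ℘).subset fun v hv => ?_
        obtain ⟨℘', h'⟩ := hcov v hv
        by_cases h : ℘' = ℘
        · exact h ▸ h'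
        · rw [Player.ne_iff.1 h, hemp] at h'
          simp at h'
      have hP := PosDominion.of_rest hG h℘ hmax (by
        have := hW ℘
        rwa [hall] at this)
      refine ⟨fun ℘' => if ℘' = ℘ then G else ∅, fun ℘' => ?_, fun v hv => ⟨℘, by simpa⟩⟩
      dsimp only
      split_ifs with h
      · exact h ▸ hP
      · exact PosDominion.empty _ _
    · have h1 : 𝒢.PosDominion G ℘.opp (W ℘.opp) := by
        refine PosDominion.of_sdiff_attr (S := G.filter fun v => 𝒢.priority v = d) hG ?_
        rw [Player.opp_opp]
        exact hW ℘.opp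
      obtain ⟨W', hW', hcov'⟩ := ih _ (𝒢.card_sdiff_attr_lt ℘.opp h1.subset hemp)
        hG.sdiff_attr rfl
      refine ⟨fun ℘' => if ℘' = ℘ then W' ℘ else 𝒢.attr ℘.opp (W ℘.opp) G ∪ W' ℘.opp,
        fun ℘' => ?_, fun v hv => ?_⟩
      · dsimp only
        split_ifs with h
        · rw [h]
          exact PosDominion.of_sdiff_attr hG (hW' ℘)
        · rw [Player.ne_iff.1 h]
          exact h1.attr_union hG (hW' ℘.opp)
      · by_cases hA : v ∈ 𝒢.attr ℘.opp (W ℘.opp) G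
        · refine ⟨℘.opp, ?_⟩
          dsimp only
          rw [if_neg ℘.opp_ne]
          exact Finset.mem_union_left _ hA
        · obtain ⟨℘', h'⟩ := hcov' v (Finset.mem_sdiff.2 ⟨hv, hA⟩)
          refine ⟨℘', ?_⟩
          dsimp only
          split_ifs with h
          · exact h ▸ h'
          · rw [Player.ne_iff.1 h] at h'
            exact Finset.mem_union_right _ h'

end

/-- If `℘` can win against a positional dominion of the opponent, the dominion was left. -/
theorem PosDominion.not_mem_of_wins (hG : 𝒢.IsSubgame G) (h : 𝒢.PosDominion G ℘.opp D) {v : V}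
    (hv : v ∈ D) {σ : List V → V} (hσ : 𝒢.IsStrategy G ℘ v σ)
    (hwin : ∀ ρ, 𝒢.Agrees G ℘ v σ ρ → 𝒢.IsWonBy ℘ ρ) : False := by
  obtain ⟨τ, hτ, hτ'⟩ := (h.isDominion hG).2 v hv
  obtain ⟨ρ, h1, h2⟩ := exists_outcome hG (h.subset hv) hσ hτ
  exact (hwin ρ h1).not_opp (hτ' ρ h2).1

/-- Determinacy is applied to the subgame `D` itself. From a vertex of the opponent's region in `D`,
his positional strategy could be played against the dominion strategy of `℘`; the play would stay in
`D` and be won by both. Hence the region of `℘` is all of `D`. -/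
theorem IsDominion.posDominion (hG : 𝒢.IsSubgame G) (h : 𝒢.IsDominion G ℘ D) :
    𝒢.PosDominion G ℘ D := by
  classical
  obtain ⟨g, hg⟩ := hG.exists_succ_fun
  -- whatever the opponent does, the play stays in the dominion
  have hplay : ∀ v ∈ D, ∀ t : V → V, (∀ u ∈ G, t u ∈ G ∧ 𝒢.Adj u (t u)) →
      ∃ ρ : ℕ → V, ρ 0 = v ∧ 𝒢.IsPlay D ρ ∧ 𝒢.IsWonBy ℘ ρ ∧
        ∀ i, 𝒢.owner (ρ i) ≠ ℘ → ρ (i + 1) = t (ρ i) := by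
    intro v hv t ht
    obtain ⟨σ, hσ, hσ'⟩ := h.2 v hv
    obtain ⟨ρ, h1, h2⟩ := exists_outcome hG (h.1 hv) hσ (isStrategy_positional ht v)
    obtain ⟨h3, h4⟩ := hσ' ρ h1
    refine ⟨ρ, h1.2.1, fun i => ⟨h4 i, (h1.1 i).2⟩, h3, fun i ho => ?_⟩
    have := h2.2.2 i (Player.ne_iff.1 ho)
    simpa only [getLastD_playPrefix] using this
  have hD : 𝒢.IsSubgame D := by
    intro v hv
    obtain ⟨ρ, h0, h1, -⟩ := hplay v hv g hg
    exact ⟨ρ 1, (h1 1).1, h0 ▸ (h1 0).2⟩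
  obtain ⟨W, hW, hcov⟩ := exists_posDominion_cover hD
  have hemp : W ℘.opp = ∅ := by
    refine Finset.eq_empty_of_forall_notMem fun v hv => ?_
    obtain ⟨f, hf, hwin⟩ := (hW ℘.opp).exists_strategy
    let t : V → V := fun u => if u ∈ W ℘.opp ∧ 𝒢.owner u ≠ ℘ then f u else g u
    have ht : ∀ u ∈ G, t u ∈ G ∧ 𝒢.Adj u (t u) := by
      intro u hu
      by_cases hc : u ∈ W ℘.opp ∧ 𝒢.owner u ≠ ℘
      · have := hf u hc.1 (Player.ne_iff.1 hc.2)
        simp only [t, hc, ne_eq, not_false_eq_true, and_self, if_true]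
        exact ⟨h.1 ((hW _).subset this.1), this.2⟩
      · simp only [t, hc, if_false]
        exact hg u hu
    obtain ⟨ρ, h0, h1, h2, h3⟩ := hplay v ((hW _).subset hv) t ht
    have hin : ∀ i, ρ i ∈ W ℘.opp := by
      intro i
      induction i with
      | zero => rw [h0]; exact hv
      | succ i ih =>
        by_cases ho : 𝒢.owner (ρ i) = ℘
        · exact (hW ℘.opp).closed _ ih (by rw [ho]; exact ℘.opp_ne.symm) _ (h1 (i + 1)).1 (h1 i).2
        · rw [h3 i ho]
          simp only [t, ih, ho, ne_eq, not_false_eq_true, and_self, if_true]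
          exact (hf _ ih (Player.ne_iff.1 ho)).1
    refine h2.not_opp (hwin ρ fun i => ⟨hin i, (h1 i).2, fun ho => ?_⟩)
    have ho' : 𝒢.owner (ρ i) ≠ ℘ := by rw [ho]; exact ℘.opp_ne
    rw [h3 i ho']
    exact if_pos ⟨hin i, ho'⟩
  have hall : W ℘ = D := by
    refine Finset.Subset.antisymm (hW ℘).subset fun v hv => ?_
    obtain ⟨℘', h'⟩ := hcov v hv
    by_cases h : ℘' = ℘
    · exact h ▸ h'
    · rw [Player.ne_iff.1 h, hemp] at h'
      simp at h'
  refine ⟨h.1, fun v hv ho w hw hvw => ?_, hall ▸ (hW ℘).exists_strategy⟩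
  -- Closedness: the opponent tries the move to `w`, and the play must nevertheless stay in `D`.
  obtain ⟨ρ, h0, h1, -, h3⟩ := hplay v hv (fun u => if u = v then w else g u) (fun u hu => by
    split_ifs with huv
    · exact ⟨hw, huv ▸ hvw⟩
    · exact hg u hu)
  have := h3 0 (h0 ▸ ho)
  rw [h0, if_pos rfl] at this
  exact this ▸ (h1 1).1

theorem isDominion_iff (hG : 𝒢.IsSubgame G) : 𝒢.IsDominion G ℘ D ↔ 𝒢.PosDominion G ℘ D :=
  ⟨fun h => h.posDominion hG, fun h => h.isDominion hG⟩

/-! ## Dominions under the removal of attractors -/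

theorem PosDominion.exists_succ (hG : 𝒢.IsSubgame G) (h : 𝒢.PosDominion G ℘ D) {v : V}
    (hv : v ∈ D) : ∃ w ∈ D, 𝒢.Adj v w := by
  obtain ⟨f, hf, -⟩ := h.exists_strategy
  by_cases ho : 𝒢.owner v = ℘
  · exact ⟨f v, hf v hv ho⟩
  · obtain ⟨w, hw, hvw⟩ := hG v (h.subset hv)
    exact ⟨w, h.closed v hv ho w hw hvw, hvw⟩

/-- The absence of self-loops is used here. It justifies the termination test `p ≤ 1`, and it halves
the number of rounds in the counting. -/
theorem two_le_card_of_exists_succ (h : ∀ v ∈ D, ∃ w ∈ D, 𝒢.Adj v w) (hne : D.Nonempty) :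
    2 ≤ D.card := by
  obtain ⟨v, hv⟩ := hne
  obtain ⟨w, hw, hvw⟩ := h v hv
  exact Finset.one_lt_card.2 ⟨v, hv, w, hw, fun h => 𝒢.irrefl v (by rw [← h] at hvw; exact hvw)⟩

theorem PosDominion.disjoint_attr_opp (hG : 𝒢.IsSubgame G) (h : 𝒢.PosDominion G ℘ D)
    (hS : Disjoint D S) : Disjoint D (𝒢.attr ℘.opp S G) := by
  obtain ⟨f, hf, -⟩ := h.exists_strategy
  refine disjoint_attr hG hS ?_ ?_
  · exact fun v hv ho => h.closed v hv (by rw [ho]; exact ℘.opp_ne)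
  · intro v hv ho
    have ho' : 𝒢.owner v = ℘ := by
      rw [Player.ne_iff, Player.opp_opp] at ho
      exact ho
    exact ⟨f v, h.subset (hf v hv ho').1, (hf v hv ho').2, (hf v hv ho').1⟩

theorem PosDominion.mono {G' : Finset V} (h : 𝒢.PosDominion G ℘ D) (hG' : G' ⊆ G) (hD : D ⊆ G') :
    𝒢.PosDominion G' ℘ D :=
  ⟨hD, fun v hv ho w hw => h.closed v hv ho w (hG' hw), h.exists_strategy⟩

variable [DecidableEq V]

theorem PosDominion.sdiff_attr_opp (hG : 𝒢.IsSubgame G) (h : 𝒢.PosDominion G ℘ D)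
    (hS : Disjoint D S) : 𝒢.PosDominion (G \ 𝒢.attr ℘.opp S G) ℘ D :=
  h.mono Finset.sdiff_subset
    (Finset.subset_sdiff.2 ⟨h.subset, h.disjoint_attr_opp hG hS⟩)

/-- A vertex of `℘` outside his own attractor has no move into it, so the old strategy never enters
the removed part. -/
theorem PosDominion.sdiff_attr (hG : 𝒢.IsSubgame G) (h : 𝒢.PosDominion G ℘ D) :
    𝒢.PosDominion (G \ 𝒢.attr ℘ S G) ℘ (D \ 𝒢.attr ℘ S G) := by
  obtain ⟨f, hf, hwin⟩ := h.exists_strategy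
  refine ⟨Finset.sdiff_subset_sdiff h.subset le_rfl, ?_, f, ?_, ?_⟩
  · intro v hv ho w hw hvw
    rw [Finset.mem_sdiff] at hv hw ⊢
    exact ⟨h.closed v hv.1 ho w hw.1 hvw, hw.2⟩
  · intro v hv ho
    rw [Finset.mem_sdiff] at hv ⊢
    obtain ⟨h1, h2⟩ := hf v hv.1 ho
    exact ⟨⟨h1, fun hA => hv.2 (mem_attr_of_own hG (h.subset hv.1) ho h2 hA)⟩, h2⟩
  · exact fun ρ hρ => hwin ρ fun i => ⟨(Finset.mem_sdiff.1 (hρ i).1).1, (hρ i).2⟩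

/-- A nonempty dominion of the opponent contains one that avoids the highest priority. -/
theorem PosDominion.exists_rest {d : ℕ} (hG : 𝒢.IsSubgame G) (hd : ℘.HasParity d)
    (hle : ∀ v ∈ G, 𝒢.priority v ≤ d) (h : 𝒢.PosDominion G ℘.opp D) (hne : D.Nonempty) :
    ∃ D' ⊆ D, D'.Nonempty ∧ 𝒢.PosDominion (𝒢.rest ℘ d G) ℘.opp D' := by
  classical
  obtain ⟨f, hf, hwin⟩ := h.exists_strategy
  obtain ⟨v₀, hv₀⟩ := hne
  set N := G.filter fun v => 𝒢.priority v = d with hN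
  -- The moves left once the opponent's strategy `f` is fixed. With `own` constantly true, `A` is
  -- plain reachability of `N` along these moves.
  let R : V → V → Prop := fun u w => 𝒢.Adj u w ∧ (𝒢.owner u = ℘.opp → w = f u)
  let A := Att (fun _ => True) R N D
  obtain ⟨g, r, hg⟩ := Att.exists_strategy (fun _ => True) R N D
  have hsucc : ∀ u ∈ D, ∃ w ∈ D, R u w := by
    intro u hu
    by_cases ho : 𝒢.owner u = ℘.opp
    · exact ⟨f u, (hf u hu ho).1, (hf u hu ho).2, fun _ => rfl⟩
    · obtain ⟨w, hw, huw⟩ := h.exists_succ hG hu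
      exact ⟨w, hw, huw, fun ho' => (ho ho').elim⟩
  have hRD : ∀ u ∈ D, ∀ w ∈ G, R u w → w ∈ D := by
    intro u hu w hw huw
    by_cases ho : 𝒢.owner u = ℘.opp
    · rw [huw.2 ho]
      exact (hf u hu ho).1
    · exact h.closed u hu ho w hw huw.1
  -- If `N` were reachable from all of `D`, a path conforming to `f` could revisit `N` forever;
  -- priority `d` would recur and `℘` would win, against the choice of `f`.
  have hD' : (D.filter fun v => ¬ A v).Nonempty := by
    rw [Finset.filter_nonempty_iff]
    by_contra! hall
    choose! s hs using hsucc
    let t : V → V := fun u => if u ∈ N then s u else g u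
    have ht : ∀ u ∈ D, t u ∈ D ∧ R u (t u) := by
      intro u hu
      dsimp only [t]
      split_ifs with hN
      · exact hs u hu
      · have := (hg u (hall u hu) hN).1 trivial
        exact ⟨this.1, this.2.1⟩
    let ρ : ℕ → V := fun i => t^[i] v₀
    have hρs : ∀ i, ρ (i + 1) = t (ρ i) := fun i => Function.iterate_succ_apply' _ _ _
    have hρD : ∀ i, ρ i ∈ D := by
      intro i
      induction i with
      | zero => exact hv₀
      | succ i ih => rw [hρs]; exact (ht _ ih).1
    have hρR : ∀ i, R (ρ i) (ρ (i + 1)) := fun i => by rw [hρs]; exact (ht _ (hρD i)).2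
    have hw1 : 𝒢.IsWonBy ℘.opp ρ := hwin ρ fun i => ⟨hρD i, (hρR i).1, (hρR i).2⟩
    refine IsWonBy.not_opp (isWonBy_of_frequently hd (fun i => hle _ (h.subset (hρD i))) ?_) hw1
    rw [Filter.frequently_atTop]
    intro i
    obtain ⟨j, hij, hj⟩ := Att.exists_hit hg (ρ := ρ) (i := i) (fun i => ⟨hρD i, hρR i⟩)
      (fun i _ h2 _ => by rw [hρs]; exact if_neg h2) (hall _ (hρD i))
    exact ⟨j, hij, (Finset.mem_filter.1 hj).2⟩
  have hcl : ∀ u ∈ D.filter fun v => ¬ A v, ∀ w ∈ G, R u w → w ∈ D.filter fun v => ¬ A v := by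
    intro u hu w hw huw
    rw [Finset.mem_filter] at hu ⊢
    have hwD := hRD u hu.1 w hw huw
    exact ⟨hwD, fun hA => hu.2 (Att.of_own (own := fun _ => True) hu.1 trivial hwD huw hA)⟩
  have hf' : ∀ u ∈ D.filter fun v => ¬ A v, 𝒢.owner u = ℘.opp →
      f u ∈ (D.filter fun v => ¬ A v) ∧ 𝒢.Adj u (f u) := by
    intro u hu ho
    obtain ⟨h1, h2⟩ := hf u (Finset.mem_filter.1 hu).1 ho
    exact ⟨hcl u hu _ (h.subset h1) ⟨h2, fun _ => rfl⟩, h2⟩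
  have hcl' : ∀ u ∈ D.filter fun v => ¬ A v, 𝒢.owner u ≠ ℘.opp → ∀ w ∈ G, 𝒢.Adj u w →
      w ∈ D.filter fun v => ¬ A v :=
    fun u hu ho w hw huw => hcl u hu w hw ⟨huw, fun ho' => (ho ho').elim⟩
  refine ⟨D.filter fun v => ¬ A v, Finset.filter_subset _ _, hD', ?_⟩
  have hPD : 𝒢.PosDominion G ℘.opp (D.filter fun v => ¬ A v) :=
    ⟨(Finset.filter_subset _ _).trans h.subset, hcl', f, hf',
      fun ρ hρ => hwin ρ fun i => ⟨(Finset.mem_filter.1 (hρ i).1).1, (hρ i).2⟩⟩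
  have hdis : Disjoint (D.filter fun v => ¬ A v) N := by
    refine Finset.disjoint_left.2 fun u hu huN => ?_
    rw [Finset.mem_filter] at hu
    exact hu.2 (Att.base hu.1 huN)
  have := hPD.sdiff_attr_opp hG hdis
  rwa [Player.opp_opp] at this

end ParityGame

namespace ParityGame

variable {V : Type*} {𝒢 : ParityGame V} {℘ : Player} {G : Finset V}

theorem isSubgame_empty : 𝒢.IsSubgame ∅ := fun v hv => by simp at hv

theorem two_le_card [Fintype V] [Nonempty V] (𝒢 : ParityGame V) : 2 ≤ Fintype.card V :=
  two_le_card_of_exists_succ (𝒢 := 𝒢) (D := Finset.univ)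
    (fun v _ => by simpa using 𝒢.exists_succ v) Finset.univ_nonempty

variable [DecidableEq V]

/-! ## Correctness of the algorithm -/

/-- The last call returns the empty set, whose attractor is empty in a subgame. So the last `H` is
still the rest of the final set, and that call bears witness about the final set. -/
theorem repeatLoop_spec {d : ℕ} {call : Finset V → Finset V × List (Call V)}
    (hcall : ∀ X, (call X).1 ⊆ X) {P : Finset V → Prop} (hP : ∀ X, P X → 𝒢.IsSubgame X)
    (hstep : ∀ X, P X → P (X \ 𝒢.attr ℘.opp (call (𝒢.rest ℘ d X)).1 X)) (hG : P G) :
    P (𝒢.repeatLoop ℘ d call G).1 ∧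
    (𝒢.repeatLoop ℘ d call G).2.1 = 𝒢.rest ℘ d (𝒢.repeatLoop ℘ d call G).1 ∧
    (call (𝒢.repeatLoop ℘ d call G).2.1).1 = ∅ := by
  induction hk : G.card using Nat.strong_induction_on generalizing G with
  | _ k ih =>
    subst hk
    rw [𝒢.repeatLoop_eq ℘ d call hcall G]
    dsimp only
    split_ifs with h
    · simp only [h, attr_empty (hP G hG), Finset.sdiff_empty, and_true]
      exact hG
    · exact ih _ (𝒢.card_sdiff_attr_lt _ ((hcall _).trans (𝒢.rest_subset _ _ _)) h)
        (hstep G hG) rfl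

/-- The number of iterations of a loop is bounded if each successful call returns at least
two vertices. -/
theorem repeatLoop_length_le {d T : ℕ} {call : Finset V → Finset V × List (Call V)}
    (hcall : ∀ X, (call X).1 ⊆ X) {P : Finset V → Prop}
    (hstep : ∀ X, P X → P (X \ 𝒢.attr ℘.opp (call (𝒢.rest ℘ d X)).1 X))
    (hT : ∀ X, P X → (call (𝒢.rest ℘ d X)).2.length ≤ T)
    (hcard : ∀ X, P X → (call (𝒢.rest ℘ d X)).1 ≠ ∅ → 2 ≤ (call (𝒢.rest ℘ d X)).1.card)
    (hG : P G) :
    ∃ k, (𝒢.repeatLoop ℘ d call G).2.2.length ≤ (k + 1) * T ∧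
      2 * k + (𝒢.repeatLoop ℘ d call G).1.card ≤ G.card := by
  induction hk : G.card using Nat.strong_induction_on generalizing G with
  | _ k ih =>
    subst hk
    rw [𝒢.repeatLoop_eq ℘ d call hcall G]
    dsimp only
    split_ifs with h
    -- `k` counts the successful calls; the final unsuccessful one accounts for the additional `T`.
    · exact ⟨0, by simpa using hT G hG,
        by simpa using Finset.card_le_card Finset.sdiff_subset⟩
    · dsimp only
      have hW := (hcall _).trans (𝒢.rest_subset ℘ d G)
      obtain ⟨j, h1, h2⟩ := ih _ (𝒢.card_sdiff_attr_lt ℘.opp hW h) (hstep G hG) rfl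
      have h3 := Finset.card_sdiff_add_card_eq_card (attr_subset (𝒢 := 𝒢) (℘ := ℘.opp)
        (S := (call (𝒢.rest ℘ d G)).1) (G := G))
      have h4 := Finset.card_le_card (𝒢.subset_attr ℘.opp hW)
      have h5 := hcard G hG h
      have h6 := hT G hG
      refine ⟨j + 1, ?_, by omega⟩
      rw [List.length_append, add_mul (j + 1) 1 T, one_mul, add_comm]
      exact Nat.add_le_add h1 h6

theorem IsSubgame.rest (hG : 𝒢.IsSubgame G) (d : ℕ) : 𝒢.IsSubgame (𝒢.rest ℘ d G) :=
  hG.sdiff_attr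

/-- Only attractors are ever removed. Together with `two_le_card_of_exists_succ` this shows that a
successful call returns at least two vertices. -/
theorem IsSubgame.run (hG : 𝒢.IsSubgame G) (d p q : ℕ) : 𝒢.IsSubgame (𝒢.run ℘ G d p q).1 := by
  cases d with
  | zero => simpa [ParityGame.run] using isSubgame_empty
  | succ d =>
    rw [ParityGame.run]
    have hloop : ∀ X, 𝒢.IsSubgame X → 𝒢.IsSubgame (𝒢.repeatLoop ℘ (d + 1)
        (fun X => 𝒢.run ℘.opp X d (q / 2) p) X).1 := fun X hX =>
      (repeatLoop_spec (fun X => 𝒢.run_subset _ _ _ _ _) (fun _ h => h)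
        (fun X hX => hX.sdiff_attr) hX).1
    dsimp only
    split_ifs with h1 h2
    · exact isSubgame_empty
    · exact (hloop _ hG).sdiff_attr
    · exact hloop _ (hloop _ hG).sdiff_attr

theorem priority_le_of_mem_rest {d : ℕ} (hle : ∀ v ∈ G, 𝒢.priority v ≤ d + 1) :
    ∀ v ∈ 𝒢.rest ℘ (d + 1) G, 𝒢.priority v ≤ d := by
  intro v hv
  obtain ⟨h1, h2⟩ := Finset.mem_sdiff.1 hv
  have h3 : 𝒢.priority v ≠ d + 1 := fun h =>
    h2 (𝒢.subset_attr ℘ (Finset.filter_subset _ _) (Finset.mem_filter.2 ⟨h1, h⟩))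
  have := hle v h1
  omega

theorem PosDominion.eq_empty_of_card_le_one {D : Finset V} (hG : 𝒢.IsSubgame G)
    (h : 𝒢.PosDominion G ℘ D) (hD : D.card ≤ 1) : D = ∅ := by
  by_contra hne
  have := two_le_card_of_exists_succ (𝒢 := 𝒢) (fun v hv => h.exists_succ hG hv)
    (Finset.nonempty_iff_ne_empty.2 hne)
  omega

/-- The invariant `P` says that small dominions of `℘` remain entirely, and that every dominion of
the opponent remains a dominion as far as it is still present. The second claim then follows by
comparing what is left of `D` with `q / 2` before and after the call with full precision. -/
theorem solve_posDominion {d p q : ℕ} (hG : 𝒢.IsSubgame G) (hd : ℘.HasParity d)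
    (hle : ∀ v ∈ G, 𝒢.priority v ≤ d) :
    (∀ D, 𝒢.PosDominion G ℘ D → D.card ≤ p → D ⊆ 𝒢.solve ℘ G d p q) ∧
    (∀ D, 𝒢.PosDominion G ℘.opp D → D.card ≤ q → Disjoint D (𝒢.solve ℘ G d p q)) := by
  induction d generalizing ℘ G p q with
  | zero =>
    have : G = ∅ := Finset.eq_empty_of_forall_notMem fun v hv => by
      have := hle v hv
      have := 𝒢.priority_pos v
      omega
    subst this
    exact ⟨fun D hD _ => hD.subset.trans (Finset.empty_subset _),
      fun D hD _ => by rw [Finset.subset_empty.1 hD.subset]; exact Finset.disjoint_empty_left _⟩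
  | succ d ih =>
    -- what is preserved when the algorithm removes vertices
    let P : Finset V → Prop := fun X => X ⊆ G ∧ 𝒢.IsSubgame X ∧
      (∀ D, 𝒢.PosDominion G ℘ D → D.card ≤ p → 𝒢.PosDominion X ℘ D) ∧
      (∀ D, 𝒢.PosDominion G ℘.opp D → 𝒢.PosDominion X ℘.opp (D ∩ X))
    have hrest : ∀ X, P X → ∀ v ∈ 𝒢.rest ℘ (d + 1) X, 𝒢.priority v ≤ d := fun X hX =>
      priority_le_of_mem_rest fun v hv => hle v (hX.1 hv)
    -- The subcall belongs to the opponent: `q'` is his own precision, and `p` guards the dominions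
    -- of `℘`.
    have hrec : ∀ X, P X → ∀ q', _ := fun X hX q' =>
      ih (℘ := ℘.opp) (p := q') (q := p) (hX.2.1.rest (℘ := ℘) (d + 1)) hd.opp_pred (hrest X hX)
    have hstep : ∀ q' X, P X →
        P (X \ 𝒢.attr ℘.opp (𝒢.run ℘.opp (𝒢.rest ℘ (d + 1) X) d q' p).1 X) := by
      intro q' X hX
      refine ⟨Finset.sdiff_subset.trans hX.1, hX.2.1.sdiff_attr, fun D hD hp => ?_,
        fun D hD => ?_⟩
      -- The part of `D` in the rest is a dominion there with at most `p` vertices, so by induction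
      -- the returned set avoids it; hence its attractor avoids `D`.
      · have h1 := hX.2.2.1 D hD hp
        refine h1.sdiff_attr_opp hX.2.1 ?_
        have h2 := h1.sdiff_attr (S := X.filter fun v => 𝒢.priority v = d + 1) hX.2.1
        have h3 := (hrec X hX q').2 _ (by rw [Player.opp_opp]; exact h2)
          ((Finset.card_le_card Finset.sdiff_subset).trans hp)
        refine Finset.disjoint_left.2 fun v hvD hvW => ?_
        have hvr := 𝒢.run_subset _ _ _ _ _ hvW
        exact Finset.disjoint_left.1 h3
          (Finset.mem_sdiff.2 ⟨hvD, (Finset.mem_sdiff.1 hvr).2⟩) hvW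
      · have h1 := (hX.2.2.2 D hD).sdiff_attr
          (S := (𝒢.run ℘.opp (𝒢.rest ℘ (d + 1) X) d q' p).1) hX.2.1
        have h2 : ∀ A : Finset V, (D ∩ X) \ A = D ∩ (X \ A) := fun A => by
          ext v
          simp only [Finset.mem_sdiff, Finset.mem_inter]
          tauto
        rwa [h2] at h1
    have hPG : P G := ⟨subset_rfl, hG, fun D hD _ => hD, fun D hD => by
      rwa [Finset.inter_eq_left.2 hD.subset]⟩
    -- a nonempty dominion of the opponent meets the result of a sufficiently precise call
    have hsmall : ∀ X, P X → ∀ D, 𝒢.PosDominion G ℘.opp D → (D ∩ X).Nonempty → ∀ q',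
        (∀ D' ⊆ D ∩ X, D'.card ≤ q') → ∃ D' ⊆ D ∩ X, D'.Nonempty ∧
          𝒢.PosDominion (𝒢.rest ℘ (d + 1) X) ℘.opp D' ∧
          D' ⊆ (𝒢.run ℘.opp (𝒢.rest ℘ (d + 1) X) d q' p).1 := by
      intro X hX D hD hne q' hq'
      obtain ⟨D', h1, h2, h3⟩ := (hX.2.2.2 D hD).exists_rest hX.2.1 hd
        (fun v hv => hle v (hX.1 hv)) hne
      exact ⟨D', h1, h2, h3, (hrec X hX q').1 D' h3 (hq' D' h1)⟩
    unfold solve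
    rw [run]
    dsimp only
    have hloop : ∀ X, P X → _ := fun X hX => repeatLoop_spec (𝒢 := 𝒢) (℘ := ℘) (d := d + 1)
      (call := fun X => 𝒢.run ℘.opp X d (q / 2) p) (fun X => 𝒢.run_subset _ _ _ _ _)
      (P := P) (fun X hX => hX.2.1) (hstep (q / 2)) hX
    split_ifs with h1 h2
    · refine ⟨fun D hD hp => ?_, fun D _ _ => Finset.disjoint_empty_right _⟩
      rcases h1 with rfl | h1
      · exact hD.subset
      · rw [hD.eq_empty_of_card_le_one hG (hp.trans h1)]
    · obtain ⟨hP1, hH, hW⟩ := hloop G hPG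
      set G₁ := (𝒢.repeatLoop ℘ (d + 1) (fun X => 𝒢.run ℘.opp X d (q / 2) p) G).1
      rw [hH] at h2 hW ⊢
      rw [h2, attr_empty hP1.2.1, Finset.sdiff_empty]
      refine ⟨fun D hD hp => (hP1.2.2.1 D hD hp).subset, fun D hD hq => ?_⟩
      rw [Finset.disjoint_iff_inter_eq_empty]
      by_contra hne
      -- The call with full precision returned nothing, although it would have to contain `D'`.
      obtain ⟨D', -, h4, -, h5⟩ := hsmall G₁ hP1 D hD (Finset.nonempty_iff_ne_empty.2 hne) q
        fun D' hD' => (Finset.card_le_card (hD'.trans Finset.inter_subset_left)).trans hq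
      rw [h2, Finset.subset_empty] at h5
      exact h4.ne_empty h5
    · obtain ⟨hP1, hH, hW⟩ := hloop G hPG
      set G₁ := (𝒢.repeatLoop ℘ (d + 1) (fun X => 𝒢.run ℘.opp X d (q / 2) p) G).1
      rw [hH] at h2 hW ⊢
      have hP2 := hstep q G₁ hP1
      obtain ⟨hP3, hH3, hW3⟩ := hloop _ hP2
      have hsub3 := 𝒢.repeatLoop_subset ℘ (d + 1) (fun X => 𝒢.run ℘.opp X d (q / 2) p)
        (G₁ \ 𝒢.attr ℘.opp (𝒢.run ℘.opp (𝒢.rest ℘ (d + 1) G₁) d q p).1 G₁)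
      set G₃ := (𝒢.repeatLoop ℘ (d + 1) (fun X => 𝒢.run ℘.opp X d (q / 2) p)
        (G₁ \ 𝒢.attr ℘.opp (𝒢.run ℘.opp (𝒢.rest ℘ (d + 1) G₁) d q p).1 G₁)).1
      rw [hH3] at hW3
      refine ⟨fun D hD hp => (hP3.2.2.1 D hD hp).subset, fun D hD hq => ?_⟩
      rw [Finset.disjoint_iff_inter_eq_empty]
      by_contra hne
      rw [← ne_eq, ← Finset.nonempty_iff_ne_empty] at hne
      have hsub1 := hsub3.trans Finset.sdiff_subset
      obtain ⟨D', h3, h4, h5, h6⟩ := hsmall G₁ hP1 D hD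
        (hne.mono (Finset.inter_subset_inter_left hsub1)) q
        fun D' hD' => (Finset.card_le_card (hD'.trans Finset.inter_subset_left)).trans hq
      -- Otherwise the last halved call of the first loop, which returned nothing, would contain
      -- `D'`.
      have hbig : q / 2 < D'.card := by
        by_contra hle'
        have := (hrec G₁ hP1 (q / 2)).1 D' h5 (not_lt.1 hle')
        unfold solve at this
        rw [hW, Finset.subset_empty] at this
        exact h4.ne_empty this
      have hdis : Disjoint D' (D ∩ G₃) := by
        refine Finset.disjoint_left.2 fun v hv hv3 => ?_
        have := (Finset.mem_sdiff.1 (hsub3 (Finset.mem_inter.1 hv3).2)).2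
        exact this (𝒢.subset_attr _ ((𝒢.run_subset _ _ _ _ _).trans (𝒢.rest_subset _ _ _))
          (h6 hv))
      -- At least `q / 2 + 1` of the at most `q` vertices of `D` have been removed with `D'`.
      have hcard : (D ∩ G₃).card ≤ q / 2 := by
        have h7 := Finset.card_le_card (Finset.union_subset
          (h3.trans Finset.inter_subset_left) (Finset.inter_subset_left : D ∩ G₃ ⊆ D))
        rw [Finset.card_union_of_disjoint hdis] at h7
        omega
      obtain ⟨D'', h7, h8, h9, h10⟩ := hsmall G₃ hP3 D hD hne (q / 2)
        fun D' hD' => (Finset.card_le_card hD').trans hcard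
      rw [hW3, Finset.subset_empty] at h10
      exact h8.ne_empty h10

theorem solve_dominion {d p q : ℕ} (hG : 𝒢.IsSubgame G) (hd : ℘.HasParity d)
    (hle : ∀ v ∈ G, 𝒢.priority v ≤ d) :
    (∀ D, 𝒢.IsDominion G ℘ D → D.card ≤ p → D ⊆ 𝒢.solve ℘ G d p q) ∧
    (∀ D, 𝒢.IsDominion G ℘.opp D → D.card ≤ q → Disjoint D (𝒢.solve ℘ G d p q)) := by
  simp only [isDominion_iff hG]
  exact solve_posDominion hG hd hle

/-- The two positional dominions that cover `G` have at most `G.card` vertices, so the returned set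
contains one and avoids the other. They are the winning regions, as no strategy wins against a
positional dominion of the opponent. -/
theorem winningRegion_eq {d : ℕ} (hG : 𝒢.IsSubgame G) (hd : ℘.HasParity d)
    (hle : ∀ v ∈ G, 𝒢.priority v ≤ d) :
    𝒢.winningRegion G ℘ = (𝒢.solve ℘ G d G.card G.card : Finset V) ∧
    𝒢.winningRegion G ℘.opp = (G \ 𝒢.solve ℘ G d G.card G.card : Finset V) := by
  obtain ⟨W, hW, hcov⟩ := exists_posDominion_cover hG
  obtain ⟨h1, h2⟩ := solve_posDominion (p := G.card) (q := G.card) hG hd hle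
  have hsub : 𝒢.solve ℘ G d G.card G.card ⊆ G := 𝒢.run_subset _ _ _ _ _
  have h3 := h1 _ (hW ℘) (Finset.card_le_card (hW ℘).subset)
  have h4 := h2 _ (hW ℘.opp) (Finset.card_le_card (hW ℘.opp).subset)
  have hreg : ∀ ℘', 𝒢.winningRegion G ℘' = (W ℘' : Set V) := by
    intro ℘'
    ext v
    constructor
    · rintro ⟨hv, σ, hσ, hwin⟩
      obtain ⟨℘'', hv'⟩ := hcov v hv
      by_cases h : ℘'' = ℘'
      · exact h ▸ hv'
      · rw [Player.ne_iff.1 h] at hv'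
        exact ((hW _).not_mem_of_wins hG hv' hσ hwin).elim
    · intro hv
      obtain ⟨σ, hσ, hwin⟩ := ((hW ℘').isDominion hG).2 v hv
      exact ⟨(hW ℘').subset hv, σ, hσ, fun ρ hρ => (hwin ρ hρ).1⟩
  have hor : ∀ v ∈ G, v ∈ W ℘ ∨ v ∈ W ℘.opp := by
    intro v hv
    obtain ⟨℘', h'⟩ := hcov v hv
    by_cases h : ℘' = ℘
    · exact Or.inl (h ▸ h')
    · exact Or.inr (Player.ne_iff.1 h ▸ h')
  rw [hreg, hreg, Finset.coe_inj, Finset.coe_inj]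
  constructor
  · refine h3.antisymm fun v hv => (hor v (hsub hv)).resolve_right fun h => ?_
    exact Finset.disjoint_left.1 h4 h hv
  · refine Finset.Subset.antisymm ?_ fun v hv => ?_
    · exact Finset.subset_sdiff.2 ⟨(hW _).subset, h4⟩
    · rw [Finset.mem_sdiff] at hv
      exact (hor v hv.1).resolve_left fun h => hv.2 (h3 h)

/-! ## The number of calls -/

theorem length_calls_of_ownPrec_le_one {d p q : ℕ} (hp : p ≤ 1) :
    (𝒢.calls ℘ G d p q).length = 1 := by
  cases d with
  | zero => simp [calls, run]
  | succ d => simp [calls, run, hp]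

/-- Both loops share one budget: every successful call, including the one with full precision,
removes at least two of the `n` vertices. -/
theorem length_calls_succ_le [Fintype V] {d p q T T' : ℕ} (hG : 𝒢.IsSubgame G)
    (hT : ∀ X, 𝒢.IsSubgame X → (𝒢.calls ℘.opp X d (q / 2) p).length ≤ T)
    (hT' : ∀ X, 𝒢.IsSubgame X → (𝒢.calls ℘.opp X d q p).length ≤ T') :
    (𝒢.calls ℘ G (d + 1) p q).length ≤ 1 + (Fintype.card V / 2 + 1) * T + T' := by
  have hsub : ∀ q' X, 𝒢.IsSubgame X → (𝒢.run ℘.opp (𝒢.rest ℘ (d + 1) X) d q' p).1 ≠ ∅ →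
      2 ≤ (𝒢.run ℘.opp (𝒢.rest ℘ (d + 1) X) d q' p).1.card := fun q' X hX hne =>
    two_le_card_of_exists_succ (𝒢 := 𝒢) ((hX.rest (d + 1)).run d q' p)
      (Finset.nonempty_iff_ne_empty.2 hne)
  have hloop : ∀ X, 𝒢.IsSubgame X → _ := fun X hX => repeatLoop_length_le (𝒢 := 𝒢) (℘ := ℘)
    (d := d + 1) (T := T) (call := fun X => 𝒢.run ℘.opp X d (q / 2) p)
    (fun X => 𝒢.run_subset _ _ _ _ _) (P := 𝒢.IsSubgame) (fun X hX => hX.sdiff_attr)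
    (fun X hX => hT _ (hX.rest (d + 1))) (hsub (q / 2)) hX
  have hspec := repeatLoop_spec (𝒢 := 𝒢) (℘ := ℘) (d := d + 1)
    (call := fun X => 𝒢.run ℘.opp X d (q / 2) p) (fun X => 𝒢.run_subset _ _ _ _ _)
    (P := 𝒢.IsSubgame) (fun _ h => h) (fun X hX => hX.sdiff_attr) hG
  obtain ⟨k, hk1, hk2⟩ := hloop G hG
  obtain ⟨hG1, hH, -⟩ := hspec
  have hGV := Finset.card_le_univ G
  unfold calls at *
  rw [run]
  dsimp only
  set r₁ := 𝒢.repeatLoop ℘ (d + 1) (fun X => 𝒢.run ℘.opp X d (q / 2) p) G with hr₁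
  rw [hH]
  set W := (𝒢.run ℘.opp (𝒢.rest ℘ (d + 1) r₁.1) d q p).1 with hW
  have hc := hT' _ (hG1.rest (℘ := ℘) (d + 1))
  split_ifs with h1 h2
  · rw [List.length_singleton]
    omega
  · rw [List.length_cons, List.length_append]
    have : (k + 1) * T ≤ (Fintype.card V / 2 + 1) * T := Nat.mul_le_mul_right _ (by omega)
    omega
  · have hWG : W ⊆ r₁.1 := (𝒢.run_subset _ _ _ _ _).trans (𝒢.rest_subset _ _ _)
    obtain ⟨j, hj1, hj2⟩ := hloop (r₁.1 \ 𝒢.attr ℘.opp W r₁.1) hG1.sdiff_attr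
    have h3 := Finset.card_sdiff_add_card_eq_card (attr_subset (𝒢 := 𝒢) (℘ := ℘.opp)
      (S := W) (G := r₁.1))
    have h4 := Finset.card_le_card (𝒢.subset_attr ℘.opp hWG)
    have h5 : 2 ≤ W.card := hsub q _ hG1 h2
    rw [List.length_cons, List.length_append, List.length_append]
    -- The two vertices removed by the call with full precision pay for the second unsuccessful
    -- halved call: `2 k + 2 + 2 j ≤ n`.
    have : (k + 1) * T + (j + 1) * T ≤ (Fintype.card V / 2 + 1) * T := by
      rw [← add_mul]
      exact Nat.mul_le_mul_right _ (by omega)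
    omega

/-- Halving `q` lowers the sum of the logarithms by one, while swapping the precisions keeps it. The
recurrence is then Pascal's rule for `(d + ℓ).choose ℓ`, weighted by powers of the base. The base `n
/ 2 + 1`, sharper than `n`, is needed for the running time. -/
theorem length_calls_le [Fintype V] {d p q : ℕ} (hG : 𝒢.IsSubgame G) (hp : 1 ≤ p) (hq : 1 ≤ q) :
    (𝒢.calls ℘ G d p q).length + 1 ≤
      2 * (Fintype.card V / 2 + 1) ^ (Nat.log 2 p + Nat.log 2 q) *
        (d + (Nat.log 2 p + Nat.log 2 q)).choose (Nat.log 2 p + Nat.log 2 q) := by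
  set h := Fintype.card V / 2 + 1 with hh
  have hpos : ∀ d ℓ : ℕ, 2 ≤ 2 * h ^ ℓ * (d + ℓ).choose ℓ := by
    intro d ℓ
    have h1 : 0 < h ^ ℓ := pow_pos (by omega) _
    have h2 : 0 < (d + ℓ).choose ℓ := Nat.choose_pos (by omega)
    have := Nat.mul_pos h1 h2
    rw [mul_assoc]
    omega
  induction d generalizing ℘ G p q with
  | zero =>
    have : (𝒢.calls ℘ G 0 p q).length = 1 := by simp [calls, run]
    rw [this]
    exact hpos 0 _
  | succ d ih =>
    by_cases hp1 : p ≤ 1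
    · rw [length_calls_of_ownPrec_le_one hp1]
      exact hpos _ _
    obtain ⟨a, ha⟩ : ∃ a, Nat.log 2 p = a + 1 := ⟨Nat.log 2 (p / 2), Nat.log_of_one_lt_of_le
      (by norm_num) (by omega)⟩
    -- Here every subcall has own precision at most `1` and stops at once, so no induction is
    -- needed.
    by_cases hq1 : q ≤ 1
    · have hb : Nat.log 2 q = 0 := Nat.log_of_lt (by omega)
      have := length_calls_succ_le (℘ := ℘) (d := d) (p := p) (q := q) (T := 1) (T' := 1) hG
        (fun X hX => (length_calls_of_ownPrec_le_one (by omega)).le)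
        (fun X hX => (length_calls_of_ownPrec_le_one (by omega)).le)
      refine (Nat.add_le_add_right this 1).trans ?_
      rw [← hh, ha, hb, add_zero]
      have h0 : 1 ≤ h := hh ▸ Nat.le_add_left _ _
      have h1 : 1 ≤ h ^ a := Nat.one_le_pow _ _ h0
      have h2 : 2 ≤ (d + 1 + (a + 1)).choose (a + 1) := by
        rw [← add_assoc, Nat.choose_succ_succ']
        have h3 : 0 < (d + 1 + a).choose a := Nat.choose_pos (by omega)
        have h4 : 0 < (d + 1 + a).choose (a + 1) := Nat.choose_pos (by omega)
        omega
      calc 1 + h * 1 + 1 + 1 ≤ 2 * (1 * h) * 2 := by omega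
        _ ≤ 2 * (h ^ a * h) * (d + 1 + (a + 1)).choose (a + 1) := by gcongr
        _ = _ := by rw [pow_succ]
    · obtain ⟨b, hb⟩ : ∃ b, Nat.log 2 (q / 2) = b ∧ Nat.log 2 q = b + 1 := ⟨_, rfl,
        Nat.log_of_one_lt_of_le (by norm_num) (by omega)⟩
      have h1 := length_calls_succ_le (℘ := ℘) (d := d) (p := p) (q := q) hG
        (fun X hX => Nat.le_sub_of_add_le (ih (℘ := ℘.opp) (p := q / 2) (q := p) hX (by omega) hp))
        (fun X hX => Nat.le_sub_of_add_le (ih (℘ := ℘.opp) (p := q) (q := p) hX hq hp))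
      have e1 : Nat.log 2 (q / 2) + Nat.log 2 p = a + b + 1 := by omega
      have e2 : Nat.log 2 q + Nat.log 2 p = a + b + 2 := by omega
      have e3 : Nat.log 2 p + Nat.log 2 q = a + b + 2 := by omega
      rw [e1, e2, ← hh] at h1
      rw [e3]
      set ℓ := a + b + 1
      change _ ≤ 2 * h ^ (ℓ + 1) * (d + 1 + (ℓ + 1)).choose (ℓ + 1)
      have e4 : (d + 1 + (ℓ + 1)).choose (ℓ + 1) =
          (d + 1 + ℓ).choose ℓ + (d + (ℓ + 1)).choose (ℓ + 1) := by
        rw [show d + 1 + (ℓ + 1) = (d + 1 + ℓ) + 1 by omega, Nat.choose_succ_succ,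
          show d + 1 + ℓ = d + (ℓ + 1) by omega]
      have e5 : (d + ℓ).choose ℓ ≤ (d + 1 + ℓ).choose ℓ := Nat.choose_le_choose _ (by omega)
      have h2 := hpos d ℓ
      have h3 := hpos d (ℓ + 1)
      rw [e4]
      -- The `- 1` in the bound for each of the `h` halved calls absorbs the call itself, as `h ≥
      -- 1`.
      have h4 : h * (2 * h ^ ℓ * (d + ℓ).choose ℓ - 1) + h ≤
          2 * h ^ (ℓ + 1) * (d + 1 + ℓ).choose ℓ := by
        calc _ = h * (2 * h ^ ℓ * (d + ℓ).choose ℓ - 1 + 1) := by ring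
          _ = h * (2 * h ^ ℓ * (d + ℓ).choose ℓ) := by rw [Nat.sub_add_cancel (by omega)]
          _ = 2 * h ^ (ℓ + 1) * (d + ℓ).choose ℓ := by rw [pow_succ]; ring
          _ ≤ _ := by gcongr
      rw [mul_add]
      change _ ≤ 1 + _ + (2 * h ^ (ℓ + 1) * (d + (ℓ + 1)).choose (ℓ + 1) - 1) at h1
      have h5 : 1 ≤ h := by omega
      omega

theorem length_calls_le_pow [Fintype V] [Nonempty V] {d p q ℓ : ℕ} (hG : 𝒢.IsSubgame G)
    (hp : 1 ≤ p) (hq : 1 ≤ q) (hℓ : ℓ = Nat.log 2 p + Nat.log 2 q) :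
    ((𝒢.calls ℘ G d p q).length : ℤ) ≤
      2 * (Fintype.card V : ℤ) ^ ℓ * ((d + ℓ).choose ℓ : ℤ) - 1 := by
  have h1 := length_calls_le (℘ := ℘) (d := d) hG hp hq
  rw [← hℓ] at h1
  have h2 : (Fintype.card V / 2 + 1) ^ ℓ ≤ Fintype.card V ^ ℓ :=
    -- `n / 2 + 1 ≤ n` requires `n ≥ 2`, which holds as there are no self-loops.
    Nat.pow_le_pow_left (by have := 𝒢.two_le_card; omega) _
  have h3 : (𝒢.calls ℘ G d p q).length + 1 ≤
      2 * Fintype.card V ^ ℓ * (d + ℓ).choose ℓ := h1.trans (by gcongr)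
  have : (((𝒢.calls ℘ G d p q).length + 1 : ℕ) : ℤ) ≤
      ((2 * Fintype.card V ^ ℓ * (d + ℓ).choose ℓ : ℕ) : ℤ) := by exact_mod_cast h3
  push_cast at this
  linarith

end ParityGame

/-! ## Reasoning about programs of the machine -/

namespace RAM

variable {w S : ℕ}

/-- Assignment to a memory cell. -/
def State.put (s : State) (i x : ℕ) : State := { s with mem := Function.update s.mem i x }

/-- Output of a number. -/
def State.print (s : State) (x : ℕ) : State := { s with out := s.out ++ [x] }

theorem State.set_reg (s : State) (r x r' : ℕ) :
    (s.set r x).reg r' = if r' = r then x else s.reg r' := Function.update_apply _ _ _ _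
theorem State.set_mem (s : State) (r x : ℕ) : (s.set r x).mem = s.mem := rfl
theorem State.set_out (s : State) (r x : ℕ) : (s.set r x).out = s.out := rfl
theorem State.put_reg (s : State) (i x : ℕ) : (s.put i x).reg = s.reg := rfl
theorem State.put_mem (s : State) (i x j : ℕ) :
    (s.put i x).mem j = if j = i then x else s.mem j := Function.update_apply _ _ _ _
theorem State.put_out (s : State) (i x : ℕ) : (s.put i x).out = s.out := rfl
theorem State.print_reg (s : State) (x : ℕ) : (s.print x).reg = s.reg := rfl
theorem State.print_mem (s : State) (x : ℕ) : (s.print x).mem = s.mem := rfl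
theorem State.print_out (s : State) (x : ℕ) : (s.print x).out = s.out ++ [x] := rfl

/-- Started in `s` at time `t`, the program `P` halts in a state and at a time that
satisfy `Q`. -/
def WP (w S : ℕ) (P : Prog) (Q : State → ℕ → Prop) (s : State) (t : ℕ) : Prop :=
  ∃ t' s', Exec w S P s t' s' ∧ Q s' (t + t')

/-- A sequence of programs. -/
def block : List Prog → Prog
  | [] => .skip
  | P :: l => .seq P (block l)

variable {Q Q' : State → ℕ → Prop} {s : State} {t : ℕ}

theorem WP.mono {P : Prog} (h : WP w S P Q s t) (hQ : ∀ s' t', Q s' t' → Q' s' t') :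
    WP w S P Q' s t := by
  obtain ⟨t', s', h1, h2⟩ := h
  exact ⟨t', s', h1, hQ _ _ h2⟩

/-- The rules for loop-free code are equivalences, so that `simp` executes it symbolically and
leaves arithmetic side conditions; only loops need invariants. -/
theorem wp_skip : WP w S .skip Q s t ↔ Q s (t + 1) :=
  ⟨fun ⟨_, _, h, hQ⟩ => by cases h; exact hQ, fun h => ⟨_, _, .skip s, h⟩⟩

theorem wp_const {r c : ℕ} : WP w S (.const r c) Q s t ↔ c < 2 ^ w ∧ Q (s.set r c) (t + 1) :=
  ⟨fun ⟨_, _, h, hQ⟩ => by cases h with | const _ _ _ h => exact ⟨h, hQ⟩,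
    fun h => ⟨_, _, .const s r c h.1, h.2⟩⟩

theorem wp_add {r a b : ℕ} : WP w S (.add r a b) Q s t ↔
    s.reg a + s.reg b < 2 ^ w ∧ Q (s.set r (s.reg a + s.reg b)) (t + 1) :=
  ⟨fun ⟨_, _, h, hQ⟩ => by cases h with | add _ _ _ _ h => exact ⟨h, hQ⟩,
    fun h => ⟨_, _, .add s r a b h.1, h.2⟩⟩

theorem wp_sub {r a b : ℕ} : WP w S (.sub r a b) Q s t ↔
    Q (s.set r (s.reg a - s.reg b)) (t + 1) :=
  ⟨fun ⟨_, _, h, hQ⟩ => by cases h; exact hQ, fun h => ⟨_, _, .sub s r a b, h⟩⟩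

theorem wp_half {r a : ℕ} : WP w S (.half r a) Q s t ↔ Q (s.set r (s.reg a / 2)) (t + 1) :=
  ⟨fun ⟨_, _, h, hQ⟩ => by cases h; exact hQ, fun h => ⟨_, _, .half s r a, h⟩⟩

theorem wp_load {r a : ℕ} : WP w S (.load r a) Q s t ↔
    s.reg a < S ∧ Q (s.set r (s.mem (s.reg a))) (t + 1) :=
  ⟨fun ⟨_, _, h, hQ⟩ => by cases h with | load _ _ _ h => exact ⟨h, hQ⟩,
    fun h => ⟨_, _, .load s r a h.1, h.2⟩⟩

theorem wp_store {a b : ℕ} : WP w S (.store a b) Q s t ↔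
    s.reg a < S ∧ Q (s.put (s.reg a) (s.reg b)) (t + 1) :=
  ⟨fun ⟨_, _, h, hQ⟩ => by cases h with | store _ _ _ h => exact ⟨h, hQ⟩,
    fun h => ⟨_, _, .store s a b h.1, h.2⟩⟩

theorem wp_emit {a : ℕ} : WP w S (.emit a) Q s t ↔ Q (s.print (s.reg a)) (t + 1) :=
  ⟨fun ⟨_, _, h, hQ⟩ => by cases h; exact hQ, fun h => ⟨_, _, .emit s a, h⟩⟩

theorem wp_seq {P P' : Prog} :
    WP w S (.seq P P') Q s t ↔ WP w S P (fun s' t' => WP w S P' Q s' t') s t := by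
  constructor
  · rintro ⟨_, _, h, hQ⟩
    cases h with
    | seq h₁ h₂ => exact ⟨_, _, h₁, _, _, h₂, by rwa [add_assoc]⟩
  · rintro ⟨_, _, h₁, _, _, h₂, hQ⟩
    exact ⟨_, _, .seq h₁ h₂, by rwa [← add_assoc]⟩

theorem wp_block_nil : WP w S (block []) Q s t ↔ Q s (t + 1) := wp_skip

theorem wp_block_cons {P : Prog} {l : List Prog} :
    WP w S (block (P :: l)) Q s t ↔ WP w S P (fun s' t' => WP w S (block l) Q s' t') s t :=
  wp_seq

theorem wp_cond {a : ℕ} {P P' : Prog} : WP w S (.cond a P P') Q s t ↔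
    if s.reg a = 0 then WP w S P' Q s (t + 1) else WP w S P Q s (t + 1) := by
  split_ifs with ha
  · constructor
    · rintro ⟨_, _, h, hQ⟩
      cases h with
      | condTrue ha' _ => exact (ha' ha).elim
      | condFalse _ h => exact ⟨_, _, h, by rwa [add_assoc, add_comm 1]⟩
    · rintro ⟨_, _, h, hQ⟩
      exact ⟨_, _, .condFalse ha h, by rwa [add_assoc, add_comm 1] at hQ⟩
  · constructor
    · rintro ⟨_, _, h, hQ⟩
      cases h with
      | condTrue _ h => exact ⟨_, _, h, by rwa [add_assoc, add_comm 1]⟩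
      | condFalse ha' _ => exact (ha ha').elim
    · rintro ⟨_, _, h, hQ⟩
      exact ⟨_, _, .condTrue ha h, by rwa [add_assoc, add_comm 1] at hQ⟩

theorem wp_loop_of_eq_zero {a : ℕ} {P : Prog} (ha : s.reg a = 0) (h : Q s (t + 1)) :
    WP w S (.loop a P) Q s t := ⟨_, _, .loopStop ha, h⟩

theorem wp_loop_of_ne_zero {a : ℕ} {P : Prog} (ha : s.reg a ≠ 0)
    (h : WP w S P (fun s' t' => WP w S (.loop a P) Q s' t') s (t + 1)) :
    WP w S (.loop a P) Q s t := by
  obtain ⟨t₁, s₁, h₁, t₂, s₂, h₂, hQ⟩ := h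
  exact ⟨_, _, .loopStep ha h₁ h₂, by
    rwa [add_comm t₁ 1, ← add_assoc, ← add_assoc]⟩

/-- Registers below `k` have the same contents in `s` and `s'`. -/
def Agree (k : ℕ) (s s' : State) : Prop := ∀ r < k, s'.reg r = s.reg r

theorem Agree.refl (k : ℕ) (s : State) : Agree k s s := fun _ _ => rfl

theorem Agree.trans {k : ℕ} {s s' s'' : State} (h : Agree k s s') (h' : Agree k s' s'') :
    Agree k s s'' := fun r hr => (h' r hr).trans (h r hr)

theorem Agree.mono {j k : ℕ} (hjk : j ≤ k) {s s' : State} (h : Agree k s s') : Agree j s s' :=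
  fun r hr => h r (hr.trans_le hjk)

theorem agree_set {k r x : ℕ} {s s' : State} (hr : k ≤ r) :
    Agree k s (s'.set r x) ↔ Agree k s s' :=
  forall₂_congr fun r' hr' => by rw [State.set_reg, if_neg (by omega)]

theorem agree_put {k i x : ℕ} {s s' : State} : Agree k s (s'.put i x) ↔ Agree k s s' := Iff.rfl

theorem agree_print {k x : ℕ} {s s' : State} : Agree k s (s'.print x) ↔ Agree k s s' := Iff.rfl

/-- A loop whose counter `a` runs down from `N` to `0`. -/
theorem wp_loop_count {a N T : ℕ} {P : Prog} (Inv : ℕ → State → Prop)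
    (hreg : ∀ k ≤ N, ∀ s, Inv k s → s.reg a = N - k)
    (hbody : ∀ k < N, ∀ s t, Inv k s →
      WP w S P (fun s' t' => Inv (k + 1) s' ∧ t' ≤ t + T) s t)
    (h0 : Inv 0 s) (hQ : ∀ s' t', Inv N s' → t' ≤ t + (N * (T + 1) + 1) → Q s' t') :
    WP w S (.loop a P) Q s t := by
  -- Induction on the number `j` of remaining iterations, each charged with `T` and one step for the
  -- test.
  suffices h : ∀ j k s t', j + k = N → Inv k s → t' + j * (T + 1) ≤ t + N * (T + 1) →
      WP w S (.loop a P) Q s t' from h N 0 s t (by simp) h0 le_rfl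
  intro j
  induction j with
  | zero =>
    intro k s t' hk hs ht
    obtain rfl : k = N := by omega
    exact wp_loop_of_eq_zero (by rw [hreg _ le_rfl _ hs]; simp) (hQ _ _ hs (by omega))
  | succ j ih =>
    intro k s t' hk hs ht
    refine wp_loop_of_ne_zero (by rw [hreg k (by omega) _ hs]; omega) ?_
    refine (hbody k (by omega) s _ hs).mono fun s' t'' h => ?_
    refine ih (k + 1) s' t'' (by omega) h.1 ?_
    have := h.2
    rw [add_mul j 1] at ht
    omega

end RAM

/-! ## The implementation: memory layout and attractors -/

namespace RAM

open ParityGame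

/-- The registers that are not changed after the initialization: constants, the numbers of vertices
and edges, the highest priority, and the addresses of the arrays. -/
structure Consts (n m d₀ : ℕ) (r : ℕ → ℕ) : Prop where
  zero : r 0 = 0
  one : r 1 = 1
  verts : r 2 = n
  top : r 3 = d₀
  edges : r 4 = 3 + 2 * n
  size : r 5 = m
  level : r 6 = 3 + 2 * n + 2 * m
  marks : r 7 = 3 + 3 * n + 2 * m
  owners : r 8 = 3
  prios : r 9 = 3 + n

theorem Consts.congr {n m d₀ : ℕ} {r r' : ℕ → ℕ} (h : Consts n m d₀ r)
    (hr : ∀ i < 10, r' i = r i) : Consts n m d₀ r' := by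
  constructor <;> rw [hr _ (by norm_num)]
  exacts [h.zero, h.one, h.verts, h.top, h.edges, h.size, h.level, h.marks, h.owners, h.prios]

/-- The part of the memory that holds the game. -/
structure HasGame {n : ℕ} (𝒢 : ParityGame (Fin n)) (edges : List (Fin n × Fin n))
    (mem : ℕ → ℕ) : Prop where
  owner : ∀ v : Fin n, mem (3 + v) = encodePlayer (𝒢.owner v)
  prio : ∀ v : Fin n, mem (3 + n + v) = 𝒢.priority v
  source : ∀ i (h : i < edges.length), mem (3 + 2 * n + 2 * i) = edges[i].1
  target : ∀ i (h : i < edges.length), mem (3 + 2 * n + 2 * i + 1) = edges[i].2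

/-- The array of levels. -/
def HasLevel {n : ℕ} (m : ℕ) (lev : Fin n → ℕ) (mem : ℕ → ℕ) : Prop :=
  ∀ v : Fin n, mem (3 + 2 * n + 2 * m + v) = lev v

/-- The array of marks. -/
def HasMarks {n : ℕ} (m : ℕ) (A : Finset (Fin n)) (mem : ℕ → ℕ) : Prop :=
  ∀ v : Fin n, mem (3 + 3 * n + 2 * m + v) = if v ∈ A then 1 else 0

/-- The memory is large enough for the arrays, and words for addresses and levels. -/
structure Fits (w S n m d₀ : ℕ) : Prop where
  arrays : 3 + 4 * n + 2 * m ≤ S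
  addresses : S < 2 ^ w
  levels : d₀ + 4 ≤ 2 ^ w

/-- The vertices whose level is at most `d`. -/
def below {n : ℕ} (lev : Fin n → ℕ) (d : ℕ) : Finset (Fin n) :=
  Finset.univ.filter fun v => lev v ≤ d

theorem mem_below {n : ℕ} {lev : Fin n → ℕ} {d : ℕ} {v : Fin n} : v ∈ below lev d ↔ lev v ≤ d := by
  simp [below]

/-- One step of the scan of the edge list for successors of the vertex in register 22. -/
def edgeBody : Prog := block [
  .load 28 25,
  .sub 29 28 22, .sub 28 22 28, .add 28 28 29,
  .cond 28 .skip (block [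
    .add 28 25 1, .load 28 28,
    .add 29 6 28, .load 29 29, .sub 29 29 11,
    .cond 29 .skip (block [
      .add 28 7 28, .load 28 28,
      .cond 24 (.cond 28 .skip (.const 27 0)) (.cond 28 (.const 27 1) .skip)])]),
  .add 25 25 1, .add 25 25 1, .sub 26 26 1]

variable {w S n d₀ d : ℕ} {𝒢 : ParityGame (Fin n)} {edges : List (Fin n × Fin n)}
  {Q : State → ℕ → Prop} {s : State} {t : ℕ} {lev : Fin n → ℕ} {A : Finset (Fin n)}

/-- The test computed by the scan of the list `l` of edges for the vertex `u`: if `o = 0`, whether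
some successor of `u` is marked, and otherwise, whether all are. -/
def ScanResult (lev : Fin n → ℕ) (d : ℕ) (A : Finset (Fin n)) (o : ℕ) (u : Fin n)
    (l : List (Fin n × Fin n)) : Prop :=
  if o = 0 then ∃ e ∈ l, e.1 = u ∧ lev e.2 ≤ d ∧ e.2 ∈ A
  else ∀ e ∈ l, e.1 = u → lev e.2 ≤ d → e.2 ∈ A

theorem scanResult_append {o : ℕ} {u : Fin n} {l : List (Fin n × Fin n)} {e : Fin n × Fin n} :
    ScanResult lev d A o u (l ++ [e]) ↔
      if e.1 = u ∧ lev e.2 ≤ d then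
        (if o = 0 then e.2 ∈ A ∨ ScanResult lev d A o u l else e.2 ∈ A ∧ ScanResult lev d A o u l)
      else ScanResult lev d A o u l := by
  unfold ScanResult
  simp only [List.mem_append, List.mem_singleton, or_imp, forall_and, or_and_right, exists_or,
    exists_eq_left, forall_eq]
  generalize (∃ x ∈ l, x.1 = u ∧ lev x.2 ≤ d ∧ x.2 ∈ A) = X
  generalize (∀ x ∈ l, x.1 = u → lev x.2 ≤ d → x.2 ∈ A) = Y
  split_ifs <;> tauto

/-- The whole unsorted edge list is scanned for each vertex, so no adjacency structure is stored.
After `k` steps, register 27 holds the test for `edges.take k`. -/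
theorem wp_edgeLoop (hfit : Fits w S n edges.length d₀) (hc : Consts n edges.length d₀ s.reg)
    (hg : HasGame 𝒢 edges s.mem) (hl : HasLevel edges.length lev s.mem)
    (hA : HasMarks edges.length A s.mem) (hd : s.reg 11 = d) {u : Fin n} (hu : s.reg 22 = u)
    (h25 : s.reg 25 = 3 + 2 * n) (h26 : s.reg 26 = edges.length) (h27 : s.reg 27 = s.reg 24)
    (hQ : ∀ s' t', s'.mem = s.mem → s'.out = s.out → Agree 25 s s' →
      (s'.reg 27 ≠ 0 ↔ ScanResult lev d A (s.reg 24) u edges) →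
      t' ≤ t + (edges.length * 25 + 1) → Q s' t') :
    WP w S (.loop 26 edgeBody) Q s t := by
  obtain ⟨hf1, hf2, hf3⟩ := hfit
  refine wp_loop_count (N := edges.length) (T := 24) (fun k s' => s'.mem = s.mem ∧
    s'.out = s.out ∧ Agree 25 s s' ∧ s'.reg 25 = 3 + 2 * n + 2 * k ∧
    s'.reg 26 = edges.length - k ∧
    (s'.reg 27 ≠ 0 ↔ ScanResult lev d A (s.reg 24) u (edges.take k)))
    (fun k _ s' h => h.2.2.2.2.1) ?_ ?_ ?_
  · rintro k hk s' t' ⟨hm, ho, hr, hr25, hr26, hr27⟩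
    have e1 : s'.reg 1 = 1 := by rw [hr _ (by norm_num), hc.one]
    have e6 := (hr 6 (by norm_num)).trans hc.level
    have e7 := (hr 7 (by norm_num)).trans hc.marks
    have e11 : s'.reg 11 = d := by rw [hr _ (by norm_num), hd]
    have e22 : s'.reg 22 = u := by rw [hr _ (by norm_num), hu]
    have e24 : s'.reg 24 = s.reg 24 := hr _ (by norm_num)
    have m1 := hg.source k hk
    have m2 := hg.target k hk
    have m3 := hl edges[k].2
    have m4 := hA edges[k].2
    have l1 := u.2
    have l2 := edges[k].1.2
    have l3 := edges[k].2.2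
    have htake : edges.take (k + 1) = edges.take k ++ [edges[k]] := by simp
    have hres := scanResult_append (lev := lev) (d := d) (A := A) (o := s.reg 24) (u := u)
      (l := edges.take k) (e := edges[k])
    rw [← htake] at hres
    rw [hres, ← hr27]
    -- The machine tests equality by adding the two truncated differences.
    have heq : (u : ℕ) - edges[k].1 + (edges[k].1 - u) = 0 ↔ edges[k].1 = u := by
      rw [Fin.ext_iff]
      omega
    unfold edgeBody
    simp only [wp_block_cons, wp_block_nil, wp_load, wp_sub, wp_add, wp_cond, wp_skip, wp_const,
      State.set_reg, State.set_mem, State.set_out, hr25, hr26, hm, ho, e1, e6, e7, e11, e22, e24,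
      m1, m2, m3, m4, Nat.reduceEqDiff, if_true, if_false, agree_set, Nat.reduceLeDiff, heq,
      Nat.sub_eq_zero_iff_le]
    generalize edges[k] = e at *
    clear hQ hres htake heq m1 m2 m3 m4 hr27
    by_cases c1 : e.1 = u <;> by_cases c2 : lev e.2 ≤ d <;> by_cases c3 : s.reg 24 = 0 <;>
      by_cases c4 : e.2 ∈ A <;>
      simp only [c1, c2, c3, c4, if_true, if_false, and_true, and_false, true_and, true_or,
        false_or, false_and, ne_eq, not_true_eq_false, not_false_eq_true, one_ne_zero, hr,
        iff_self] <;>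
      omega
  -- Register 27 starts with the value of register 24: zero is the empty disjunction, nonzero the
  -- empty conjunction.
  · exact ⟨rfl, rfl, Agree.refl _ _, by omega, by omega, by
      rw [h27, List.take_zero]
      by_cases h : s.reg 24 = 0 <;> simp [ScanResult, h]⟩
  · rintro s' t' ⟨h1, h2, h3, -, -, h4⟩ ht
    exact hQ s' t' h1 h2 h3 (by rw [h4, List.take_length]) ht

/-- The cells outside the interval from `a` to `b` have the same contents in `mem` and
`mem'`. -/
def SameOff (a b : ℕ) (mem mem' : ℕ → ℕ) : Prop := ∀ i, i < a ∨ b ≤ i → mem' i = mem i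

theorem SameOff.refl (a b : ℕ) (mem : ℕ → ℕ) : SameOff a b mem mem := fun _ _ => rfl

theorem SameOff.trans {a b : ℕ} {mem mem' mem'' : ℕ → ℕ} (h : SameOff a b mem mem')
    (h' : SameOff a b mem' mem'') : SameOff a b mem mem'' := fun i hi => (h' i hi).trans (h i hi)

theorem SameOff.put {a b i x : ℕ} {mem : ℕ → ℕ} {s' : State} (h : SameOff a b mem s'.mem)
    (ha : a ≤ i) (hb : i < b) : SameOff a b mem (s'.put i x).mem := fun j hj => by
  rw [State.put_mem, if_neg (by omega)]
  exact h j hj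

theorem HasGame.congr {mem mem' : ℕ → ℕ} (h : HasGame 𝒢 edges mem)
    (hm : ∀ i < 3 + 2 * n + 2 * edges.length, mem' i = mem i) : HasGame 𝒢 edges mem' where
  owner v := by rw [hm _ (by omega), h.owner]
  prio v := by rw [hm _ (by omega), h.prio]
  source i hi := by rw [hm _ (by omega), h.source i hi]
  target i hi := by rw [hm _ (by omega), h.target i hi]

theorem HasLevel.congr {m : ℕ} {mem mem' : ℕ → ℕ} (h : HasLevel m lev mem)
    (hm : ∀ i, 3 + 2 * n + 2 * m ≤ i → i < 3 + 3 * n + 2 * m → mem' i = mem i) :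
    HasLevel m lev mem' := fun v => by rw [hm _ (by omega) (by omega), h v]

theorem HasMarks.insert {m : ℕ} {s' : State} (h : HasMarks m A s'.mem) (u : Fin n) :
    HasMarks m (insert u A) (s'.put (3 + 3 * n + 2 * m + u) 1).mem := fun v => by
  rw [State.put_mem, h v]
  by_cases hvu : v = u
  · simp [hvu]
  · have : (v : ℕ) ≠ u := fun h => hvu (Fin.ext h)
    rw [if_neg (by omega)]
    simp [hvu]

/-- Marks the vertex in register 22 if it belongs to the set and is forced to a marked one, by the
player in register 20. -/
def scanVertex : Prog := block [
  .add 24 8 22, .load 24 24, .sub 28 24 20, .sub 29 20 24, .add 24 28 29,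
  .add 27 24 0, .add 25 4 0, .add 26 5 0, .loop 26 edgeBody,
  .add 28 7 22, .cond 27 (.store 28 1) .skip]

/-- One step of a round of the computation of an attractor. -/
def vertexBody : Prog := block [
  .add 28 6 22, .load 28 28, .sub 28 28 11,
  .cond 28 .skip (block [.add 28 7 22, .load 28 28, .cond 28 .skip scanVertex]),
  .add 22 22 1, .sub 23 23 1]

/-- The attractor of the marked vertices in the set of vertices of level at most the contents of
register 11, for the player in register 20. -/
def attrProg : Prog := block [
  .add 21 2 0,
  .loop 21 (block [.sub 22 2 2, .add 23 2 0, .loop 23 vertexBody, .sub 21 21 1])]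

/-- The vertex `u` is forced to `A` in one move. -/
def Forced (𝒢 : ParityGame (Fin n)) (℘ : Player) (G A : Finset (Fin n)) (u : Fin n) : Prop :=
  if 𝒢.owner u = ℘ then ∃ v ∈ G, 𝒢.Adj u v ∧ v ∈ A else ∀ v ∈ G, 𝒢.Adj u v → v ∈ A

variable {℘ : Player}

theorem scanResult_iff (he : 𝒢.IsEdgeList edges) {o : ℕ} {u : Fin n}
    (ho : o = 0 ↔ 𝒢.owner u = ℘) :
    ScanResult lev d A o u edges ↔ Forced 𝒢 ℘ (below lev d) A u := by
  unfold ScanResult Forced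
  simp only [ho, mem_below, ← he.2, Prod.exists, Prod.forall]
  split_ifs
  · constructor
    · rintro ⟨a, b, h1, rfl, h2, h3⟩
      exact ⟨b, h2, h1, h3⟩
    · rintro ⟨b, h1, h2, h3⟩
      exact ⟨u, b, h2, rfl, h1, h3⟩
  · exact ⟨fun h v hv hu => h u v hu rfl hv, fun h a b hab ha hb => h b hb (ha ▸ hab)⟩

theorem Forced.mem_attr {G B : Finset (Fin n)} (hG : 𝒢.IsSubgame G) {u : Fin n} (hu : u ∈ G)
    (h : Forced 𝒢 ℘ G A u) (hA : A ⊆ 𝒢.attr ℘ B G) : u ∈ 𝒢.attr ℘ B G := by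
  unfold Forced at h
  split_ifs at h with ho
  · obtain ⟨v, hv, huv, hvA⟩ := h
    exact mem_attr_of_own hG hu ho huv (hA hvA)
  · exact mem_attr_of_forall hG hu ho fun v hv huv => hA (h v hv huv)

/-- Minimality of the fixed point; it turns a round without new marks into a proof that the
attractor is complete. -/
theorem attr_subset_of_forced {G B : Finset (Fin n)} (hG : 𝒢.IsSubgame G) (hB : B ⊆ A)
    (h : ∀ u ∈ G, Forced 𝒢 ℘ G A u → u ∈ A) : 𝒢.attr ℘ B G ⊆ A := by
  intro v hv
  rw [ParityGame.mem_attr hG] at hv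
  refine Att.induction (P := fun v => v ∈ A) (fun v _ hvB => hB hvB) ?_ ?_ hv
  · intro v hv ho w hw hvw hwA
    exact h v hv (by rw [Forced, if_pos ho]; exact ⟨w, hw, hvw, hwA⟩)
  · intro v hv ho hall
    exact h v hv (by rw [Forced, if_neg ho]; exact hall)

theorem encodePlayer_le (℘ : Player) : encodePlayer ℘ ≤ 1 := by cases ℘ <;> simp [encodePlayer]

theorem encodePlayer_sub_eq_zero {℘ ℘' : Player} :
    encodePlayer ℘ - encodePlayer ℘' + (encodePlayer ℘' - encodePlayer ℘) = 0 ↔ ℘ = ℘' := by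
  cases ℘ <;> cases ℘' <;> simp [encodePlayer]

open Classical in
theorem wp_scanVertex (hfit : Fits w S n edges.length d₀) (he : 𝒢.IsEdgeList edges)
    (hc : Consts n edges.length d₀ s.reg) (hg : HasGame 𝒢 edges s.mem)
    (hl : HasLevel edges.length lev s.mem) (hA : HasMarks edges.length A s.mem)
    (hd : s.reg 11 = d) (hy : s.reg 20 = encodePlayer ℘) {u : Fin n} (hu : s.reg 22 = u)
    (hQ : ∀ s' t', SameOff (3 + 3 * n + 2 * edges.length) (3 + 4 * n + 2 * edges.length)
        s.mem s'.mem → s'.out = s.out → Agree 24 s s' →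
      HasMarks edges.length (if Forced 𝒢 ℘ (below lev d) A u then insert u A else A) s'.mem →
      t' ≤ t + (edges.length * 25 + 20) → Q s' t') :
    WP w S scanVertex Q s t := by
  have hfit' := hfit
  obtain ⟨hf1, hf2, hf3⟩ := hfit'
  have hul := u.2
  have p1 := encodePlayer_le ℘
  have p2 := encodePlayer_le (𝒢.owner u)
  unfold scanVertex
  simp only [wp_block_cons, wp_load, wp_sub, wp_add, State.set_reg, State.set_mem, hc.zero,
    hc.edges, hc.size, hc.owners, hu, hy, hg.owner, Nat.reduceEqDiff, if_true, if_false,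
    Nat.add_zero]
  refine ⟨by omega, by omega, by omega, by omega, by omega, by omega, ?_⟩
  refine wp_edgeLoop (lev := lev) (d := d) (A := A) (u := u) hfit (hc.congr fun i hi => ?_) hg hl hA
    ?_ ?_ ?_ ?_ ?_ fun s' t' hm ho hr hres ht => ?_
  · simp only [State.set_reg]
    split_ifs <;> omega
  iterate 5 simp only [State.set_reg, Nat.reduceEqDiff, if_true, if_false, hd, hu]
  simp only [State.set_mem, State.set_out, State.set_reg, Nat.reduceEqDiff, if_true, if_false]
    at hm ho hres
  rw [scanResult_iff (℘ := ℘) he encodePlayer_sub_eq_zero] at hres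
  have hr' : Agree 24 s s' := by
    have := hr.mono (show 24 ≤ 25 by norm_num)
    intro r hlt
    rw [this r hlt]
    simp only [State.set_reg]
    split_ifs <;> omega
  have e1 := (hr' 1 (by norm_num)).trans hc.one
  have e7 := (hr' 7 (by norm_num)).trans hc.marks
  have e22 := (hr' 22 (by norm_num)).trans hu
  simp only [wp_block_nil, wp_cond, wp_store, wp_skip, State.set_reg, e1, e7, e22, Nat.reduceEqDiff,
    if_true, if_false]
  refine ⟨by omega, ?_⟩
  by_cases hF : Forced 𝒢 ℘ (below lev d) A u
  · rw [if_neg (hres.2 hF)]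
    refine ⟨by omega, hQ _ _ ?_ ho ?_ ?_ (by omega)⟩
    · exact SameOff.put (by rw [State.set_mem, hm]; exact SameOff.refl _ _ _) (by omega) (by omega)
    · rwa [agree_put, agree_set (by norm_num)]
    · rw [if_pos hF]
      exact HasMarks.insert (by rw [State.set_mem, hm]; exact hA) u
  · rw [if_pos (by by_contra h; exact hF (hres.1 h))]
    refine hQ _ _ ?_ ho ?_ ?_ (by omega)
    · rw [State.set_mem, hm]
      exact SameOff.refl _ _ _
    · rwa [agree_set (by norm_num)]
    · rw [if_neg hF, State.set_mem, hm]
      exact hA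

/-- One round of the computation of an attractor: the marked set `A` grows to a set `A'`, and
`A' = A` only if the first `k` vertices need no marks. -/
def RoundInv (𝒢 : ParityGame (Fin n)) (℘ : Player) (G B A A' : Finset (Fin n)) (k : ℕ) : Prop :=
  A ⊆ A' ∧ A' ⊆ 𝒢.attr ℘ B G ∧
    (A' = A → ∀ u : Fin n, (u : ℕ) < k → u ∈ G → Forced 𝒢 ℘ G A u → u ∈ A)

/-- Marks are set in place, so a vertex is tested against a set that may have grown during the
round. If the round ends with `A`, nothing had grown before `u` either, and the test of `u` was made
against `A` itself. -/
theorem RoundInv.step {G B A' A'' : Finset (Fin n)} {u : Fin n}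
    (h : RoundInv 𝒢 ℘ G B A A' u) (hA : A' ⊆ A'') (hB : A'' ⊆ 𝒢.attr ℘ B G)
    (hu : u ∈ G → Forced 𝒢 ℘ G A' u → u ∈ A'') : RoundInv 𝒢 ℘ G B A A'' (u + 1) := by
  refine ⟨h.1.trans hA, hB, ?_⟩
  rintro rfl v hv hvG hF
  obtain rfl := hA.antisymm h.1
  rcases Nat.lt_succ_iff_lt_or_eq.1 hv with hv | hv
  · exact h.2.2 rfl v hv hvG hF
  · obtain rfl := Fin.ext hv
    exact hu hvG hF

open Classical in
theorem wp_vertexLoop (hfit : Fits w S n edges.length d₀) (he : 𝒢.IsEdgeList edges)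
    (hc : Consts n edges.length d₀ s.reg) (hg : HasGame 𝒢 edges s.mem)
    (hl : HasLevel edges.length lev s.mem) (hA : HasMarks edges.length A s.mem)
    (hd : s.reg 11 = d) (hy : s.reg 20 = encodePlayer ℘) (h22 : s.reg 22 = 0)
    (h23 : s.reg 23 = n) {B : Finset (Fin n)} (hG : 𝒢.IsSubgame (below lev d))
    (hB : A ⊆ 𝒢.attr ℘ B (below lev d))
    (hQ : ∀ s' t' A', SameOff (3 + 3 * n + 2 * edges.length) (3 + 4 * n + 2 * edges.length)
        s.mem s'.mem → s'.out = s.out → Agree 22 s s' → HasMarks edges.length A' s'.mem →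
      RoundInv 𝒢 ℘ (below lev d) B A A' n →
      t' ≤ t + (n * (edges.length * 25 + 41) + 1) → Q s' t') :
    WP w S (.loop 23 vertexBody) Q s t := by
  have hfit' := hfit
  obtain ⟨hf1, hf2, hf3⟩ := hfit'
  refine wp_loop_count (N := n) (T := edges.length * 25 + 40) (fun k s' =>
    SameOff (3 + 3 * n + 2 * edges.length) (3 + 4 * n + 2 * edges.length) s.mem s'.mem ∧
    s'.out = s.out ∧ Agree 22 s s' ∧ s'.reg 22 = k ∧ s'.reg 23 = n - k ∧
    ∃ A', HasMarks edges.length A' s'.mem ∧ RoundInv 𝒢 ℘ (below lev d) B A A' k)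
    (fun k _ s' h => h.2.2.2.2.1) ?_ ?_ ?_
  · rintro k hk s' t' ⟨hm, ho, hr, hr22, hr23, A', hA', hR⟩
    obtain ⟨u, rfl⟩ : ∃ u : Fin n, (u : ℕ) = k := ⟨⟨k, hk⟩, rfl⟩
    have hl' : HasLevel edges.length lev s'.mem := hl.congr fun i h1 h2 => hm i (by omega)
    have hg' : HasGame 𝒢 edges s'.mem := hg.congr fun i h1 => hm i (by omega)
    have hc' : Consts n edges.length d₀ s'.reg := hc.congr fun i hi => hr i (by omega)
    have e11 := (hr 11 (by norm_num)).trans hd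
    have e20 := (hr 20 (by norm_num)).trans hy
    have m1 := hl' u
    have m2 := hA' u
    unfold vertexBody
    simp only [wp_block_cons, wp_block_nil, wp_load, wp_sub, wp_add, wp_cond, wp_skip,
      State.set_reg, State.set_mem, State.set_out, hr22, hr23, ho, hc'.one, hc'.level, hc'.marks,
      e11, m1, m2, Nat.reduceEqDiff, if_true, if_false, agree_set, Nat.reduceLeDiff,
      Nat.sub_eq_zero_iff_le, true_and]
    refine ⟨by omega, by omega, ?_⟩
    by_cases h1 : lev u ≤ d
    · rw [if_pos h1]
      refine ⟨by omega, by omega, ?_⟩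
      by_cases h2 : u ∈ A'
      · simp only [h2, if_true, one_ne_zero, if_false]
        exact ⟨by omega, ⟨hm, hr, by omega, A', hA', hR.step subset_rfl hR.2.1 fun _ _ => h2⟩,
          by omega⟩
      · simp only [h2, if_false, if_true]
        refine wp_scanVertex (lev := lev) (d := d) (A := A') (u := u) (℘ := ℘) hfit he
          (hc'.congr fun i hi => ?_) hg' hl' hA' ?_ ?_ ?_ fun s'' t'' hm2 ho2 hr2 hA2 ht2 => ?_
        · simp only [State.set_reg]
          split_ifs <;> omega
        iterate 3 simp only [State.set_reg, Nat.reduceEqDiff, if_false, hr22, e11, e20]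
        have hr2' : Agree 24 s' s'' := by
          intro r hlt
          rw [hr2 r hlt]
          simp only [State.set_reg]
          split_ifs <;> omega
        simp only [State.set_mem, State.set_out] at hm2 ho2
        have f1 := (hr2' 1 (by norm_num)).trans hc'.one
        have f22 := (hr2' 22 (by norm_num)).trans hr22
        have f23 := (hr2' 23 (by norm_num)).trans hr23
        simp only [f1, f22, f23, ho2, ho, true_and]
        refine ⟨by omega, ⟨hm.trans hm2, hr.trans (hr2'.mono (by norm_num)), by omega, _, hA2,
          ?_⟩, by omega⟩
        by_cases hF : Forced 𝒢 ℘ (below lev d) A' u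
        · rw [if_pos hF]
          exact hR.step (Finset.subset_insert _ _) (Finset.insert_subset
            (hF.mem_attr hG (mem_below.2 h1) hR.2.1) hR.2.1) fun _ _ => Finset.mem_insert_self _ _
        · rw [if_neg hF]
          exact hR.step subset_rfl hR.2.1 fun _ h => (hF h).elim
    · rw [if_neg h1]
      exact ⟨by omega, ⟨hm, hr, by omega, A', hA',
        hR.step subset_rfl hR.2.1 fun h _ => (h1 (mem_below.1 h)).elim⟩, by omega⟩
  · exact ⟨SameOff.refl _ _ _, rfl, Agree.refl _ _, h22, by omega, A, hA, subset_rfl, hB,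
      fun _ u hu => by omega⟩
  · rintro s' t' ⟨h1, h2, h3, -, -, A', h4, h5⟩ ht
    exact hQ s' t' A' h1 h2 h3 h4 h5 ht

/-- Each round adds a mark unless the marked set is closed already. So after `k` rounds the set is
closed or has at least `k` elements, and after `n` rounds it is closed in either case. -/
theorem wp_attrProg (hfit : Fits w S n edges.length d₀) (he : 𝒢.IsEdgeList edges)
    (hc : Consts n edges.length d₀ s.reg) (hg : HasGame 𝒢 edges s.mem)
    (hl : HasLevel edges.length lev s.mem) (hA : HasMarks edges.length A s.mem)
    (hd : s.reg 11 = d) (hy : s.reg 20 = encodePlayer ℘)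
    (hG : 𝒢.IsSubgame (below lev d)) (hAG : A ⊆ below lev d)
    (hQ : ∀ s' t', SameOff (3 + 3 * n + 2 * edges.length) (3 + 4 * n + 2 * edges.length)
        s.mem s'.mem → s'.out = s.out → Agree 21 s s' →
      HasMarks edges.length (𝒢.attr ℘ A (below lev d)) s'.mem →
      t' ≤ t + (n * (n * (edges.length * 25 + 41) + 10) + 5) → Q s' t') :
    WP w S attrProg Q s t := by
  have hfit' := hfit
  obtain ⟨hf1, hf2, hf3⟩ := hfit'
  unfold attrProg
  simp only [wp_block_cons, wp_block_nil, wp_add, hc.zero, hc.verts]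
  refine ⟨by omega, wp_loop_count (N := n) (T := n * (edges.length * 25 + 41) + 9) (fun k s' =>
    SameOff (3 + 3 * n + 2 * edges.length) (3 + 4 * n + 2 * edges.length) s.mem s'.mem ∧
    s'.out = s.out ∧ Agree 21 s s' ∧ s'.reg 21 = n - k ∧
    ∃ A', HasMarks edges.length A' s'.mem ∧ A ⊆ A' ∧ A' ⊆ 𝒢.attr ℘ A (below lev d) ∧
      ((∀ u ∈ below lev d, Forced 𝒢 ℘ (below lev d) A' u → u ∈ A') ∨ k ≤ A'.card))
    (fun k _ s' h => h.2.2.2.1) ?_ ?_ ?_⟩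
  · rintro k hk s' t' ⟨hm, ho, hr, hr21, A', hA', hAA', hA'attr, hprog⟩
    have hc' : Consts n edges.length d₀ s'.reg := hc.congr fun i hi => hr i (by omega)
    simp only [wp_block_cons, wp_add, wp_sub, State.set_reg, Nat.reduceEqDiff, if_false, hc'.zero,
      hc'.verts]
    refine ⟨by omega, wp_vertexLoop (lev := lev) (d := d) (A := A') (℘ := ℘) (B := A) hfit he
      (hc'.congr fun i hi => ?_) (hg.congr fun i h1 => hm i (by omega))
      (hl.congr fun i h1 h2 => hm i (by omega)) hA' ?_ ?_ ?_ ?_ hG hA'attr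
      fun s'' t'' A'' hm2 ho2 hr2 hA2 hR ht2 => ?_⟩
    · simp only [State.set_reg]
      split_ifs <;> omega
    · simp only [State.set_reg, Nat.reduceEqDiff, if_false]
      rw [hr 11 (by norm_num), hd]
    · simp only [State.set_reg, Nat.reduceEqDiff, if_false]
      rw [hr 20 (by norm_num), hy]
    · simp only [State.set_reg, Nat.reduceEqDiff, if_false, if_true, Nat.sub_self]
    · simp only [State.set_reg, if_true, Nat.add_zero]
    have hr2' : Agree 22 s' s'' := by
      intro r hlt
      rw [hr2 r hlt]
      simp only [State.set_reg]
      split_ifs <;> omega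
    have f1 := (hr2' 1 (by norm_num)).trans hc'.one
    have f21 := (hr2' 21 (by norm_num)).trans hr21
    simp only [State.set_mem, State.set_out] at hm2 ho2
    simp only [wp_block_nil, State.set_reg, State.set_mem, State.set_out, f1, f21, if_true,
      ho2, ho, true_and, agree_set, le_refl]
    refine ⟨⟨hm.trans hm2, hr.trans (hr2'.mono (by norm_num)), by omega, A'', hA2,
      hAA'.trans hR.1, hR.2.1, ?_⟩, by omega⟩
    by_cases hcl : ∀ u ∈ below lev d, Forced 𝒢 ℘ (below lev d) A' u → u ∈ A'
    · have h1 := attr_subset_of_forced hG hAA' hcl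
      have h2 : A'' = A' := (hR.2.1.trans h1).antisymm hR.1
      exact Or.inl (h2 ▸ hcl)
    · right
      have h1 : A' ⊂ A'' := by
        refine hR.1.ssubset_of_ne fun h => hcl fun u hu => hR.2.2 h.symm u u.2 hu
      have h2 := Finset.card_lt_card h1
      have h3 := hprog.resolve_left hcl
      omega
  · simp only [State.set_mem, State.set_out, State.set_reg, if_true, agree_set, le_refl, true_and]
    exact ⟨SameOff.refl _ _ _, Agree.refl _ _, by omega, A, hA, subset_rfl,
      𝒢.subset_attr ℘ hAG, Or.inr (Nat.zero_le _)⟩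
  · rintro s' t' ⟨h1, h2, h3, -, A', h4, h5, h6, h7⟩ ht
    change t' ≤ t + 1 + (n * (n * (edges.length * 25 + 41) + 10) + 1) at ht
    refine hQ s' _ h1 h2 h3 ?_ (by omega)
    have hcl : ∀ u ∈ below lev d, Forced 𝒢 ℘ (below lev d) A' u → u ∈ A' := by
      rcases h7 with h7 | h7
      · exact h7
      · have : A' = Finset.univ := (Finset.card_eq_iff_eq_univ A').1 (by
          rw [Fintype.card_fin]
          exact le_antisymm (by simpa using Finset.card_le_univ A') h7)
        intro u _ _
        rw [this]
        exact Finset.mem_univ u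
    rwa [(attr_subset_of_forced hG h5 hcl).antisymm h6]

end RAM

/-! ## Scans of the vertices -/

namespace RAM

open ParityGame

variable {n w S d₀ d : ℕ} {𝒢 : ParityGame (Fin n)} {edges : List (Fin n × Fin n)}
  {Q : State → ℕ → Prop} {s : State} {t : ℕ} {lev : Fin n → ℕ} {A : Finset (Fin n)} {℘ : Player}

/-- Executes `P` for every vertex, whose number is in register 22. -/
def forVertices (P : Prog) : Prog := block [
  .sub 22 2 2, .add 23 2 0, .loop 23 (block [P, .add 22 22 1, .sub 23 23 1])]

/-- By `hset` the invariant must not depend on registers 22 and 23, which the scan itself uses as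
vertex number and counter. -/
theorem wp_forVertices {P : Prog} {m T : ℕ} (hfit : Fits w S n m d₀) (Inv : ℕ → State → Prop)
    (hc : ∀ k s, Inv k s → Consts n m d₀ s.reg)
    (hset : ∀ k s x y, Inv k s → Inv k ((s.set 22 x).set 23 y))
    (hbody : ∀ (u : Fin n) s t, Inv u s → s.reg 22 = u → WP w S P (fun s' t' =>
      Inv (u + 1) s' ∧ s'.reg 22 = s.reg 22 ∧ s'.reg 23 = s.reg 23 ∧ t' ≤ t + T) s t)
    (h0 : Inv 0 s) (hQ : ∀ s' t', Inv n s' → t' ≤ t + (n * (T + 4) + 4) → Q s' t') :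
    WP w S (forVertices P) Q s t := by
  obtain ⟨hf1, hf2, hf3⟩ := hfit
  have hc0 := hc _ _ h0
  unfold forVertices
  simp only [wp_block_cons, wp_block_nil, wp_sub, wp_add, State.set_reg, hc0.zero, hc0.verts,
    Nat.reduceEqDiff, if_false, Nat.add_zero, Nat.sub_self]
  refine ⟨by omega, wp_loop_count (N := n) (T := T + 3)
    (fun k s' => Inv k s' ∧ s'.reg 22 = k ∧ s'.reg 23 = n - k) (fun k _ s' h => h.2.2) ?_ ?_ ?_⟩
  · rintro k hk s' t' ⟨h1, h2, h3⟩
    refine wp_block_cons.2 <| (hbody ⟨k, hk⟩ s' t' h1 h2).mono fun s'' t'' ⟨h4, h5, h6, h7⟩ => ?_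
    have hc1 := hc _ _ h4
    simp only [wp_block_cons, wp_block_nil, wp_add, wp_sub, State.set_reg, hc1.one, h5, h6, h2,
      h3, Nat.reduceEqDiff, if_true, if_false, true_and]
    exact ⟨by omega, ⟨hset _ _ _ _ h4, by omega⟩, by omega⟩
  · exact ⟨hset _ _ _ _ h0, by simp [State.set_reg], by simp [State.set_reg]⟩
  · rintro s' t' ⟨h1, -, -⟩ ht
    refine hQ s' _ h1 ?_
    change t' ≤ t + 1 + 1 + (n * (T + 4) + 1) at ht
    omega

/-- A scan that replaces the level of each vertex `v` by `f v`. -/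
theorem wp_levelScan {P : Prog} {m T : ℕ} {f : Fin n → ℕ} (hfit : Fits w S n m d₀)
    (hc : Consts n m d₀ s.reg) (hl : HasLevel m lev s.mem)
    (hbody : ∀ (u : Fin n) s' t', Consts n m d₀ s'.reg → Agree 22 s s' → s'.reg 22 = u →
      SameOff (3 + 2 * n + 2 * m) (3 + 3 * n + 2 * m) s.mem s'.mem →
      s'.mem (3 + 2 * n + 2 * m + u) = lev u → WP w S P (fun s'' t'' =>
        Agree 24 s' s'' ∧ s''.out = s'.out ∧
        (∀ i, s''.mem i = if i = 3 + 2 * n + 2 * m + u then f u else s'.mem i) ∧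
        t'' ≤ t' + T) s' t')
    (hQ : ∀ s' t', Agree 22 s s' → s'.out = s.out →
      SameOff (3 + 2 * n + 2 * m) (3 + 3 * n + 2 * m) s.mem s'.mem → HasLevel m f s'.mem →
      t' ≤ t + (n * (T + 4) + 4) → Q s' t') :
    WP w S (forVertices P) Q s t := by
  refine wp_forVertices (T := T) hfit (fun k s' => Agree 22 s s' ∧ s'.out = s.out ∧
    SameOff (3 + 2 * n + 2 * m) (3 + 3 * n + 2 * m) s.mem s'.mem ∧
    ∀ v : Fin n, s'.mem (3 + 2 * n + 2 * m + v) = if (v : ℕ) < k then f v else lev v)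
    ?_ ?_ ?_ ?_ ?_
  · exact fun k s' h => hc.congr fun i hi => h.1 i (by omega)
  · intro k s' x y h
    simpa only [agree_set, Nat.reduceLeDiff, le_refl, State.set_mem, State.set_out] using h
  · rintro u s' t' ⟨h1, h2, h3, h4⟩ h22
    refine (hbody u s' t' (hc.congr fun i hi => h1 i (by omega)) h1 h22 h3
      (by rw [h4]; simp)).mono fun s'' t'' ⟨h5, h6, h7, h8⟩ => ?_
    refine ⟨⟨h1.trans (h5.mono (by norm_num)), h6.trans h2, fun i hi => ?_, fun v => ?_⟩,
      h5 22 (by norm_num), h5 23 (by norm_num), h8⟩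
    · rw [h7, if_neg (by have := u.2; omega), h3 i hi]
    · rw [h7, h4]
      by_cases hvu : v = u
      · simp [hvu]
      · have : (v : ℕ) ≠ u := fun h => hvu (Fin.ext h)
        rw [if_neg (by omega)]
        by_cases hlt : (v : ℕ) < u
        · rw [if_pos hlt, if_pos (by omega)]
        · rw [if_neg hlt, if_neg (by omega)]
  · exact ⟨Agree.refl _ _, rfl, SameOff.refl _ _ _, fun v => by simpa using hl v⟩
  · rintro s' t' ⟨h1, h2, h3, h4⟩ ht
    exact hQ s' t' h1 h2 h3 (fun v => by rw [h4, if_pos v.2]) ht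

/-- A scan that marks the vertices of a set `A`, and possibly records in register 19 whether it is
nonempty. -/
theorem wp_markScan {P : Prog} {m T : ℕ} (hfit : Fits w S n m d₀)
    (hc : Consts n m d₀ s.reg) (h19 : s.reg 19 = 0)
    (hbody : ∀ (u : Fin n) s' t', Consts n m d₀ s'.reg → Agree 19 s s' → s'.reg 22 = u →
      SameOff (3 + 3 * n + 2 * m) (3 + 4 * n + 2 * m) s.mem s'.mem → WP w S P (fun s'' t'' =>
        Agree 19 s' s'' ∧ s''.reg 19 = (if u ∈ A then 1 else s'.reg 19) ∧
        s''.reg 22 = s'.reg 22 ∧ s''.reg 23 = s'.reg 23 ∧ s''.out = s'.out ∧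
        (∀ i, s''.mem i = if i = 3 + 3 * n + 2 * m + u then (if u ∈ A then 1 else 0)
          else s'.mem i) ∧ t'' ≤ t' + T) s' t')
    (hQ : ∀ s' t', Agree 19 s s' → s'.out = s.out →
      SameOff (3 + 3 * n + 2 * m) (3 + 4 * n + 2 * m) s.mem s'.mem → HasMarks m A s'.mem →
      (s'.reg 19 = 0 ↔ A = ∅) → t' ≤ t + (n * (T + 4) + 4) → Q s' t') :
    WP w S (forVertices P) Q s t := by
  refine wp_forVertices (T := T) hfit (fun k s' => Agree 19 s s' ∧ s'.out = s.out ∧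
    SameOff (3 + 3 * n + 2 * m) (3 + 4 * n + 2 * m) s.mem s'.mem ∧
    (∀ v : Fin n, (v : ℕ) < k → s'.mem (3 + 3 * n + 2 * m + v) = if v ∈ A then 1 else 0) ∧
    (s'.reg 19 = 0 ↔ ∀ v : Fin n, (v : ℕ) < k → v ∉ A))
    ?_ ?_ ?_ ?_ ?_
  · exact fun k s' h => hc.congr fun i hi => h.1 i (by omega)
  · intro k s' x y h
    simpa only [agree_set, Nat.reduceLeDiff, State.set_mem, State.set_out, State.set_reg,
      Nat.reduceEqDiff, if_false] using h
  · rintro u s' t' ⟨h1, h2, h3, h4, h5⟩ h22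
    refine (hbody u s' t' (hc.congr fun i hi => h1 i (by omega)) h1 h22 h3).mono
      fun s'' t'' ⟨g1, g2, g3, g4, g5, g6, g7⟩ => ?_
    refine ⟨⟨h1.trans g1, g5.trans h2, fun i hi => ?_, fun v hv => ?_, ?_⟩, g3, g4, g7⟩
    · rw [g6, if_neg (by have := u.2; omega), h3 i hi]
    · rw [g6]
      by_cases hvu : v = u
      · simp [hvu]
      · have : (v : ℕ) ≠ u := fun h => hvu (Fin.ext h)
        rw [if_neg (by omega), h4 v (by omega)]
    · rw [g2]
      by_cases hu : u ∈ A
      · rw [if_pos hu]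
        exact iff_of_false one_ne_zero fun h => h u (by omega) hu
      · rw [if_neg hu, h5]
        refine ⟨fun h v hv => ?_, fun h v hv => h v (by omega)⟩
        rcases Nat.lt_succ_iff_lt_or_eq.1 hv with hv | hv
        · exact h v hv
        · exact Fin.ext hv ▸ hu
  · exact ⟨Agree.refl _ _, rfl, SameOff.refl _ _ _, fun v hv => by omega,
      ⟨fun _ v hv => by omega, fun _ => h19⟩⟩
  · rintro s' t' ⟨h1, h2, h3, h4, h5⟩ ht
    refine hQ s' t' h1 h2 h3 (fun v => h4 v v.2) ?_ ht
    rw [h5, Finset.eq_empty_iff_forall_notMem]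
    exact ⟨fun h v => h v v.2, fun h v _ => h v⟩

/-- Writes the set of vertices of level at most the contents of register 11, and records in register
19 whether it is nonempty. -/
def emitSet : Prog := block [.add 19 0 0, forVertices (block [
  .add 28 6 22, .load 28 28, .sub 28 28 11,
  .cond 28 (.emit 0) (block [.emit 1, .add 19 1 0])])]

theorem wp_emitSet {m : ℕ} (hfit : Fits w S n m d₀) (hc : Consts n m d₀ s.reg)
    (hl : HasLevel m lev s.mem) (hd : s.reg 11 = d)
    (hQ : ∀ s' t', Agree 19 s s' → s'.mem = s.mem → s'.out = s.out ++ encodeSet (below lev d) →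
      (s'.reg 19 = 0 ↔ below lev d = ∅) → t' ≤ t + (n * 14 + 10) → Q s' t') :
    WP w S emitSet Q s t := by
  have hfit' := hfit
  obtain ⟨hf1, hf2, hf3⟩ := hfit'
  unfold emitSet
  simp only [wp_block_cons, wp_block_nil, wp_add, hc.zero]
  refine ⟨by omega, wp_forVertices (T := 10) hfit (fun k s' => Agree 19 s s' ∧ s'.mem = s.mem ∧
    s'.out = s.out ++ (encodeSet (below lev d)).take k ∧
    (s'.reg 19 = 0 ↔ ∀ v : Fin n, (v : ℕ) < k → v ∉ below lev d)) ?_ ?_ ?_ ?_ ?_⟩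
  · exact fun k s' h => hc.congr fun i hi => h.1 i (by omega)
  · intro k s' x y h
    simpa only [agree_set, Nat.reduceLeDiff, State.set_mem, State.set_out, State.set_reg,
      Nat.reduceEqDiff, if_false] using h
  · rintro u s' t' ⟨h1, h2, h3, h4⟩ h22
    have hc' : Consts n m d₀ s'.reg := hc.congr fun i hi => h1 i (by omega)
    have e11 := (h1 11 (by norm_num)).trans hd
    have hu := u.2
    have m1 := hl u
    have htake : (encodeSet (below lev d)).take (u + 1) =
        (encodeSet (below lev d)).take u ++ [if lev u ≤ d then 1 else 0] := by
      have hlen : (u : ℕ) < (encodeSet (below lev d)).length := by simp [encodeSet]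
      rw [← List.take_concat_get' _ _ hlen]
      simp [encodeSet, mem_below]
    have hall : (∀ v : Fin n, (v : ℕ) < u + 1 → v ∉ below lev d) ↔
        ¬ lev u ≤ d ∧ ∀ v : Fin n, (v : ℕ) < u → v ∉ below lev d := by
      refine ⟨fun h => ⟨fun hle => h u (by omega) (mem_below.2 hle), fun v hv => h v (by omega)⟩,
        fun h v hv => ?_⟩
      rcases Nat.lt_succ_iff_lt_or_eq.1 hv with hv | hv
      · exact h.2 v hv
      · exact Fin.ext hv ▸ fun h' => h.1 (mem_below.1 h')
    simp only [wp_block_cons, wp_block_nil, wp_add, wp_load, wp_sub, wp_cond, wp_emit,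
      State.set_reg, State.set_mem, State.set_out, State.print_reg, State.print_mem,
      State.print_out, hc'.zero, hc'.one, hc'.level, e11, h22, h2, h3, m1, Nat.reduceEqDiff,
      if_true, if_false, agree_set, agree_print, Nat.reduceLeDiff, le_refl,
      Nat.sub_eq_zero_iff_le, htake, hall, true_and]
    by_cases hle : lev u ≤ d
    · simp only [hle, if_true, not_true_eq_false, false_and, List.append_assoc]
      exact ⟨by omega, by omega, by omega, ⟨h1, trivial, by simp⟩, by omega⟩
    · simp only [hle, if_false, not_false_eq_true, true_and, List.append_assoc]
      exact ⟨by omega, by omega, ⟨h1, h4⟩, by omega⟩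
  · simp only [agree_set, le_refl, State.set_mem, State.set_out, State.set_reg, if_true,
      List.take_zero, List.append_nil, true_and]
    exact ⟨Agree.refl _ _, fun _ v hv => by omega, fun _ => trivial⟩
  · rintro s' t' ⟨h1, h2, h3, h4⟩ ht
    have hlen : (encodeSet (below lev d)).length ≤ n := by simp [encodeSet]
    rw [List.take_of_length_le hlen] at h3
    refine hQ s' _ h1 h2 h3 ?_ (by omega)
    rw [h4, Finset.eq_empty_iff_forall_notMem]
    exact ⟨fun h v => h v v.2, fun h v _ => h v⟩

/-- Moves all vertices of level at most `d`, the contents of register 11, to the level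
`d + 1`. -/
def clearProg : Prog := forVertices (block [
  .add 28 6 22, .load 29 28, .sub 30 29 11,
  .cond 30 .skip (block [.add 30 11 1, .store 28 30])])

/-- Used to return the empty set: all vertices of the current set leave it, and thereby go back to
the set of the caller. -/
theorem wp_clearProg {m : ℕ} (hfit : Fits w S n m d₀) (hc : Consts n m d₀ s.reg)
    (hl : HasLevel m lev s.mem) (hd : s.reg 11 = d) (hd₀ : d ≤ d₀)
    (hQ : ∀ s' t', Agree 22 s s' → s'.out = s.out →
      SameOff (3 + 2 * n + 2 * m) (3 + 3 * n + 2 * m) s.mem s'.mem →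
      HasLevel m (fun v => if lev v ≤ d then d + 1 else lev v) s'.mem →
      t' ≤ t + (n * 14 + 4) → Q s' t') :
    WP w S clearProg Q s t := by
  have hfit' := hfit
  obtain ⟨hf1, hf2, hf3⟩ := hfit'
  refine wp_levelScan (T := 10) hfit hc hl (fun u s' t' hc' hr h22 _ hu => ?_) hQ
  have e11 := (hr 11 (by norm_num)).trans hd
  have := u.2
  simp only [wp_block_cons, wp_block_nil, wp_add, wp_load, wp_store, wp_sub, wp_cond, wp_skip,
    State.set_reg, State.set_mem, State.set_out, State.put_mem, State.put_out,
    hc'.one, hc'.level, e11, h22, hu, Nat.reduceEqDiff, if_true, if_false, agree_set, agree_put,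
    Nat.reduceLeDiff, Nat.sub_eq_zero_iff_le, true_and]
  by_cases hle : lev u ≤ d
  · simp only [hle, if_true]
    exact ⟨by omega, by omega, by omega, by omega, Agree.refl _ _, fun i => trivial, by omega⟩
  · simp only [hle, if_false]
    refine ⟨by omega, by omega, Agree.refl _ _, fun i => ?_, by omega⟩
    split_ifs with hi
    · rw [hi, hu]
    · rfl

/-- Moves all marked vertices to the level `d + 1`, where `d` is the contents of register
11. -/
def dropProg : Prog := forVertices (block [
  .add 28 7 22, .load 28 28,
  .cond 28 (block [.add 28 6 22, .add 29 11 1, .store 28 29]) .skip])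

/-- Used to remove the attractor of a returned set from the current set. -/
theorem wp_dropProg {m : ℕ} (hfit : Fits w S n m d₀) (hc : Consts n m d₀ s.reg)
    (hl : HasLevel m lev s.mem) (hA : HasMarks m A s.mem) (hd : s.reg 11 = d) (hd₀ : d ≤ d₀)
    (hQ : ∀ s' t', Agree 22 s s' → s'.out = s.out →
      SameOff (3 + 2 * n + 2 * m) (3 + 3 * n + 2 * m) s.mem s'.mem →
      HasLevel m (fun v => if v ∈ A then d + 1 else lev v) s'.mem →
      t' ≤ t + (n * 14 + 4) → Q s' t') :
    WP w S dropProg Q s t := by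
  have hfit' := hfit
  obtain ⟨hf1, hf2, hf3⟩ := hfit'
  refine wp_levelScan (T := 10) hfit hc hl (fun u s' t' hc' hr h22 hm hu => ?_) hQ
  have e11 := (hr 11 (by norm_num)).trans hd
  have := u.2
  have m1 : s'.mem (3 + 3 * n + 2 * m + u) = _ := (hm _ (by omega)).trans (hA u)
  simp only [wp_block_cons, wp_block_nil, wp_add, wp_load, wp_store, wp_cond, wp_skip,
    State.set_reg, State.set_mem, State.set_out, State.put_mem, State.put_out,
    hc'.one, hc'.level, hc'.marks, e11, h22, m1, Nat.reduceEqDiff, if_true, if_false, agree_set,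
    agree_put, Nat.reduceLeDiff, true_and]
  by_cases hle : u ∈ A
  · simp only [hle, if_true, one_ne_zero, if_false]
    exact ⟨by omega, by omega, by omega, by omega, by omega, Agree.refl _ _, fun i => trivial,
      by omega⟩
  · simp only [hle, if_false, if_true]
    refine ⟨by omega, by omega, Agree.refl _ _, fun i => ?_, by omega⟩
    split_ifs with hi
    · rw [hi, hu]
    · rfl

/-- Moves all vertices of level at most `d` that are not marked to the level `d - 1`, where `d` is
the contents of register 11. -/
def lowerProg : Prog := forVertices (block [
  .add 28 6 22, .load 29 28, .sub 29 29 11,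
  .cond 29 .skip (block [.add 29 7 22, .load 29 29,
    .cond 29 .skip (block [.sub 29 11 1, .store 28 29])])])

/-- Used to enter a subcall on `H`: the attractor of the top priority is marked, and the rest goes
down. -/
theorem wp_lowerProg {m : ℕ} (hfit : Fits w S n m d₀) (hc : Consts n m d₀ s.reg)
    (hl : HasLevel m lev s.mem) (hA : HasMarks m A s.mem) (hd : s.reg 11 = d)
    (hQ : ∀ s' t', Agree 22 s s' → s'.out = s.out →
      SameOff (3 + 2 * n + 2 * m) (3 + 3 * n + 2 * m) s.mem s'.mem →
      HasLevel m (fun v => if v ∈ below lev d \ A then d - 1 else lev v) s'.mem →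
      t' ≤ t + (n * 18 + 4) → Q s' t') :
    WP w S lowerProg Q s t := by
  have hfit' := hfit
  obtain ⟨hf1, hf2, hf3⟩ := hfit'
  refine wp_levelScan (T := 14) hfit hc hl (fun u s' t' hc' hr h22 hm hu => ?_) hQ
  have e11 := (hr 11 (by norm_num)).trans hd
  have := u.2
  have m1 : s'.mem (3 + 3 * n + 2 * m + u) = _ := (hm _ (by omega)).trans (hA u)
  have hskip : ∀ i, s'.mem i = if i = 3 + 2 * n + 2 * m + ↑u then lev u else s'.mem i := by
    intro i
    split_ifs with hi
    · rw [hi, hu]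
    · rfl
  simp only [wp_block_cons, wp_block_nil, wp_add, wp_load, wp_sub, wp_store, wp_cond, wp_skip,
    State.set_reg, State.set_mem, State.set_out, State.put_mem, State.put_out,
    hc'.one, hc'.level, hc'.marks, e11, h22, hu, m1, Nat.reduceEqDiff, if_true, if_false, agree_set,
    agree_put, Nat.reduceLeDiff, Nat.sub_eq_zero_iff_le, true_and, Finset.mem_sdiff, mem_below]
  by_cases hle : lev u ≤ d
  · by_cases hmA : u ∈ A
    · simp only [hle, hmA, if_true, one_ne_zero, if_false, not_true_eq_false, and_false]
      exact ⟨by omega, by omega, by omega, by omega, Agree.refl _ _, hskip, by omega⟩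
    · simp only [hle, hmA, if_false, if_true, not_false_eq_true, and_self]
      exact ⟨by omega, by omega, by omega, by omega, by omega, Agree.refl _ _, fun i => trivial,
        by omega⟩
  · simp only [hle, if_false, false_and]
    exact ⟨by omega, by omega, Agree.refl _ _, hskip, by omega⟩

/-- Marks the vertices of level less than the contents of register 11. -/
def markLower : Prog := block [.add 19 0 0, forVertices (block [
  .add 28 6 22, .load 28 28, .sub 28 11 28, .add 29 7 22,
  .cond 28 (block [.store 29 1, .add 19 1 0]) (.store 29 0)])]

/-- After a return, once register 11 again holds the caller's priority, the vertices on lower levels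
are exactly the returned set. -/
theorem wp_markLower {m : ℕ} (hfit : Fits w S n m d₀) (hc : Consts n m d₀ s.reg)
    (hl : HasLevel m lev s.mem) (hd : s.reg 11 = d)
    (hA : ∀ v, v ∈ A ↔ lev v < d)
    (hQ : ∀ s' t', Agree 19 s s' → s'.out = s.out →
      SameOff (3 + 3 * n + 2 * m) (3 + 4 * n + 2 * m) s.mem s'.mem → HasMarks m A s'.mem →
      (s'.reg 19 = 0 ↔ A = ∅) → t' ≤ t + (n * 16 + 6) → Q s' t') :
    WP w S markLower Q s t := by
  have hfit' := hfit
  obtain ⟨hf1, hf2, hf3⟩ := hfit'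
  unfold markLower
  simp only [wp_block_cons, wp_block_nil, wp_add, hc.zero]
  refine ⟨by omega, wp_markScan (A := A) (T := 12) hfit (hc.congr fun i hi => ?_) ?_ ?_ ?_⟩
  · rw [State.set_reg, if_neg (by omega)]
  · rw [State.set_reg, if_pos rfl]
  · intro u s' t' hc' hr h22 hm
    have hr' : Agree 19 s s' := fun r hlt => (hr r hlt).trans (by
      rw [State.set_reg, if_neg (by omega)])
    have e11 := (hr' 11 (by norm_num)).trans hd
    have := u.2
    have m1 : s'.mem (3 + 2 * n + 2 * m + u) = _ := (hm _ (by omega)).trans (hl u)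
    simp only [wp_block_cons, wp_block_nil, wp_add, wp_load, wp_sub, wp_store, wp_cond,
      State.set_reg, State.set_mem, State.set_out, State.put_reg, State.put_mem, State.put_out,
      hc'.zero, hc'.one, hc'.level, hc'.marks, e11, h22, m1, Nat.reduceEqDiff, if_true, if_false,
      agree_set, agree_put, Nat.reduceLeDiff, le_refl, Nat.sub_eq_zero_iff_le, true_and, hA]
    by_cases hle : d ≤ lev u
    · simp only [hle, if_true, not_lt.2 hle, if_false]
      and_intros <;> first | trivial | omega | exact Agree.refl _ _ | simp
    · simp only [hle, if_false, not_le.1 hle, if_true]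
      and_intros <;> first | trivial | omega | exact Agree.refl _ _ | simp
  · intro s' t' h1 h2 h3 h4 h5 ht
    exact hQ s' _ (fun r hlt => (h1 r hlt).trans (by rw [State.set_reg, if_neg (by omega)]))
      h2 h3 h4 h5 (by omega)

/-- Marks the vertices of level at most `d` and priority `d`, the contents of register 11. -/
def markTop : Prog := block [.add 19 0 0, forVertices (block [
  .add 28 6 22, .load 28 28, .sub 28 28 11,
  .add 29 9 22, .load 29 29, .sub 30 29 11, .sub 29 11 29, .add 29 29 30, .add 30 7 22,
  .cond 28 (.store 30 0) (.cond 29 (.store 30 0) (block [.store 30 1, .add 19 1 0]))])]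

theorem wp_markTop (hfit : Fits w S n edges.length d₀) (hc : Consts n edges.length d₀ s.reg)
    (hg : HasGame 𝒢 edges s.mem) (hl : HasLevel edges.length lev s.mem) (hd : s.reg 11 = d)
    (hd₀ : d ≤ d₀) (hp : ∀ v, 𝒢.priority v ≤ d₀)
    (hQ : ∀ s' t', Agree 19 s s' → s'.out = s.out →
      SameOff (3 + 3 * n + 2 * edges.length) (3 + 4 * n + 2 * edges.length) s.mem s'.mem →
      HasMarks edges.length ((below lev d).filter fun v => 𝒢.priority v = d) s'.mem →
      t' ≤ t + (n * 24 + 6) → Q s' t') :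
    WP w S markTop Q s t := by
  have hfit' := hfit
  obtain ⟨hf1, hf2, hf3⟩ := hfit'
  unfold markTop
  simp only [wp_block_cons, wp_block_nil, wp_add, hc.zero]
  refine ⟨by omega, wp_markScan (A := (below lev d).filter fun v => 𝒢.priority v = d) (T := 20)
    hfit (hc.congr fun i hi => ?_) ?_ ?_ ?_⟩
  · rw [State.set_reg, if_neg (by omega)]
  · rw [State.set_reg, if_pos rfl]
  · intro u s' t' hc' hr h22 hm
    have hr' : Agree 19 s s' := fun r hlt => (hr r hlt).trans (by
      rw [State.set_reg, if_neg (by omega)])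
    have e11 := (hr' 11 (by norm_num)).trans hd
    have := u.2
    have m1 : s'.mem (3 + 2 * n + 2 * edges.length + u) = _ := (hm _ (by omega)).trans (hl u)
    have m2 : s'.mem (3 + n + u) = _ := (hm _ (by omega)).trans (hg.prio u)
    have hpu := hp u
    have heq : d - 𝒢.priority u + (𝒢.priority u - d) = 0 ↔ 𝒢.priority u = d := by omega
    simp only [wp_block_cons, wp_block_nil, wp_add, wp_load, wp_sub, wp_store, wp_cond,
      State.set_reg, State.set_mem, State.set_out, State.put_reg, State.put_mem, State.put_out,
      hc'.zero, hc'.one, hc'.level, hc'.marks, hc'.prios, e11, h22, m1, m2, Nat.reduceEqDiff,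
      if_true, if_false, agree_set, agree_put, Nat.reduceLeDiff, le_refl, Nat.sub_eq_zero_iff_le,
      true_and, Finset.mem_filter, mem_below, heq]
    by_cases hle : lev u ≤ d <;> by_cases hpr : 𝒢.priority u = d <;>
      simp only [hle, hpr, if_true, if_false, and_self, and_false, false_and] <;>
      and_intros <;> first | trivial | omega | exact Agree.refl _ _ | simp
  · intro s' t' h1 h2 h3 h4 h5 ht
    exact hQ s' _ (fun r hlt => (h1 r hlt).trans (by rw [State.set_reg, if_neg (by omega)]))
      h2 h3 h4 (by omega)

end RAM

/-! ## The main loop -/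

namespace RAM

open ParityGame

variable {n w S d₀ d p q : ℕ} {𝒢 : ParityGame (Fin n)} {edges : List (Fin n × Fin n)}
  {Q : State → ℕ → Prop} {s s' : State} {t : ℕ} {lev lev' : Fin n → ℕ} {A : Finset (Fin n)}
  {℘ : Player} {stk : List (ℕ × ℕ × ℕ)} {out out' : List ℕ}

/-- The stack, whose first element is the one stored last. -/
def HasStack (base : ℕ) (mem : ℕ → ℕ) : List (ℕ × ℕ × ℕ) → Prop
  | [] => True
  | e :: l => mem (base + 3 * l.length) = e.1 ∧ mem (base + 3 * l.length + 1) = e.2.1 ∧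
      mem (base + 3 * l.length + 2) = e.2.2 ∧ HasStack base mem l

theorem HasStack.congr {base : ℕ} {mem mem' : ℕ → ℕ} (h : HasStack base mem stk)
    (hm : ∀ i, base ≤ i → i < base + 3 * stk.length → mem' i = mem i) :
    HasStack base mem' stk := by
  induction stk with
  | nil => trivial
  | cons e l ih =>
    obtain ⟨h1, h2, h3, h4⟩ := h
    rw [List.length_cons] at hm
    exact ⟨by rw [hm _ (by omega) (by omega), h1], by rw [hm _ (by omega) (by omega), h2],
      by rw [hm _ (by omega) (by omega), h3], ih h4 fun i hi hi' => hm i hi (by omega)⟩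

/-- The state `s` of the machine represents a state of the algorithm: the levels of the vertices,
the arguments of the current call, the data stored for the pending calls with halved precision,
and the output. -/
structure Rep (𝒢 : ParityGame (Fin n)) (edges : List (Fin n × Fin n)) (d₀ S : ℕ) (s : State)
    (lev : Fin n → ℕ) (d p q : ℕ) (℘ : Player) (stk : List (ℕ × ℕ × ℕ)) (out : List ℕ) :
    Prop where
  consts : Consts n edges.length d₀ s.reg
  game : HasGame 𝒢 edges s.mem
  level : HasLevel edges.length lev s.mem
  stack : HasStack (3 + 4 * n + 2 * edges.length) s.mem stk
  room : 3 + 4 * n + 2 * edges.length + 3 * stk.length ≤ S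
  sp : s.reg 10 = 3 + 4 * n + 2 * edges.length + 3 * stk.length
  maxPriority : s.reg 11 = d
  ownPrec : s.reg 12 = p
  oppPrec : s.reg 13 = q
  player : s.reg 14 = encodePlayer ℘
  output : s.out = out
  le_top : d ≤ d₀
  ownPrec_le : p ≤ n
  oppPrec_le : q ≤ n
  stack_le : ∀ e ∈ stk, e.1 ≤ d₀ ∧ e.2.2 ≤ n

/-- The registers from 15 on and the array of marks are not part of the represented state; they
serve as control flags and scratch space. -/
theorem Rep.congr (h : Rep 𝒢 edges d₀ S s lev d p q ℘ stk out) (hr : Agree 15 s s')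
    (hm : ∀ i, i < 3 + 2 * n + 2 * edges.length ∨ 3 + 4 * n + 2 * edges.length ≤ i →
      s'.mem i = s.mem i)
    (hl : HasLevel edges.length lev' s'.mem) (ho : s'.out = out') :
    Rep 𝒢 edges d₀ S s' lev' d p q ℘ stk out' where
  consts := h.consts.congr fun i hi => hr i (by omega)
  game := h.game.congr fun i hi => hm i (by omega)
  level := hl
  stack := h.stack.congr fun i hi _ => hm i (by omega)
  room := h.room
  sp := (hr _ (by norm_num)).trans h.sp
  maxPriority := (hr _ (by norm_num)).trans h.maxPriority
  ownPrec := (hr _ (by norm_num)).trans h.ownPrec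
  oppPrec := (hr _ (by norm_num)).trans h.oppPrec
  player := (hr _ (by norm_num)).trans h.player
  output := ho
  le_top := h.le_top
  ownPrec_le := h.ownPrec_le
  oppPrec_le := h.oppPrec_le
  stack_le := h.stack_le

theorem encodePlayer_opp (℘ : Player) : 1 - encodePlayer ℘ = encodePlayer ℘.opp := by
  cases ℘ <;> rfl

/-- Starts a call: register 17 is set to `1` if a call with halved precision follows, and to `0`
if the empty set is returned. -/
def callProg : Prog := block [
  .emit 14, .emit 11, .emit 12, .emit 13, emitSet,
  .add 17 0 0, .add 18 0 0, .sub 28 12 1,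
  .cond 19 (.cond 28 (.cond 11 (.add 17 1 0) .skip) .skip) .skip,
  .cond 17 .skip (block [clearProg, .add 16 0 0])]

theorem wp_callProg (hfit : Fits w S n edges.length d₀)
    (hR : Rep 𝒢 edges d₀ S s lev d p q ℘ stk out)
    (hQ₁ : ∀ s' t', below lev d = ∅ ∨ p ≤ 1 ∨ d = 0 →
      Rep 𝒢 edges d₀ S s' (fun v => if lev v ≤ d then d + 1 else lev v) d p q ℘ stk
        (out ++ encodeCall ⟨℘, below lev d, d, p, q⟩) →
      s'.reg 15 = s.reg 15 → s'.reg 16 = 0 → s'.reg 17 = 0 → t' ≤ t + (n * 28 + 50) → Q s' t')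
    (hQ₂ : ∀ s' t', ¬ (below lev d = ∅ ∨ p ≤ 1 ∨ d = 0) →
      Rep 𝒢 edges d₀ S s' lev d p q ℘ stk (out ++ encodeCall ⟨℘, below lev d, d, p, q⟩) →
      s'.reg 15 = s.reg 15 → s'.reg 17 = 1 → s'.reg 18 = 0 → t' ≤ t + (n * 28 + 50) → Q s' t') :
    WP w S callProg Q s t := by
  have hfit' := hfit
  obtain ⟨hf1, hf2, hf3⟩ := hfit'
  unfold callProg
  simp only [wp_block_cons, wp_emit]
  refine wp_emitSet hfit hR.consts hR.level hR.maxPriority fun s₁ t₁ hr₁ hm₁ ho₁ hf ht₁ => ?_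
  change Agree 19 s s₁ at hr₁
  simp only [State.print_mem, State.print_out, State.print_reg, hR.maxPriority, hR.player,
    hR.ownPrec, hR.oppPrec, hR.output] at hm₁ ho₁
  have hout : s₁.out = out ++ encodeCall ⟨℘, below lev d, d, p, q⟩ := by
    simp [ho₁, encodeCall]
  have hR₁ : Rep 𝒢 edges d₀ S s₁ lev d p q ℘ stk (out ++ encodeCall ⟨℘, below lev d, d, p, q⟩) :=
    hR.congr (hr₁.mono (by norm_num)) (fun i _ => by rw [hm₁]) (by rw [hm₁]; exact hR.level) hout
  have e15 := hr₁ 15 (by norm_num)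
  simp only [wp_block_nil, wp_block_cons, wp_add, wp_sub, wp_cond, wp_skip, State.set_reg,
    Nat.reduceEqDiff, if_true, if_false, hR₁.consts.zero, hR₁.consts.one, hR₁.ownPrec,
    hR₁.maxPriority, hf]
  -- The three reasons for returning the empty set leave different branches of the nested tests but
  -- continue alike.
  have hclear : ∀ s₂ t₂, below lev d = ∅ ∨ p ≤ 1 ∨ d = 0 → Agree 16 s₁ s₂ → s₂.mem = s₁.mem →
      s₂.out = s₁.out → s₂.reg 17 = 0 → t₂ ≤ t₁ + 16 →
      WP w S clearProg (fun s' t' => s'.reg 0 + s'.reg 0 < 2 ^ w ∧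
        Q (s'.set 16 (s'.reg 0 + s'.reg 0)) (t' + 1 + 1 + 1)) s₂ t₂ := by
    intro s₂ t₂ hcond hr₂ hm₂ ho₂ h17 ht₂
    have hR₂ : Rep 𝒢 edges d₀ S s₂ lev d p q ℘ stk _ :=
      hR₁.congr (hr₂.mono (by norm_num)) (fun i _ => by rw [hm₂]) (by rw [hm₂]; exact hR₁.level)
        (ho₂.trans hout)
    refine wp_clearProg hfit hR₂.consts hR₂.level hR₂.maxPriority hR₂.le_top
      fun s₃ t₃ hr₃ ho₃ hm₃ hl₃ ht₃ => ?_
    have e0 := (hr₃ 0 (by norm_num)).trans hR₂.consts.zero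
    rw [e0]
    refine ⟨by omega, hQ₁ _ _ hcond ?_ ?_ ?_ ?_ (by omega)⟩
    · refine hR₂.congr ?_ ?_ hl₃ ?_
      · rw [agree_set (by norm_num)]
        exact hr₃.mono (by norm_num)
      · exact fun i hi => hm₃ i (by omega)
      · exact ho₃.trans hR₂.output
    · rw [State.set_reg, if_neg (by norm_num), hr₃ _ (by norm_num), hr₂ _ (by norm_num), e15]
    · rw [State.set_reg, if_pos rfl]
    · rw [State.set_reg, if_neg (by norm_num), hr₃ _ (by norm_num), h17]
  refine ⟨by omega, by omega, ?_⟩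
  by_cases c1 : below lev d = ∅
  · simp only [c1, if_true]
    refine hclear _ _ (Or.inl c1) ?_ ?_ ?_ ?_ (by omega)
    · simp only [agree_set, Nat.reduceLeDiff]
      exact Agree.refl _ _
    all_goals simp [State.set_mem, State.set_out, State.set_reg]
  by_cases c2 : p - 1 = 0
  · simp only [c1, c2, if_true, if_false]
    refine hclear _ _ (Or.inr (Or.inl (by omega))) ?_ ?_ ?_ ?_ (by omega)
    · simp only [agree_set, Nat.reduceLeDiff]
      exact Agree.refl _ _
    all_goals simp [State.set_mem, State.set_out, State.set_reg]
  by_cases c3 : d = 0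
  · rw [if_neg c1, if_neg c2, if_pos c3]
    refine hclear _ _ (Or.inr (Or.inr c3)) ?_ ?_ ?_ ?_ (by omega)
    · simp only [agree_set, Nat.reduceLeDiff]
      exact Agree.refl _ _
    all_goals simp [State.set_mem, State.set_out, State.set_reg]
  simp only [c1, c2, c3, if_false, Nat.add_zero]
  refine ⟨by omega, ?_⟩
  refine hQ₂ _ _ ?_ ?_ ?_ ?_ ?_ (by omega)
  · rintro (h | h | h)
    exacts [c1 h, c2 (by omega), c3 h]
  · refine hR₁.congr ?_ (fun i _ => rfl) hR₁.level hout
    simp only [agree_set, Nat.reduceLeDiff]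
    exact Agree.refl _ _
  all_goals simp [State.set_reg, e15]

/-- Passes to a call: to one with halved precision if register 17 contains `1`, in which case the
register 18 and the precision are stored, and to one with full precision otherwise. -/
def downProg : Prog := block [
  markTop, .add 20 14 0, attrProg, lowerProg, .sub 28 17 1,
  .cond 28 .skip (block [.store 10 11, .add 10 10 1, .store 10 18, .add 10 10 1, .store 10 13,
    .add 10 10 1, .half 13 13]),
  .add 28 12 0, .add 12 13 0, .add 13 28 0, .sub 14 1 14, .sub 11 11 1, .add 16 1 0]

/-- A bound for the time needed by one execution of the body of the main loop. -/
def partBound (n m : ℕ) : ℕ := n * (n * (m * 25 + 41) + 10) + n * 60 + 100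

/-- Halving loses the parity of `q`, so a halved call saves `q`, together with the phase in register
18. A call with full precision only exchanges the precisions, which is reversible without any
storage. -/
theorem wp_downProg (hfit : Fits w S n edges.length d₀) (he : 𝒢.IsEdgeList edges)
    (hp : ∀ v, 𝒢.priority v ≤ d₀) (hR : Rep 𝒢 edges d₀ S s lev (d + 1) p q ℘ stk out)
    (hG : 𝒢.IsSubgame (below lev (d + 1)))
    (h17 : s.reg 17 = 1 ∨ s.reg 17 = 2)
    (hroom : s.reg 17 = 1 → 3 + 4 * n + 2 * edges.length + 3 * (stk.length + 1) ≤ S)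
    (hQ : ∀ s' t', Rep 𝒢 edges d₀ S s'
        (fun v => if v ∈ 𝒢.rest ℘ (d + 1) (below lev (d + 1)) then d else lev v) d
        (if s.reg 17 = 1 then q / 2 else q) p ℘.opp
        (if s.reg 17 = 1 then (d + 1, s.reg 18, q) :: stk else stk) out →
      s'.reg 15 = s.reg 15 → s'.reg 16 = 1 → t' ≤ t + partBound n edges.length → Q s' t') :
    WP w S downProg Q s t := by
  have hfit' := hfit
  obtain ⟨hf1, hf2, hf3⟩ := hfit'
  unfold downProg
  rw [wp_block_cons]
  refine wp_markTop hfit hR.consts hR.game hR.level hR.maxPriority hR.le_top hp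
    fun s₁ t₁ hr₁ ho₁ hm₁ hA₁ ht₁ => ?_
  have hR₁ : Rep 𝒢 edges d₀ S s₁ lev (d + 1) p q ℘ stk out :=
    hR.congr (hr₁.mono (by norm_num)) (fun i _ => hm₁ i (by omega))
      (hR.level.congr fun i _ _ => hm₁ i (by omega)) (ho₁.trans hR.output)
  have hlt := encodePlayer_le ℘
  simp only [wp_block_cons, wp_add, hR₁.consts.zero, hR₁.player]
  refine ⟨by omega, ?_⟩
  refine wp_attrProg (℘ := ℘) hfit he (hR₁.consts.congr fun i hi => ?_) hR₁.game hR₁.level hA₁ ?_ ?_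
    hG (Finset.filter_subset _ _) fun s₂ t₂ hm₂ ho₂ hr₂ hA₂ ht₂ => ?_
  · rw [State.set_reg, if_neg (by omega)]
  · rw [State.set_reg, if_neg (by norm_num), hR₁.maxPriority]
  · rw [State.set_reg, if_pos rfl, Nat.add_zero]
  have hr₂' : Agree 20 s₁ s₂ := fun r hr => by
    rw [hr₂ r (by omega), State.set_reg, if_neg (by omega)]
  have hR₂ : Rep 𝒢 edges d₀ S s₂ lev (d + 1) p q ℘ stk out :=
    hR₁.congr (hr₂'.mono (by norm_num)) (fun i _ => hm₂ i (by omega))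
      (hR₁.level.congr fun i _ _ => hm₂ i (by omega)) (ho₂.trans hR₁.output)
  refine wp_lowerProg hfit hR₂.consts hR₂.level hA₂ hR₂.maxPriority
    fun s₃ t₃ hr₃ ho₃ hm₃ hl₃ ht₃ => ?_
  have hR₃ : Rep 𝒢 edges d₀ S s₃
      (fun v => if v ∈ 𝒢.rest ℘ (d + 1) (below lev (d + 1)) then d else lev v)
      (d + 1) p q ℘ stk out :=
    hR₂.congr (hr₃.mono (by norm_num)) (fun i _ => hm₃ i (by omega)) hl₃ (ho₃.trans hR₂.output)
  have hr : Agree 19 s s₃ := hr₁.trans ((hr₂'.mono (by norm_num)).trans (hr₃.mono (by norm_num)))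
  have e15 := hr 15 (by norm_num)
  have e17 := hr 17 (by norm_num)
  have e18 := hr 18 (by norm_num)
  simp only [wp_block_nil, wp_block_cons, wp_add, wp_sub, wp_cond, wp_skip, wp_store, wp_half,
    State.set_reg, State.put_reg, Nat.reduceEqDiff, if_true, if_false, hR₃.consts.zero,
    hR₃.consts.one, hR₃.ownPrec, hR₃.oppPrec, hR₃.player, hR₃.maxPriority, hR₃.sp, e17, e18]
  have hpn := hR.ownPrec_le
  have hqn := hR.oppPrec_le
  have hdd := hR.le_top
  have htime : t₃ + 25 ≤ t + partBound n edges.length := by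
    unfold partBound
    omega
  rcases h17 with h | h
  · have hroom' := hroom h
    simp only [h, Nat.sub_self, if_true, Nat.add_zero]
    refine ⟨by omega, by omega, by omega, by omega, by omega, by omega, by omega, by omega, by omega,
      by omega, ?_⟩
    simp only [h, if_true] at hQ
    refine hQ _ _ ?_ ?_ ?_ (by omega)
    · constructor
      · refine hR₃.consts.congr (show Agree 10 s₃ _ from ?_)
        simp only [agree_set, agree_put, Nat.reduceLeDiff, le_refl]
        exact Agree.refl _ _
      · exact hR₃.game.congr fun i hi => by
          simp only [State.set_mem, State.put_mem]
          split_ifs <;> omega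
      · exact hR₃.level.congr fun i hi hi' => by
          simp only [State.set_mem, State.put_mem]
          split_ifs <;> omega
      · refine ⟨?_, ?_, ?_, hR₃.stack.congr fun i hi hi' => ?_⟩ <;>
          simp only [State.set_mem, State.put_mem] <;> split_ifs <;> omega
      · rw [List.length_cons]
        exact hroom'
      · simp only [State.set_reg, State.put_reg, Nat.reduceEqDiff, if_true, if_false,
          List.length_cons]
        omega
      all_goals try simp [State.set_reg, encodePlayer_opp]
      · exact hR₃.output
      all_goals try omega
      · exact ⟨⟨hdd, hqn⟩, fun a b c => hR.stack_le (a, b, c)⟩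
    · simp [State.set_reg, State.put_reg, e15]
    · simp [State.set_reg]
  · simp only [h, Nat.reduceSub, one_ne_zero, if_false, Nat.add_zero]
    refine ⟨by omega, by omega, by omega, by omega, ?_⟩
    simp only [h, Nat.reduceEqDiff, if_false] at hQ
    refine hQ _ _ ?_ ?_ ?_ (by omega)
    · constructor
      · refine hR₃.consts.congr (show Agree 10 s₃ _ from ?_)
        simp only [agree_set, Nat.reduceLeDiff]
        exact Agree.refl _ _
      · exact hR₃.game
      · exact hR₃.level
      · exact hR₃.stack
      · exact hR₃.room
      all_goals try simp [State.set_reg, encodePlayer_opp]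
      · exact hR₃.sp
      · exact hR₃.output
      all_goals try omega
      · exact fun a b c => hR.stack_le (a, b, c)
    · simp [State.set_reg, e15]
    · simp [State.set_reg]

/-- Returns to the calling procedure; register 18 is set to `1` if the call had full precision, and
to the stored value otherwise. -/
def popProg : Prog := block [
  .add 11 11 1, .add 28 12 0, .add 12 13 0, .add 13 28 0, .sub 14 1 14,
  .const 28 3, .sub 28 10 28, .load 29 28,
  .sub 30 29 11, .sub 29 11 29, .add 29 29 30,
  .cond 29 (.add 18 1 0) (block [.add 10 28 0, .add 28 28 1, .load 18 28, .add 28 28 1,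
    .load 13 28])]

/-- An entry of the caller's priority on top means that the finished call was a halved one; any
other entry means full precision. The stack has to be nonempty for this test, which is ensured by an
initial entry of priority `0`. -/
theorem wp_popProg {e : ℕ × ℕ × ℕ} (hfit : Fits w S n edges.length d₀)
    (hR : Rep 𝒢 edges d₀ S s lev d p q ℘ (e :: stk) out) (hd : d < d₀)
    (hQ : ∀ s' t', Rep 𝒢 edges d₀ S s' lev (d + 1) q (if e.1 = d + 1 then e.2.2 else p) ℘.opp
        (if e.1 = d + 1 then stk else e :: stk) out →
      s'.reg 15 = s.reg 15 → s'.reg 16 = s.reg 16 → s'.reg 17 = s.reg 17 →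
      s'.reg 18 = (if e.1 = d + 1 then e.2.1 else 1) → t' ≤ t + 30 → Q s' t') :
    WP w S popProg Q s t := by
  obtain ⟨hf1, hf2, hf3⟩ := hfit
  obtain ⟨k1, k2, k3, k4⟩ := hR.stack
  have hsp := hR.sp
  have hroom := hR.room
  rw [List.length_cons] at hsp hroom
  have hpn := hR.ownPrec_le
  have hqn := hR.oppPrec_le
  have he := hR.stack_le e (by simp)
  have haddr : 3 + 4 * n + 2 * edges.length + 3 * (stk.length + 1) - 3 =
      3 + 4 * n + 2 * edges.length + 3 * stk.length := by omega
  have hlt := encodePlayer_le ℘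
  have heq : d + 1 - e.1 + (e.1 - (d + 1)) = 0 ↔ e.1 = d + 1 := by omega
  unfold popProg
  simp only [wp_block_nil, wp_block_cons, wp_add, wp_sub, wp_cond, wp_load, wp_const,
    State.set_reg, State.set_mem, Nat.reduceEqDiff, if_true, if_false, hR.consts.zero,
    hR.consts.one, hR.ownPrec, hR.oppPrec, hR.player, hR.maxPriority, hsp, haddr, k1, heq]
  refine ⟨by omega, by omega, by omega, by omega, by omega, by omega, by omega, ?_⟩
  by_cases hc : e.1 = d + 1
  · simp only [hc, if_true, Nat.add_zero, k2, k3] at hQ ⊢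
    refine ⟨by omega, by omega, by omega, by omega, by omega, hQ _ _ ?_ ?_ ?_ ?_ ?_ (by omega)⟩
    · constructor
      · refine hR.consts.congr (show Agree 10 s _ from ?_)
        simp only [agree_set, Nat.reduceLeDiff]
        exact Agree.refl _ _
      · exact hR.game
      · exact hR.level
      · exact k4
      · omega
      all_goals try simp [State.set_reg, encodePlayer_opp]
      · exact hR.output
      all_goals try omega
      · exact fun a b c h => hR.stack_le (a, b, c) (List.mem_cons_of_mem _ h)
    all_goals simp [State.set_reg]
  · simp only [hc, if_false, Nat.add_zero] at hQ ⊢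
    refine ⟨by omega, hQ _ _ ?_ ?_ ?_ ?_ ?_ (by omega)⟩
    · constructor
      · refine hR.consts.congr (show Agree 10 s _ from ?_)
        simp only [agree_set, Nat.reduceLeDiff]
        exact Agree.refl _ _
      · exact hR.game
      · exact hR.level
      · exact hR.stack
      · exact hR.room
      · exact hR.sp
      all_goals try simp [State.set_reg, encodePlayer_opp]
      · exact hR.output
      all_goals try omega
      · exact ⟨he, fun a b c h => hR.stack_le (a, b, c) (List.mem_cons_of_mem _ h)⟩
    all_goals simp [State.set_reg]

/-- Returns to the calling procedure and removes the attractor of the returned set. Register 17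
is set to `1` or `2` if a call with halved or with full precision follows, and to `0`
otherwise. -/
def unwindProg : Prog := block [
  popProg, markLower, .sub 20 1 14, attrProg, dropProg,
  .cond 19 (block [.add 17 1 0, .cond 18 (.const 18 2) .skip]) (.cond 18 .skip (.const 17 2))]

/-- Here `℘` is the player of the finished call. The phase `ph` is `0` in the first loop, `1` for
the call with full precision and `2` in the second loop. An empty result leads from phase `0` to the
call with full precision and ends the caller otherwise; a nonempty one leads to another halved call.
-/
theorem wp_unwindProg {e : ℕ × ℕ × ℕ} (hfit : Fits w S n edges.length d₀)
    (he : 𝒢.IsEdgeList edges)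
    (hR : Rep 𝒢 edges d₀ S s lev d p q ℘ (e :: stk) out) (hd : d < d₀)
    (hG : 𝒢.IsSubgame (below lev (d + 1))) (h17 : s.reg 17 = 0) {ph : ℕ}
    (hph : ph = if e.1 = d + 1 then e.2.1 else 1)
    (hQ : ∀ s' t', Rep 𝒢 edges d₀ S s'
        (fun v => if v ∈ 𝒢.attr ℘ (below lev d) (below lev (d + 1)) then d + 2 else lev v)
        (d + 1) q (if e.1 = d + 1 then e.2.2 else p) ℘.opp
        (if e.1 = d + 1 then stk else e :: stk) out →
      s'.reg 15 = s.reg 15 → s'.reg 16 = s.reg 16 →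
      (below lev d = ∅ → s'.reg 17 = if ph = 0 then 2 else 0) →
      (below lev d ≠ ∅ → s'.reg 17 = 1 ∧ s'.reg 18 = if ph = 0 then 0 else 2) →
      t' ≤ t + partBound n edges.length → Q s' t') :
    WP w S unwindProg Q s t := by
  have hfit' := hfit
  obtain ⟨hf1, hf2, hf3⟩ := hfit'
  unfold unwindProg
  rw [wp_block_cons]
  refine wp_popProg hfit hR hd fun s₀ t₀ hR₀ g15 g16 g17 g18 ht₀ => ?_
  rw [← hph] at g18
  rw [wp_block_cons]
  refine wp_markLower (A := below lev d) hfit hR₀.consts hR₀.level hR₀.maxPriority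
    (fun v => by rw [mem_below, Nat.lt_succ_iff]) fun s₁ t₁ hr₁ ho₁ hm₁ hA₁ hf ht₁ => ?_
  have hR₁ := hR₀.congr (hr₁.mono (by norm_num)) (fun i _ => hm₁ i (by omega))
      (hR₀.level.congr fun i _ _ => hm₁ i (by omega)) (ho₁.trans hR₀.output)
  simp only [wp_block_cons, wp_sub, hR₁.consts.one, hR₁.player, encodePlayer_opp,
    Player.opp_opp]
  refine wp_attrProg (℘ := ℘) (A := below lev d) hfit he (hR₁.consts.congr fun i hi => ?_) hR₁.game
    hR₁.level hA₁ ?_ ?_ hG (fun v hv => ?_) fun s₂ t₂ hm₂ ho₂ hr₂ hA₂ ht₂ => ?_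
  · rw [State.set_reg, if_neg (by omega)]
  · rw [State.set_reg, if_neg (by norm_num), hR₁.maxPriority]
  · rw [State.set_reg, if_pos rfl]
  · rw [mem_below] at hv ⊢
    omega
  have hr₂' : Agree 20 s₁ s₂ := fun r hr => by
    rw [hr₂ r (by omega), State.set_reg, if_neg (by omega)]
  have hR₂ := hR₁.congr (hr₂'.mono (by norm_num)) (fun i _ => hm₂ i (by omega))
      (hR₁.level.congr fun i _ _ => hm₂ i (by omega)) (ho₂.trans hR₁.output)
  refine wp_dropProg hfit hR₂.consts hR₂.level hA₂ hR₂.maxPriority hR₂.le_top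
    fun s₃ t₃ hr₃ ho₃ hm₃ hl₃ ht₃ => ?_
  have hR₃ := hR₂.congr (hr₃.mono (by norm_num)) (fun i _ => hm₃ i (by omega)) hl₃
    (ho₃.trans hR₂.output)
  have hr : Agree 19 s₀ s₃ := hr₁.trans ((hr₂'.mono (by norm_num)).trans (hr₃.mono (by norm_num)))
  have e15 := (hr 15 (by norm_num)).trans g15
  have e16 := (hr 16 (by norm_num)).trans g16
  have e17 := (hr 17 (by norm_num)).trans (g17.trans h17)
  have e18 := (hr 18 (by norm_num)).trans g18
  have e19 : s₃.reg 19 = 0 ↔ below lev d = ∅ := by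
    rw [hr₃ 19 (by norm_num), hr₂' 19 (by norm_num), hf]
  simp only [wp_block_nil, wp_block_cons, wp_add, wp_cond, wp_skip, wp_const, State.set_reg,
    Nat.reduceEqDiff, if_false, hR₃.consts.zero, hR₃.consts.one, e19, e18]
  have htime : t₃ + 10 ≤ t + partBound n edges.length := by
    unfold partBound
    omega
  by_cases hW : below lev d = ∅
  · by_cases hp0 : ph = 0
    · simp only [hW, hp0, if_true]
      refine ⟨by omega, hQ _ _ ?_ ?_ ?_ ?_ ?_ (by omega)⟩
      · refine hR₃.congr ?_ (fun i _ => rfl) hl₃ hR₃.output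
        simp only [agree_set, Nat.reduceLeDiff]
        exact Agree.refl _ _
      all_goals simp [State.set_reg, e15, e16, hW, hp0]
    · simp only [hW, hp0, if_true, if_false]
      refine hQ _ _ hR₃ e15 e16 ?_ ?_ (by omega)
      all_goals simp [e17, hW, hp0]
  · by_cases hp0 : ph = 0
    · simp only [hW, hp0, if_true, if_false]
      refine ⟨by omega, hQ _ _ ?_ ?_ ?_ ?_ ?_ (by omega)⟩
      · refine hR₃.congr ?_ (fun i _ => rfl) hl₃ hR₃.output
        simp only [agree_set, Nat.reduceLeDiff]
        exact Agree.refl _ _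
      all_goals simp [State.set_reg, e15, e16, e18, hW, hp0]
    · simp only [hW, hp0, if_false]
      refine ⟨by omega, by omega, hQ _ _ ?_ ?_ ?_ ?_ ?_ (by omega)⟩
      · refine hR₃.congr ?_ (fun i _ => rfl) hl₃ hR₃.output
        simp only [agree_set, Nat.reduceLeDiff]
        exact Agree.refl _ _
      all_goals simp [State.set_reg, e15, e16, hW, hp0]

end RAM

/-! ## The simulation of the algorithm -/

namespace RAM

open ParityGame

variable {n w S d₀ d p q K : ℕ} {𝒢 : ParityGame (Fin n)} {edges : List (Fin n × Fin n)}
  {Q : State → ℕ → Prop} {s : State} {t : ℕ} {L : Fin n → ℕ} {W X G : Finset (Fin n)}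
  {℘ : Player} {stk : List (ℕ × ℕ × ℕ)} {out : List ℕ}

/-- Executed at the end of a call: returns to the calling procedure, or stops the main loop. -/
def retProg : Prog := block [.add 17 0 0, .sub 28 3 11, .cond 28 unwindProg (.add 15 0 0)]

/-- The body of the main loop. -/
def mainBody : Prog := block [.cond 16 callProg retProg, .cond 17 downProg .skip]

/-- The levels of the vertices while the current call, with maximal priority `d` and argument `G`,
works on its subset `W`. -/
def stage (d : ℕ) (W G : Finset (Fin n)) (L : Fin n → ℕ) (v : Fin n) : ℕ :=
  if v ∈ W then d else if v ∈ G then d + 1 else L v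

theorem below_stage (hL : ∀ v ∉ G, d < L v) : below (stage d W G L) d = W := by
  ext v
  rw [mem_below, stage]
  have := hL v
  split_ifs with h1 h2
  · simp [h1]
  · simp [h1]
  · simpa [h1] using this h2

/-- The levels of the caller become the background of the subcall, so nested calls are nested
`stage`s of one array. -/
theorem stage_lower (℘ : Player) (hL : ∀ v ∉ G, d + 1 < L v) :
    (fun v => if v ∈ 𝒢.rest ℘ (d + 1) (below (stage (d + 1) X G L) (d + 1)) then d
      else stage (d + 1) X G L v) =
    stage d (𝒢.rest ℘ (d + 1) X) (𝒢.rest ℘ (d + 1) X) (stage (d + 1) X G L) := by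
  rw [below_stage hL]
  funext v
  by_cases h : v ∈ 𝒢.rest ℘ (d + 1) X <;> simp [stage, h]

theorem lt_stage (hL : ∀ v ∉ G, d + 1 < L v) (v : Fin n) : d < stage (d + 1) X G L v := by
  have := hL v
  unfold stage
  split_ifs with h1 h2
  · omega
  · omega
  · have := this h2
    omega

theorem below_stage_succ {R : Finset (Fin n)} (hL : ∀ v ∉ G, d + 1 < L v) (hWR : W ⊆ R)
    (hRX : R ⊆ X) : below (stage d W R (stage (d + 1) X G L)) (d + 1) = X := by
  ext v
  have h := Finset.ext_iff.1 (below_stage (W := X) hL) v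
  rw [mem_below] at h ⊢
  rw [stage]
  split_ifs with h1 h2
  · simp [hRX (hWR h1)]
  · simp [hRX h2]
  · exact h

/-- The vertices of `R` discarded by the subcall are already on level `d + 1`, hence back in the set
of the caller. Only the attractor has to be moved. -/
theorem stage_drop {R A : Finset (Fin n)} (hWA : W ⊆ A) (hRX : R ⊆ X) (hAX : A ⊆ X)
    (hXG : X ⊆ G) :
    (fun v => if v ∈ A then d + 2 else stage d W R (stage (d + 1) X G L) v) =
      stage (d + 1) (X \ A) G L := by
  funext v
  by_cases h1 : v ∈ A
  · simp [stage, h1, hXG (hAX h1)]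
  · have h2 : v ∉ W := fun h => h1 (hWA h)
    by_cases h3 : v ∈ R
    · simp [stage, h1, h2, h3, hRX h3]
    · simp [stage, h1, h2, h3]

/-- The second half of the body of the main loop, and the rest of the execution. -/
def Resume (w S : ℕ) (Q : State → ℕ → Prop) (s : State) (t : ℕ) : Prop :=
  WP w S (block [.cond 17 downProg .skip]) (WP w S (.loop 15 mainBody) Q) s t

theorem wp_mainLoop_call (h15 : s.reg 15 = 1) (h16 : s.reg 16 = 1)
    (h : WP w S callProg (Resume w S Q) s (t + 2)) : WP w S (.loop 15 mainBody) Q s t := by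
  refine wp_loop_of_ne_zero (by simp [h15]) ?_
  rw [mainBody, wp_block_cons, wp_cond, h16, if_neg one_ne_zero]
  exact h

theorem wp_mainLoop_ret (h15 : s.reg 15 = 1) (h16 : s.reg 16 = 0)
    (h : WP w S retProg (Resume w S Q) s (t + 2)) : WP w S (.loop 15 mainBody) Q s t := by
  refine wp_loop_of_ne_zero (by simp [h15]) ?_
  rw [mainBody, wp_block_cons, wp_cond, h16, if_pos rfl]
  exact h

theorem resume_of_eq_zero (h17 : s.reg 17 = 0) (h : WP w S (.loop 15 mainBody) Q s (t + 3)) :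
    Resume w S Q s t := by
  simpa only [Resume, wp_block_cons, wp_block_nil, wp_cond, wp_skip, h17, if_true]

theorem resume_of_ne_zero (h17 : s.reg 17 ≠ 0)
    (h : WP w S downProg (fun s' t' => WP w S (.loop 15 mainBody) Q s' (t' + 1)) s (t + 1)) :
    Resume w S Q s t := by
  simpa only [Resume, wp_block_cons, wp_block_nil, wp_cond, h17, if_false]

/-- The stack has enough room for all calls made by a call with precisions `p` and `q`. -/
def Room (K : ℕ) (stk : List (ℕ × ℕ × ℕ)) (p q : ℕ) : Prop :=
  2 ≤ p → 1 ≤ q ∧ stk.length + Nat.log 2 p + Nat.log 2 q ≤ K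

/-- The top of the stack does not belong to a call with maximal priority `d`. -/
def TopNe (d : ℕ) (stk : List (ℕ × ℕ × ℕ)) : Prop := ∃ e l, stk = e :: l ∧ (e.1 = 0 ∨ d < e.1)

/-- The main loop executes every call with maximal priority `d` correctly. -/
def Simulates (w S d₀ K : ℕ) (𝒢 : ParityGame (Fin n)) (edges : List (Fin n × Fin n)) (d : ℕ) :
    Prop :=
  ∀ (Q : State → ℕ → Prop) (℘ : Player) (G : Finset (Fin n)) (p q : ℕ) (s : State) (t : ℕ)
    (L : Fin n → ℕ) (stk : List (ℕ × ℕ × ℕ)) (out : List ℕ),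
    Rep 𝒢 edges d₀ S s (stage d G G L) d p q ℘ stk out → s.reg 15 = 1 → s.reg 16 = 1 →
    𝒢.IsSubgame G → (∀ v ∉ G, d < L v) → TopNe d stk → Room K stk p q →
    (∀ s' t', Rep 𝒢 edges d₀ S s' (stage d (𝒢.run ℘ G d p q).1 G L) d p q ℘ stk
        (out ++ (𝒢.run ℘ G d p q).2.flatMap encodeCall) →
      s'.reg 15 = 1 → s'.reg 16 = 0 →
      t' + 2 * partBound n edges.length + 20 ≤
        t + 3 * partBound n edges.length * (𝒢.run ℘ G d p q).2.length →
      WP w S (.loop 15 mainBody) Q s' t') →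
    WP w S (.loop 15 mainBody) Q s t

/-- The effect of a single call made by a call with maximal priority `d + 1`. -/
theorem resume_child (hsim : Simulates w S d₀ K 𝒢 edges d) (hfit : Fits w S n edges.length d₀)
    (he : 𝒢.IsEdgeList edges) (hp : ∀ v, 𝒢.priority v ≤ d₀) {q' ph : ℕ}
    (hR : Rep 𝒢 edges d₀ S s (stage (d + 1) X G L) (d + 1) p q ℘ stk out)
    (h15 : s.reg 15 = 1)
    (hcase : s.reg 17 = 1 ∧ q' = q / 2 ∧ s.reg 18 = ph ∨ s.reg 17 = 2 ∧ q' = q ∧ ph = 1)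
    (hX : 𝒢.IsSubgame X) (hXG : X ⊆ G) (hL : ∀ v ∉ G, d + 1 < L v) (hstk : TopNe (d + 1) stk)
    (hroom : Room K stk p q) (hp2 : 2 ≤ p)
    (hK : 3 + 4 * n + 2 * edges.length + 3 * K ≤ S)
    (hQ : ∀ s' t', Rep 𝒢 edges d₀ S s'
        (stage (d + 1)
          (X \ 𝒢.attr ℘.opp (𝒢.run ℘.opp (𝒢.rest ℘ (d + 1) X) d q' p).1 X) G L)
        (d + 1) p q ℘ stk
        (out ++ (𝒢.run ℘.opp (𝒢.rest ℘ (d + 1) X) d q' p).2.flatMap encodeCall) →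
      s'.reg 15 = 1 → s'.reg 16 = 0 →
      ((𝒢.run ℘.opp (𝒢.rest ℘ (d + 1) X) d q' p).1 = ∅ →
        s'.reg 17 = if ph = 0 then 2 else 0) →
      ((𝒢.run ℘.opp (𝒢.rest ℘ (d + 1) X) d q' p).1 ≠ ∅ →
        s'.reg 17 = 1 ∧ s'.reg 18 = if ph = 0 then 0 else 2) →
      t' ≤ t + 3 * partBound n edges.length *
        (𝒢.run ℘.opp (𝒢.rest ℘ (d + 1) X) d q' p).2.length →
      Resume w S Q s' t') :
    Resume w S Q s t := by
  have hbel : below (stage (d + 1) X G L) (d + 1) = X := below_stage hL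
  obtain ⟨hq1, hlog⟩ := hroom hp2
  -- As `p ≥ 2`, its logarithm leaves room for one more stack entry.
  have hlogp := Nat.log_pos one_lt_two hp2
  refine resume_of_ne_zero (by omega) (wp_downProg hfit he hp hR (by rwa [hbel]) (by omega)
    (fun _ => by omega) fun s₁ t₁ hR₁ g15 g16 ht₁ => ?_)
  rw [stage_lower ℘ hL] at hR₁
  obtain ⟨e, l, rfl, hel⟩ := hstk
  have hq' : (if s.reg 17 = 1 then q / 2 else q) = q' := by
    rcases hcase with h | h <;> simp [h]
  rw [hq'] at hR₁
  generalize hrest : 𝒢.rest ℘ (d + 1) X = R at *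
  have hRX : R ⊆ X := hrest ▸ 𝒢.rest_subset ℘ (d + 1) X
  have hRsub : 𝒢.IsSubgame R := hrest ▸ hX.rest (d + 1)
  have hL' : ∀ v ∉ R, d < stage (d + 1) X G L v := fun v _ => lt_stage hL v
  refine hsim Q _ _ _ _ _ _ _ _ _ hR₁ (g15.trans h15) g16 hRsub hL' ?_ ?_
    fun s₂ t₂ hR₂ k15 k16 ht₂ => ?_
  · split_ifs
    · exact ⟨_, _, rfl, Or.inr (Nat.lt_succ_self d)⟩
    · exact ⟨_, _, rfl, by omega⟩
  -- A pushed entry is paid by the logarithm lost in halving `q`; with full precision the two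
  -- logarithms are merely exchanged.
  · intro h2
    refine ⟨by omega, ?_⟩
    rcases hcase with ⟨h17, rfl, -⟩ | ⟨h17, rfl, -⟩
    · rw [if_pos h17, List.length_cons]
      have : Nat.log 2 q = Nat.log 2 (q / 2) + 1 := Nat.log_of_one_lt_of_le one_lt_two (by omega)
      omega
    · rw [if_neg (by omega)]
      omega
  · generalize hc : 𝒢.run ℘.opp R d q' p = c at *
    have hcR : c.1 ⊆ R := hc ▸ 𝒢.run_subset _ _ _ _ _
    have hlt : d < d₀ := hR.le_top
    refine wp_mainLoop_ret k15 k16 ?_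
    unfold retProg
    simp only [wp_block_cons, wp_block_nil, wp_add, wp_sub, wp_cond, State.set_reg, hR₂.consts.zero,
      hR₂.consts.top, hR₂.maxPriority, Nat.reduceEqDiff, if_true, if_false]
    refine ⟨by have := hfit.levels; omega, ?_⟩
    -- Since `d < d₀`, the finished call is not the outermost one, and the caller is resumed.
    rw [if_neg (by omega)]
    have hR₃ : Rep 𝒢 edges d₀ S ((s₂.set 17 (0 + 0)).set 28 (d₀ - d)) _ d q' p ℘.opp _ _ :=
      hR₂.congr (by
        simp only [agree_set, Nat.reduceLeDiff]
        exact Agree.refl _ _) (fun i _ => rfl) hR₂.level hR₂.output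
    have hb1 : below (stage d c.1 R (stage (d + 1) X G L)) d = c.1 := below_stage hL'
    have hb2 : below (stage d c.1 R (stage (d + 1) X G L)) (d + 1) = X :=
      below_stage_succ hL hcR hRX
    have hattr : 𝒢.attr ℘.opp c.1 X ⊆ X := attr_subset
    have hdrop := stage_drop (d := d) (L := L) (W := c.1) (R := R)
      (𝒢.subset_attr ℘.opp (hcR.trans hRX)) hRX hattr hXG
    rcases hcase with ⟨h17, rfl, h18⟩ | ⟨h17, rfl, rfl⟩
    · rw [if_pos h17] at hR₃
      refine wp_unwindProg (ph := ph) hfit he hR₃ hlt (by rwa [hb2]) (by simp [State.set_reg])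
        (by simp [h18]) fun s₄ t₄ hR₄ l15 l16 l17 l17' ht₄ => ?_
      rw [hb1, hb2, hdrop, Player.opp_opp] at hR₄
      simp only [if_true] at hR₄
      rw [hb1] at l17 l17'
      refine hQ _ _ hR₄ (l15.trans ?_) (l16.trans ?_) l17 l17' ?_
      · simpa [State.set_reg] using k15
      · simpa [State.set_reg] using k16
      -- Of the `3 * partBound` per call, the claim in `Simulates` keeps two parts in reserve; they
      -- pay for `downProg` before the subcall and `unwindProg` after it.
      · omega
    · rw [if_neg (by omega)] at hR₃
      have hne : e.1 ≠ d + 1 := by omega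
      refine wp_unwindProg (ph := 1) hfit he hR₃ hlt (by rwa [hb2]) (by simp [State.set_reg])
        (by simp [hne]) fun s₄ t₄ hR₄ l15 l16 l17 l17' ht₄ => ?_
      rw [hb1, hb2, hdrop, Player.opp_opp] at hR₄
      simp only [hne, if_false] at hR₄
      rw [hb1] at l17 l17'
      refine hQ _ _ hR₄ (l15.trans ?_) (l16.trans ?_) l17 l17' ?_
      · simpa [State.set_reg] using k15
      · simpa [State.set_reg] using k16
      · omega

/-- The effect of a loop of calls with halved precision. -/
theorem resume_repeat (hsim : Simulates w S d₀ K 𝒢 edges d) (hfit : Fits w S n edges.length d₀)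
    (he : 𝒢.IsEdgeList edges) (hp : ∀ v, 𝒢.priority v ≤ d₀) {ph : ℕ} (hph : ph = 0 ∨ ph = 2)
    (hR : Rep 𝒢 edges d₀ S s (stage (d + 1) X G L) (d + 1) p q ℘ stk out)
    (h15 : s.reg 15 = 1) (h17 : s.reg 17 = 1) (h18 : s.reg 18 = ph)
    (hX : 𝒢.IsSubgame X) (hXG : X ⊆ G) (hL : ∀ v ∉ G, d + 1 < L v) (hstk : TopNe (d + 1) stk)
    (hroom : Room K stk p q) (hp2 : 2 ≤ p)
    (hK : 3 + 4 * n + 2 * edges.length + 3 * K ≤ S)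
    {r : Finset (Fin n) × Finset (Fin n) × List (Call (Fin n))}
    (hr : 𝒢.repeatLoop ℘ (d + 1) (fun X => 𝒢.run ℘.opp X d (q / 2) p) X = r)
    (hQ : ∀ s' t', Rep 𝒢 edges d₀ S s' (stage (d + 1) r.1 G L) (d + 1) p q ℘ stk
        (out ++ r.2.2.flatMap encodeCall) →
      s'.reg 15 = 1 → s'.reg 16 = 0 → (s'.reg 17 = if ph = 0 then 2 else 0) →
      t' ≤ t + 3 * partBound n edges.length * r.2.2.length → Resume w S Q s' t') :
    Resume w S Q s t := by
  induction hk : X.card using Nat.strong_induction_on generalizing X s t out r with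
  | _ k ih =>
    rw [repeatLoop_eq _ _ _ _ fun X => 𝒢.run_subset _ _ _ _ _] at hr
    refine resume_child hsim hfit he hp hR h15 (Or.inl ⟨h17, rfl, h18⟩) hX hXG hL hstk hroom hp2 hK
      fun s₁ t₁ hR₁ g15 g16 g17 g17' ht₁ => ?_
    have hsub := 𝒢.run_subset ℘.opp (𝒢.rest ℘ (d + 1) X) d (q / 2) p
    have hX' := hX.sdiff_attr (℘ := ℘.opp) (S := (𝒢.run ℘.opp (𝒢.rest ℘ (d + 1) X) d (q / 2) p).1)
    dsimp only at hr
    split_ifs at hr with hW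
    · subst hr
      exact hQ _ _ hR₁ g15 g16 (g17 hW) ht₁
    · subst hr
      obtain ⟨k17, k18⟩ := g17' hW
      -- A nonempty result keeps the phase `0` or `2`, so the same loop goes on with a smaller set.
      refine ih _ (hk ▸ 𝒢.card_sdiff_attr_lt ℘.opp (hsub.trans (𝒢.rest_subset _ _ _)) hW) hR₁ g15 k17
        (k18.trans (by rcases hph with rfl | rfl <;> rfl)) hX'
        (Finset.sdiff_subset.trans hXG) rfl (fun s₂ t₂ hR₂ l15 l16 l17 ht₂ => ?_) rfl
      refine hQ _ _ ?_ l15 l16 l17 ?_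
      · rwa [List.flatMap_append, ← List.append_assoc]
      · rw [List.length_append, mul_add]
        omega

theorem run_eq_of_trivial (h : G = ∅ ∨ p ≤ 1 ∨ d = 0) :
    𝒢.run ℘ G d p q = (∅, [⟨℘, G, d, p, q⟩]) := by
  cases d with
  | zero => rfl
  | succ d =>
    rw [ParityGame.run, if_pos]
    simpa using h

theorem stage_empty (hL : ∀ v ∉ G, d < L v) :
    (fun v => if stage d G G L v ≤ d then d + 1 else stage d G G L v) = stage d ∅ G L := by
  funext v
  by_cases hv : v ∈ G
  · simp [stage, hv]
  · have := hL v hv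
    simp [stage, hv]
    omega

/-- Induction on `d`, following the recursion of `run`: a trivial call is one pass through the main
loop, and any other consists of `resume_repeat` in phase `0`, `resume_child` with full precision
and, if that was successful, `resume_repeat` in phase `2`. The statement is about the rest of the
execution, since all calls share one loop of the machine. -/
theorem simulates (hfit : Fits w S n edges.length d₀) (he : 𝒢.IsEdgeList edges)
    (hp : ∀ v, 𝒢.priority v ≤ d₀) (hK : 3 + 4 * n + 2 * edges.length + 3 * K ≤ S) (d : ℕ) :
    Simulates w S d₀ K 𝒢 edges d := by
  induction d with
  | zero =>
    intro Q ℘ G p q s t L stk out hR h15 h16 hG hL hstk hroom hQ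
    refine wp_mainLoop_call h15 h16 (wp_callProg hfit hR ?_ ?_) <;> rw [below_stage hL]
    · intro s₁ t₁ h hR₁ g15 g16 g17 ht₁
      rw [run_eq_of_trivial h] at hQ
      rw [stage_empty hL] at hR₁
      refine resume_of_eq_zero g17 (hQ _ _ (by simpa using hR₁) (g15.trans h15) g16 ?_)
      simp [partBound]
      omega
    · intro s₁ t₁ h
      simp at h
  | succ d ih =>
    intro Q ℘ G p q s t L stk out hR h15 h16 hG hL hstk hroom hQ
    refine wp_mainLoop_call h15 h16 (wp_callProg hfit hR ?_ ?_) <;> rw [below_stage hL]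
    · intro s₁ t₁ h hR₁ g15 g16 g17 ht₁
      rw [run_eq_of_trivial h] at hQ
      rw [stage_empty hL] at hR₁
      refine resume_of_eq_zero g17 (hQ _ _ (by simpa using hR₁) (g15.trans h15) g16 ?_)
      simp [partBound]
      omega
    · intro s₁ t₁ h hR₁ g15 g17 g18 ht₁
      have hB : n * 28 + 100 ≤ partBound n edges.length := by
        unfold partBound
        omega
      have hp2 : 2 ≤ p := by omega
      rw [ParityGame.run, if_neg (by tauto)] at hQ
      dsimp only at hQ
      have hloop := repeatLoop_spec (𝒢 := 𝒢) (℘ := ℘) (d := d + 1) (G := G)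
        (call := fun X => 𝒢.run ℘.opp X d (q / 2) p) (fun X => 𝒢.run_subset _ _ _ _ _)
        (P := fun X => 𝒢.IsSubgame X) (fun _ h => h) (fun X hX => hX.sdiff_attr) hG
      have hsub := 𝒢.repeatLoop_subset ℘ (d + 1) (fun X => 𝒢.run ℘.opp X d (q / 2) p) G
      refine resume_repeat ih hfit he hp (Or.inl rfl) hR₁ (g15.trans h15) g17 g18 hG subset_rfl hL
        hstk hroom hp2 hK rfl fun s₂ t₂ hR₂ k15 k16 k17 ht₂ => ?_
      generalize 𝒢.repeatLoop ℘ (d + 1) (fun X => 𝒢.run ℘.opp X d (q / 2) p) G = r₁ at *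
      obtain ⟨hr1, hr2, -⟩ := hloop
      rw [hr2] at hQ
      refine resume_child (ph := 1) ih hfit he hp hR₂ k15 (Or.inr ⟨k17, rfl, rfl⟩) hr1 hsub hL hstk
        hroom hp2 hK fun s₃ t₃ hR₃ l15 l16 l17 l17' ht₃ => ?_
      generalize 𝒢.run ℘.opp (𝒢.rest ℘ (d + 1) r₁.1) d q p = c at *
      have hX : 𝒢.IsSubgame (r₁.1 \ 𝒢.attr ℘.opp c.1 r₁.1) := hr1.sdiff_attr
      by_cases hW : c.1 = ∅
      · rw [if_pos hW] at hQ
        refine resume_of_eq_zero (l17 hW) (hQ _ _ ?_ l15 l16 ?_)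
        · simpa only [List.flatMap_cons, List.flatMap_append, List.append_assoc] using hR₃
        · simp only [List.length_cons, List.length_append, mul_add, mul_one] at *
          omega
      · rw [if_neg hW] at hQ
        obtain ⟨m17, m18⟩ := l17' hW
        refine resume_repeat ih hfit he hp (Or.inr rfl) hR₃ l15 m17 m18 hX
          (Finset.sdiff_subset.trans hsub) hL hstk hroom hp2 hK rfl
          fun s₄ t₄ hR₄ n15 n16 n17 ht₄ => ?_
        refine resume_of_eq_zero n17 (hQ _ _ ?_ n15 n16 ?_)
        · simpa only [List.flatMap_cons, List.flatMap_append, List.append_assoc] using hR₄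
        · simp only [List.length_cons, List.length_append, mul_add, mul_one] at *
          omega

end RAM

/-! ## The whole program -/

namespace RAM

open ParityGame

variable {n w S d K : ℕ} {𝒢 : ParityGame (Fin n)} {edges : List (Fin n × Fin n)}
  {Q : State → ℕ → Prop} {s : State} {t : ℕ}

theorem getElem?_flatMap_pair {α : Type*} (l : List α) (f g : α → ℕ) (i : ℕ) :
    (l.flatMap fun e => [f e, g e])[2 * i]? = l[i]?.map f ∧
    (l.flatMap fun e => [f e, g e])[2 * i + 1]? = l[i]?.map g := by
  induction l generalizing i with
  | nil => simp
  | cons e l ih =>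
    cases i with
    | zero => simp
    | succ i =>
      simpa [List.flatMap_cons, mul_add, add_right_comm _ 2 1] using ih i

theorem length_encodeGame :
    (𝒢.encodeGame d edges).length = 3 + 2 * n + 2 * edges.length := by
  simp [encodeGame, List.length_flatMap]
  omega

theorem hasGame_initial : HasGame 𝒢 edges (initial (𝒢.encodeGame d edges)).mem := by
  have h := getElem?_flatMap_pair edges (fun e => e.1.val) fun e => e.2.val
  constructor <;> intro i
  · have := i.2
    simp only [initial, encodeGame, List.getD_eq_getElem?_getD, List.getElem?_append,
      List.length_append, List.length_ofFn, List.length_cons, List.length_nil]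
    rw [if_pos (by omega), if_pos (by omega), if_neg (by omega)]
    simp
  · have := i.2
    simp only [initial, encodeGame, List.getD_eq_getElem?_getD, List.getElem?_append,
      List.length_append, List.length_ofFn, List.length_cons, List.length_nil]
    rw [if_pos (by omega), if_neg (by omega),
      show 3 + n + (i : ℕ) - (0 + 1 + 1 + 1 + n) = i by omega]
    simp
  · intro hi
    simp only [initial, encodeGame, List.getD_eq_getElem?_getD, List.getElem?_append,
      List.length_append, List.length_ofFn, List.length_cons, List.length_nil]
    rw [if_neg (by omega), show 3 + 2 * n + 2 * i - (0 + 1 + 1 + 1 + n + n) = 2 * i by omega,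
      (h i).1]
    simp [hi]
  · intro hi
    simp only [initial, encodeGame, List.getD_eq_getElem?_getD, List.getElem?_append,
      List.length_append, List.length_ofFn, List.length_cons, List.length_nil]
    rw [if_neg (by omega), show 3 + 2 * n + 2 * i + 1 - (0 + 1 + 1 + 1 + n + n) = 2 * i + 1 by omega,
      (h i).2]
    simp [hi]

theorem initial_mem_eq_zero {i : ℕ} (hi : 3 + 2 * n + 2 * edges.length ≤ i) :
    (initial (𝒢.encodeGame d edges)).mem i = 0 :=
  List.getD_eq_default _ _ (length_encodeGame.trans_le hi)

/-- Initializes the registers. -/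
def initRegs : Prog := block [
  .const 1 1, .load 2 0, .load 5 1, .const 28 2, .load 3 28, .const 8 3, .add 9 8 2, .add 4 9 2,
  .add 6 4 5, .add 6 6 5, .add 7 6 2, .add 10 7 2, .add 10 10 8, .add 11 3 0, .add 12 2 0,
  .add 13 2 0, .half 28 3, .add 28 28 28, .sub 14 3 28, .const 15 1, .const 16 1]

/-- Puts all vertices on the level in register 11. -/
def initLevels : Prog := forVertices (block [.add 28 6 22, .store 28 11])

/-- The implementation of the algorithm. -/
def mainProg : Prog := block [initRegs, initLevels, .loop 15 mainBody, emitSet]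

theorem encodePlayer_ofParity (d : ℕ) :
    encodePlayer (Player.ofParity d) = d - (d / 2 + d / 2) := by
  unfold Player.ofParity
  split_ifs with h
  · simp [encodePlayer]
    omega
  · simp [encodePlayer]
    omega

theorem wp_initLevels {m d₀ : ℕ} {lev : Fin n → ℕ} (hfit : Fits w S n m d₀)
    (hc : Consts n m d₀ s.reg)
    (hl : HasLevel m lev s.mem) (hd : s.reg 11 = d)
    (hQ : ∀ s' t', Agree 22 s s' → s'.out = s.out →
      SameOff (3 + 2 * n + 2 * m) (3 + 3 * n + 2 * m) s.mem s'.mem →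
      HasLevel m (fun _ : Fin n => d) s'.mem → t' ≤ t + (n * 8 + 4) → Q s' t') :
    WP w S initLevels Q s t := by
  refine wp_levelScan (T := 4) hfit hc hl (fun u s' t' hc' hr h22 _ hu => ?_) hQ
  obtain ⟨hf1, hf2, hf3⟩ := hfit
  have e11 := (hr 11 (by norm_num)).trans hd
  have := u.2
  simp only [wp_block_cons, wp_block_nil, wp_add, wp_store,
    State.set_reg, State.set_mem, State.set_out, State.put_mem, State.put_out,
    hc'.level, e11, h22, Nat.reduceEqDiff, if_true, if_false, agree_set, agree_put,
    Nat.reduceLeDiff, true_and]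
  exact ⟨by omega, by omega, Agree.refl _ _, fun i => trivial, by omega⟩

/-- The bottom stack entry and the nested halved calls need `1 + 2 ⌊log n⌋` entries; initialization
and final output are paid from the reserve left by `simulates`. -/
theorem exec_mainProg (hn : 1 ≤ n) (hfit : Fits w S n edges.length d) (he : 𝒢.IsEdgeList edges)
    (hp : ∀ v, 𝒢.priority v ≤ d) (hlog : 1 + 2 * Nat.log 2 n ≤ K)
    (hK : 3 + 4 * n + 2 * edges.length + 3 * K ≤ S) :
    ∃ t s, Exec w S mainProg (initial (𝒢.encodeGame d edges)) t s ∧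
      s.out = 𝒢.expectedOutput d ∧ t ≤ 3 * partBound n edges.length *
        (𝒢.calls (Player.ofParity d) Finset.univ d n n).length := by
  suffices h : WP w S mainProg (fun s t => s.out = 𝒢.expectedOutput d ∧
      t ≤ 3 * partBound n edges.length *
        (𝒢.calls (Player.ofParity d) Finset.univ d n n).length)
      (initial (𝒢.encodeGame d edges)) 0 by
    obtain ⟨t, s, h1, h2, h3⟩ := h
    exact ⟨t, s, h1, h2, by omega⟩
  have hfit' := hfit
  obtain ⟨hf1, hf2, hf3⟩ := hfit'
  have hm0 : (initial (𝒢.encodeGame d edges)).mem 0 = n := rfl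
  have hm1 : (initial (𝒢.encodeGame d edges)).mem 1 = edges.length := rfl
  have hm2 : (initial (𝒢.encodeGame d edges)).mem 2 = d := rfl
  have hzero : ∀ i, 3 + 2 * n + 2 * edges.length ≤ i →
      (initial (𝒢.encodeGame d edges)).mem i = 0 := fun i => initial_mem_eq_zero
  have hgame : HasGame 𝒢 edges (initial (𝒢.encodeGame d edges)).mem := hasGame_initial
  have hreg : ∀ r, (initial (𝒢.encodeGame d edges)).reg r = 0 := fun _ => rfl
  have hout : (initial (𝒢.encodeGame d edges)).out = [] := rfl
  generalize initial (𝒢.encodeGame d edges) = s₀ at *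
  unfold mainProg
  rw [wp_block_cons]
  suffices hinit : WP w S initRegs (fun s t => Consts n edges.length d s.reg ∧ s.mem = s₀.mem ∧
      s.out = [] ∧ s.reg 10 = 3 + 4 * n + 2 * edges.length + 3 ∧ s.reg 11 = d ∧ s.reg 12 = n ∧
      s.reg 13 = n ∧ s.reg 14 = encodePlayer (Player.ofParity d) ∧ s.reg 15 = 1 ∧
      s.reg 16 = 1 ∧ t ≤ 30) s₀ 0 by
    refine hinit.mono fun s₁ t₁ ⟨hc₁, hm₁, ho₁, h10, h11, h12, h13, h14, h15, h16, ht₁⟩ => ?_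
    rw [wp_block_cons]
    refine wp_initLevels (lev := fun _ => 0) hfit hc₁ (fun v => by rw [hm₁, hzero _ (by omega)])
      h11 fun s₂ t₂ hr₂ ho₂ hm₂ hl₂ ht₂ => ?_
    rw [wp_block_cons]
    have hL : ∀ v ∉ (Finset.univ : Finset (Fin n)), d < (fun _ => 0) v := fun v hv =>
      (hv (Finset.mem_univ v)).elim
    have hR₂ : Rep 𝒢 edges d S s₂ (stage d Finset.univ Finset.univ fun _ => 0) d n n
        (Player.ofParity d) [(0, 0, 0)] [] := by
      constructor
      · exact hc₁.congr fun i hi => hr₂ i (by omega)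
      · exact (hm₁ ▸ hgame).congr fun i hi => hm₂ i (by omega)
      · convert hl₂ using 2
        simp [stage]
      -- The bottom entry `(0, 0, 0)` needs no writing: the cells behind the input are zero
      -- initially.
      · refine ⟨?_, ?_, ?_, trivial⟩ <;> rw [hm₂ _ (by simp; omega), hm₁, hzero _ (by simp; omega)]
      · simp
        omega
      · rw [hr₂ _ (by norm_num), h10]
        simp
      · rw [hr₂ _ (by norm_num), h11]
      · rw [hr₂ _ (by norm_num), h12]
      · rw [hr₂ _ (by norm_num), h13]
      · rw [hr₂ _ (by norm_num), h14]
      · rw [ho₂, ho₁]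
      · exact le_rfl
      · exact le_rfl
      · exact le_rfl
      · simp
    refine simulates hfit he hp hK d _ _ _ _ _ _ _ _ _ _ hR₂ ((hr₂ 15 (by norm_num)).trans h15)
      ((hr₂ 16 (by norm_num)).trans h16) (fun v _ => by simpa using 𝒢.exists_succ v) hL
      ⟨_, _, rfl, Or.inl rfl⟩ (fun _ => ⟨hn, by simp; omega⟩) fun s₃ t₃ hR₃ k15 k16 ht₃ => ?_
    refine wp_mainLoop_ret k15 k16 ?_
    unfold retProg
    simp only [wp_block_cons, wp_block_nil, wp_add, wp_sub, wp_cond, State.set_reg, hR₃.consts.zero,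
      hR₃.consts.top, hR₃.maxPriority, Nat.reduceEqDiff, if_true, if_false, Nat.sub_self]
    -- The outermost call has the top priority, so `retProg` clears register 15 and the main loop
    -- stops.
    refine ⟨by omega, by omega, resume_of_eq_zero (by simp [State.set_reg])
      (wp_loop_of_eq_zero (by simp [State.set_reg]) ?_)⟩
    refine wp_emitSet (d := d) hfit (hR₃.consts.congr fun i hi => ?_) hR₃.level ?_
      fun s₄ t₄ _ _ ho₄ _ ht₄ => ?_
    · simp only [State.set_reg]
      split_ifs <;> omega
    · simp [State.set_reg, hR₃.maxPriority]
    · rw [below_stage hL] at ho₄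
      refine ⟨?_, ?_⟩
      · rw [ho₄]
        change s₃.out ++ _ = _
        rw [hR₃.output, List.nil_append]
        rfl
      · unfold calls
        unfold partBound at *
        omega
  unfold initRegs
  simp only [wp_block_cons, wp_block_nil, wp_add, wp_sub, wp_half, wp_const, wp_load,
    State.set_reg, State.set_mem, State.set_out, hreg, hm0, hm1, hm2, hout, Nat.reduceEqDiff,
    if_true, if_false, encodePlayer_ofParity, true_and]
  and_intros <;> first | omega | skip
  constructor <;> simp only [State.set_reg, Nat.reduceEqDiff, if_true, if_false, hreg] <;> omega

end RAM

/-! ## Bounds for the resources -/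

namespace ParityGame

open Real

/-- The binomial coefficient is read off from a single term of the expansion of `(a / d + 1) ^ (d +
ℓ)`. Of this power, the `d` factors give at most `exp a`, and the other `ℓ`, divided by `(a / d) ^
ℓ`, give `(1 + d / a) ^ ℓ`. -/
theorem choose_le_exp_mul_rpow {d ℓ : ℕ} {a : ℝ} (hd : 1 ≤ d) (ha : 0 < a) (hℓ : (ℓ : ℝ) ≤ a) :
    ((d + ℓ).choose ℓ : ℝ) ≤ exp a * (1 + d / a) ^ a := by
  have hd0 : (0 : ℝ) < d := by exact_mod_cast hd
  have hx : 0 < a / d := by positivity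
  have h1 : ((d + ℓ).choose ℓ : ℝ) * (a / d) ^ ℓ ≤ (a / d + 1) ^ (d + ℓ) := by
    rw [add_pow]
    refine le_trans (le_of_eq ?_) (Finset.single_le_sum (f := fun k =>
      (a / d) ^ k * 1 ^ (d + ℓ - k) * ((d + ℓ).choose k : ℝ)) (fun k _ => by positivity)
      (Finset.mem_range.2 (show ℓ < d + ℓ + 1 by omega)))
    rw [one_pow, mul_one, mul_comm]
  have h2 : (a / d + 1) ^ d ≤ exp a := by
    calc (a / d + 1) ^ d ≤ exp (a / d) ^ d := by gcongr; exact add_one_le_exp _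
      _ = exp a := by rw [← exp_nat_mul]; congr 1; field_simp
  have h3 : (a / d + 1) ^ ℓ = (1 + d / a) ^ ℓ * (a / d) ^ ℓ := by
    rw [← mul_pow]
    congr 1
    field_simp
  have h4 : (1 + d / a) ^ ℓ ≤ (1 + d / a) ^ a := by
    rw [← rpow_natCast]
    exact rpow_le_rpow_of_exponent_le (by linarith [show 0 < d / a by positivity]) hℓ
  rw [pow_add, h3, ← mul_assoc] at h1
  refine (le_of_mul_le_mul_right h1 (by positivity)).trans ?_
  gcongr

/-- Since `n ^ 2 ≤ 4 * 2 ^ ℓ`, the factor `n ^ 2` doubles the base, up to the constant `4`. The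
doubled base is at most `n * (1 + 2 / n)`, and `(1 + 2 / n) ^ ℓ ≤ exp 4` because `ℓ ≤ 2 * n`. -/
theorem half_add_one_pow_le {n ℓ : ℕ} (hn : 2 ≤ n) (hℓ : ℓ = 2 * Nat.log 2 n) :
    (n : ℝ) ^ 2 * ((n / 2 + 1 : ℕ) : ℝ) ^ ℓ ≤ 4 * exp 4 * (n : ℝ) ^ (2 * logb 2 n) := by
  have hn0 : (0 : ℝ) < n := by positivity
  have h1 : (n : ℝ) ≤ 2 * 2 ^ Nat.log 2 n := by
    have := (Nat.lt_pow_succ_log_self one_lt_two n).le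
    rw [pow_succ'] at this
    exact_mod_cast this
  have h2 : (n : ℝ) ^ 2 ≤ 4 * 2 ^ ℓ := by
    calc (n : ℝ) ^ 2 ≤ (2 * 2 ^ Nat.log 2 n) ^ 2 := by gcongr
      _ = 4 * 2 ^ ℓ := by rw [hℓ, mul_pow, ← pow_mul, mul_comm (Nat.log 2 n)]; norm_num
  have h3 : 2 * ((n / 2 + 1 : ℕ) : ℝ) ≤ n * (1 + 2 / n) := by
    have : 2 * (n / 2 + 1) ≤ n + 2 := by omega
    have : 2 * ((n / 2 + 1 : ℕ) : ℝ) ≤ n + 2 := by exact_mod_cast this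
    rwa [mul_add, mul_div_cancel₀ _ hn0.ne', mul_one]
  have h4 : (1 + 2 / (n : ℝ)) ^ ℓ ≤ exp 4 := by
    have hlog : (Nat.log 2 n : ℝ) ≤ n := by exact_mod_cast Nat.log_le_self 2 n
    calc (1 + 2 / (n : ℝ)) ^ ℓ ≤ exp (2 / n) ^ ℓ := by
          gcongr
          rw [add_comm]
          exact add_one_le_exp _
      _ = exp (ℓ * (2 / n)) := by rw [← exp_nat_mul]
      _ ≤ exp 4 := by
          rw [exp_le_exp, hℓ, mul_div_assoc', div_le_iff₀ hn0]
          push_cast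
          linarith
  have h5 : (n : ℝ) ^ ℓ ≤ (n : ℝ) ^ (2 * logb 2 n) := by
    rw [← rpow_natCast]
    refine rpow_le_rpow_of_exponent_le (by exact_mod_cast (by omega : 1 ≤ n)) ?_
    rw [hℓ]
    push_cast
    have := natLog_le_logb n 2
    push_cast at this
    linarith
  calc (n : ℝ) ^ 2 * ((n / 2 + 1 : ℕ) : ℝ) ^ ℓ
      ≤ 4 * 2 ^ ℓ * ((n / 2 + 1 : ℕ) : ℝ) ^ ℓ := by gcongr
    _ = 4 * (2 * ((n / 2 + 1 : ℕ) : ℝ)) ^ ℓ := by rw [mul_pow, mul_assoc]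
    _ ≤ 4 * (n * (1 + 2 / n)) ^ ℓ := by gcongr
    _ = 4 * (1 + 2 / (n : ℝ)) ^ ℓ * n ^ ℓ := by rw [mul_pow]; ring
    _ ≤ 4 * exp 4 * (n : ℝ) ^ (2 * logb 2 n) := by gcongr

theorem one_le_logb {x : ℝ} (hx : 2 ≤ x) : 1 ≤ logb 2 x := by
  rwa [le_logb_iff_rpow_le one_lt_two (by linarith), rpow_one]

theorem rpow_mul_logb {x y : ℝ} (hx : 0 < x) (hy : 0 < y) : x ^ logb 2 y = y ^ logb 2 x := by
  rw [rpow_def_of_pos hx, rpow_def_of_pos hy, logb, logb]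
  congr 1
  ring

/-- The source of the exponent 2.9: the left side is `x` to the power 2 / ln 2, which is about
2.885. -/
theorem exp_two_mul_logb_le {x : ℝ} (hx : 1 ≤ x) : exp (2 * logb 2 x) ≤ x ^ (2.9 : ℝ) := by
  have h2 := log_two_gt_d9
  rw [rpow_def_of_pos (by linarith), exp_le_exp, logb]
  have : 2 * (log x / log 2) = log x * (2 / log 2) := by ring
  rw [this]
  refine mul_le_mul_of_nonneg_left ?_ (log_nonneg hx)
  rw [div_le_iff₀ (by linarith)]
  linarith

/-- The bound for the running time that follows from the number of calls. -/
theorem time_le {n d ℓ : ℕ} (hn : 2 ≤ n) (hd : 1 ≤ d) (hℓ : ℓ = 2 * Nat.log 2 n) :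
    (n : ℝ) ^ 2 * ((n / 2 + 1 : ℕ) : ℝ) ^ ℓ * ((d + ℓ).choose ℓ : ℝ) ≤
      4 * exp 4 * (n : ℝ) ^ (2.9 + 2 * logb 2 n + 2 * logb 2 (1 + d / (2 * logb 2 n))) := by
  have hn2 : (2 : ℝ) ≤ n := by exact_mod_cast hn
  have hL := one_le_logb hn2
  have hn0 : (0 : ℝ) < n := by linarith
  have h1 := half_add_one_pow_le hn hℓ
  have h2 := choose_le_exp_mul_rpow (ℓ := ℓ) (a := 2 * logb 2 n) hd (by linarith) (by
    rw [hℓ]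
    push_cast
    have := natLog_le_logb n 2
    push_cast at this
    linarith)
  have h3 := exp_two_mul_logb_le (x := n) (by linarith)
  have hpos : 0 < 1 + (d : ℝ) / (2 * logb 2 n) := by positivity
  have h4 : (1 + (d : ℝ) / (2 * logb 2 n)) ^ (2 * logb 2 (n : ℝ)) =
      (n : ℝ) ^ (2 * logb 2 (1 + d / (2 * logb 2 n))) := by
    generalize 1 + (d : ℝ) / (2 * logb 2 n) = y at hpos
    rw [mul_comm, rpow_mul hpos.le, ← rpow_mul_logb hn0 hpos, ← rpow_mul hn0.le, mul_comm]
  calc _ ≤ 4 * exp 4 * (n : ℝ) ^ (2 * logb 2 n) *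
        (exp (2 * logb 2 n) * (1 + d / (2 * logb 2 n)) ^ (2 * logb 2 (n : ℝ))) := by gcongr
    _ ≤ 4 * exp 4 * (n : ℝ) ^ (2 * logb 2 n) *
        ((n : ℝ) ^ (2.9 : ℝ) * (n : ℝ) ^ (2 * logb 2 (1 + d / (2 * logb 2 n)))) := by
      rw [h4]
      gcongr
    _ = _ := by
      rw [rpow_add hn0, rpow_add hn0]
      ring

/-- As `n ≥ 2`, the constant is at most `n ^ 19`. The exponents 19, 2 (from `m`) and 2.9 are
absorbed using `1 ≤ logb 2 n`, which with the term `2 * logb 2 n` gives at most 26. -/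
theorem le_rpow_of_le {n d : ℕ} {m t C : ℝ} (hn : 2 ≤ n) (hm0 : 0 ≤ m) (hm : m ≤ (n : ℝ) ^ 2)
    (hC : C = 2 ^ 19)
    (ht : t ≤ C * (m * (n : ℝ) ^ (2.9 + 2 * logb 2 n + 2 * logb 2 (1 + d / (2 * logb 2 n))))) :
    t ≤ (n : ℝ) ^ (26 * (logb 2 n + logb 2 (1 + d / logb 2 n))) := by
  have hn2 : (2 : ℝ) ≤ n := by exact_mod_cast hn
  have hL := one_le_logb hn2
  have hn0 : (0 : ℝ) < n := by linarith
  have h1 : logb 2 (1 + d / (2 * logb 2 (n : ℝ))) ≤ logb 2 (1 + d / logb 2 n) := by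
    refine logb_le_logb_of_le one_lt_two (by positivity) ?_
    gcongr
    linarith
  have h2 : 0 ≤ logb 2 (1 + d / logb 2 (n : ℝ)) :=
    logb_nonneg one_lt_two (le_add_of_nonneg_right (by positivity))
  have h3 : C ≤ (n : ℝ) ^ (19 : ℝ) := by
    rw [hC, show (19 : ℝ) = (19 : ℕ) by norm_num, rpow_natCast]
    gcongr
  have h4 : m ≤ (n : ℝ) ^ (2 : ℝ) := by rwa [rpow_two]
  calc t ≤ _ := ht
    _ ≤ (n : ℝ) ^ (19 : ℝ) * ((n : ℝ) ^ (2 : ℝ) *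
          (n : ℝ) ^ (2.9 + 2 * logb 2 n + 2 * logb 2 (1 + d / (2 * logb 2 n)))) := by gcongr
    _ = (n : ℝ) ^ (19 + (2 + (2.9 + 2 * logb 2 n + 2 * logb 2 (1 + d / (2 * logb 2 n))))) := by
      rw [rpow_add hn0 19, rpow_add hn0 2]
    _ ≤ _ := rpow_le_rpow_of_exponent_le (by linarith) (by linarith)

theorem logb_one_add_div_le {n d : ℕ} (hn : 2 ≤ n) (hd : d ≤ n) :
    logb 2 (1 + d / logb 2 n) ≤ 2 * logb 2 (n : ℝ) := by
  have hn2 : (2 : ℝ) ≤ n := by exact_mod_cast hn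
  have hL := one_le_logb hn2
  have hdn : (d : ℝ) ≤ n := by exact_mod_cast hd
  rw [show 2 * logb 2 (n : ℝ) = logb 2 ((n : ℝ) ^ 2) by rw [logb_pow]; norm_num]
  refine logb_le_logb_of_le one_lt_two (by positivity) ?_
  have : (d : ℝ) / logb 2 n ≤ n := (div_le_self (by positivity) hL).trans hdn
  nlinarith

end ParityGame

/-! ### Assembling the resource bounds. -/

namespace RAM

open ParityGame Real

variable {n d : ℕ} {𝒢 : ParityGame (Fin n)} {edges : List (Fin n × Fin n)}

theorem lt_of_mem_encodeGame {x b : ℕ} (hp : ∀ v, 𝒢.priority v ≤ d) (h1 : 1 < b) (hn : n < b)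
    (hm : edges.length < b) (hd : d < b) (hx : x ∈ 𝒢.encodeGame d edges) : x < b := by
  simp only [encodeGame, List.mem_append, List.mem_cons, List.not_mem_nil, or_false, List.mem_ofFn,
    List.mem_flatMap] at hx
  rcases hx with (((rfl | rfl | rfl) | ⟨v, rfl⟩) | ⟨v, rfl⟩) | ⟨e, -, rfl | rfl⟩
  · exact hn
  · exact hm
  · exact hd
  · exact (encodePlayer_le _).trans_lt h1
  · exact (hp v).trans_lt hd
  · exact e.1.2.trans hn
  · exact e.2.2.trans hn

theorem exists_exec (hn : 1 ≤ n) (hp : ∀ v, 𝒢.priority v ≤ d) (he : 𝒢.IsEdgeList edges) :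
    ∃ (w S t : ℕ) (s : State),
      Exec w S mainProg (initial (𝒢.encodeGame d edges)) t s ∧ s.out = 𝒢.expectedOutput d ∧
      (∀ x ∈ 𝒢.encodeGame d edges, x < 2 ^ w) ∧ (𝒢.encodeGame d edges).length ≤ S ∧
      w = 2 * Nat.log 2 (n + d) + 7 ∧
      S = 6 + 4 * n + 2 * edges.length + 6 * Nat.log 2 n ∧
      (edges.length : ℝ) ≤ (n : ℝ) ^ 2 ∧
      (t : ℝ) ≤ 2 ^ 19 * (edges.length * (n : ℝ) ^ (2.9 + 2 * logb 2 n +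
        2 * logb 2 (1 + d / (2 * logb 2 n)))) := by
  have : Nonempty (Fin n) := ⟨⟨0, hn⟩⟩
  have hn2 : 2 ≤ n := by simpa using 𝒢.two_le_card
  have hd : 1 ≤ d := (𝒢.priority_pos ⟨0, hn⟩).trans (hp _)
  have hm : edges.length ≤ n ^ 2 := by
    simpa [sq] using he.1.length_le_card
  have hm1 : 1 ≤ edges.length := by
    obtain ⟨v, hv⟩ := 𝒢.exists_succ ⟨0, hn⟩
    exact List.length_pos_of_mem ((he.2 _ _).2 hv)
  have hlog := Nat.log_le_self 2 n
  set k := Nat.log 2 (n + d) with hk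
  -- The word length has twice the logarithm because addresses grow like `m ≤ n ^ 2`.
  have hpow : (2 : ℕ) ^ (2 * k + 7) = 32 * (2 ^ (k + 1) * 2 ^ (k + 1)) := by ring
  have hnd : n + d < 2 ^ (k + 1) := Nat.lt_pow_succ_log_self one_lt_two _
  have hS : 6 + 4 * n + 2 * edges.length + 6 * Nat.log 2 n < 2 ^ (2 * k + 7) := by
    rw [hpow]
    nlinarith
  have hdw : d + 4 ≤ 2 ^ (2 * k + 7) := by
    rw [hpow]
    nlinarith
  obtain ⟨t, s, h1, h2, h3⟩ := exec_mainProg (w := 2 * k + 7)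
    (S := 6 + 4 * n + 2 * edges.length + 6 * Nat.log 2 n) (K := 1 + 2 * Nat.log 2 n)
    hn ⟨by omega, hS, hdw⟩ he hp le_rfl (by omega)
  refine ⟨_, _, t, s, h1, h2, fun x => lt_of_mem_encodeGame hp (by omega) (by omega) (by omega)
    (by omega), by rw [length_encodeGame]; omega, rfl, rfl, by exact_mod_cast hm, ?_⟩
  have hcalls := length_calls_le (𝒢 := 𝒢) (℘ := Player.ofParity d) (G := Finset.univ) (d := d)
    (fun v _ => by simpa using 𝒢.exists_succ v) hn hn
  rw [Fintype.card_fin, ← two_mul] at hcalls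
  -- 236 is the sum of the coefficients 25, 41, 10, 60 and 100 in `partBound`.
  have hpart : partBound n edges.length ≤ 236 * (n ^ 2 * edges.length) := by
    unfold partBound
    nlinarith [Nat.mul_le_mul hn2 hn2, Nat.mul_le_mul (Nat.mul_le_mul hn2 hn2) hm1,
      Nat.mul_le_mul hn2 (le_refl n), Nat.mul_le_mul (le_refl (n * n)) hm1]
  have ht : t ≤ 1416 * edges.length * (n ^ 2 * (n / 2 + 1) ^ (2 * Nat.log 2 n) *
      (d + 2 * Nat.log 2 n).choose (2 * Nat.log 2 n)) := by
    calc t ≤ _ := h3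
      _ ≤ 3 * (236 * (n ^ 2 * edges.length)) * (2 * (n / 2 + 1) ^ (2 * Nat.log 2 n) *
          (d + 2 * Nat.log 2 n).choose (2 * Nat.log 2 n)) := by
        gcongr
        omega
      _ = _ := by ring
  -- 5664 is 3 · 236 · 2, from the time per call and the number of calls, times the 4 of `time_le`.
  have hexp : 5664 * exp 4 ≤ 2 ^ 19 := by
    have h := exp_one_lt_three
    have : exp 4 = exp 1 ^ 4 := by rw [← exp_nat_mul]; norm_num
    have : exp 1 ^ 4 ≤ 3 ^ 4 := by gcongr
    linarith
  have hfin := time_le hn2 hd rfl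
  calc (t : ℝ) ≤ 1416 * edges.length * ((n : ℝ) ^ 2 * ((n / 2 + 1 : ℕ) : ℝ) ^ (2 * Nat.log 2 n) *
        ((d + 2 * Nat.log 2 n).choose (2 * Nat.log 2 n) : ℝ)) := by exact_mod_cast ht
    _ ≤ 1416 * edges.length * (4 * exp 4 * (n : ℝ) ^ (2.9 + 2 * logb 2 n +
        2 * logb 2 (1 + d / (2 * logb 2 n)))) := by gcongr
    _ = 5664 * exp 4 * (edges.length * (n : ℝ) ^ (2.9 + 2 * logb 2 n +
        2 * logb 2 (1 + d / (2 * logb 2 n)))) := by ring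
    _ ≤ _ := by gcongr

end RAM

open Real in
theorem implementation :
    ∃ (P : RAM.Prog) (C : ℝ), ∀ (n m d : ℕ) (𝒢 : ParityGame (Fin n))
        (edges : List (Fin n × Fin n)),
      1 ≤ n → (∀ v, 𝒢.priority v ≤ d) → 𝒢.IsEdgeList edges → m = edges.length →
      ∃ (w S t : ℕ) (s : RAM.State),
        RAM.Exec w S P (RAM.initial (𝒢.encodeGame d edges)) t s ∧
        s.out = 𝒢.expectedOutput d ∧
        (∀ x ∈ 𝒢.encodeGame d edges, x < 2 ^ w) ∧
        (𝒢.encodeGame d edges).length ≤ S ∧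
        (w : ℝ) ≤ C * Real.logb 2 (n + d) ∧
        (S : ℝ) ≤ C * (m + n * Real.logb 2 n) ∧
        (t : ℝ) ≤ C * (m * (n : ℝ) ^ (2.9 + 2 * Real.logb 2 n +
          2 * Real.logb 2 (1 + d / (2 * Real.logb 2 n)))) ∧
        (t : ℝ) ≤ (n : ℝ) ^ (C * (Real.logb 2 n + Real.logb 2 (1 + d / Real.logb 2 n))) ∧
        (d ≤ n → (t : ℝ) ≤ (n : ℝ) ^ (C * Real.logb 2 n)) := by
  -- The constant is dictated by the running time; the other bounds need far less.
  refine ⟨RAM.mainProg, 2 ^ 19, fun n m d 𝒢 edges hn hp he hm => ?_⟩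
  subst hm
  obtain ⟨w, S, t, s, h1, h2, h3, h4, hw, hS, hm, ht⟩ := RAM.exists_exec hn hp he
  have : Nonempty (Fin n) := ⟨⟨0, hn⟩⟩
  have hn2 : 2 ≤ n := by simpa using 𝒢.two_le_card
  have hn2' : (2 : ℝ) ≤ n := by exact_mod_cast hn2
  have hL := ParityGame.one_le_logb hn2'
  have hD : 0 ≤ logb 2 (1 + d / logb 2 (n : ℝ)) :=
    logb_nonneg one_lt_two (le_add_of_nonneg_right (by positivity))
  have ht2 := ParityGame.le_rpow_of_le hn2 (Nat.cast_nonneg _) hm rfl ht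
  have hlogn : (Nat.log 2 n : ℝ) ≤ n := by exact_mod_cast Nat.log_le_self 2 n
  refine ⟨w, S, t, s, h1, h2, h3, h4, ?_, ?_, ht, ?_, fun hdn => ?_⟩
  · have h5 := natLog_le_logb (n + d) 2
    have h6 := ParityGame.one_le_logb (x := n + d) (by linarith [Nat.cast_nonneg (α := ℝ) d])
    push_cast at h5
    rw [hw]
    push_cast
    linarith
  · have h5 : (n : ℝ) ≤ n * logb 2 n := le_mul_of_one_le_right (by linarith) hL
    have h6 : (0 : ℝ) ≤ edges.length := Nat.cast_nonneg _
    rw [hS]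
    push_cast
    linarith
  · refine ht2.trans (rpow_le_rpow_of_exponent_le (by linarith) ?_)
    gcongr
    norm_num
  · refine ht2.trans (rpow_le_rpow_of_exponent_le (by linarith) ?_)
    have := ParityGame.logb_one_add_div_le hn2 hdn
    linarith

theorem mainTheorem2 :
    -- correctness of the procedures with arbitrary precision parameters
    (∀ (V : Type*) [Fintype V] [DecidableEq V] (𝒢 : ParityGame V) (G : Finset V)
        (℘ : Player) (d p q : ℕ),
      𝒢.IsSubgame G → ℘.HasParity d → (∀ v ∈ G, 𝒢.priority v ≤ d) →
      (∀ D, 𝒢.IsDominion G ℘ D → D.card ≤ p → D ⊆ 𝒢.solve ℘ G d p q) ∧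
      (∀ D, 𝒢.IsDominion G ℘.opp D → D.card ≤ q → Disjoint D (𝒢.solve ℘ G d p q))) ∧
    -- with full precision, the winning regions are computed
    (∀ (V : Type*) [Fintype V] [DecidableEq V] (𝒢 : ParityGame V) (G : Finset V)
        (℘ : Player) (d : ℕ),
      𝒢.IsSubgame G → ℘.HasParity d → (∀ v ∈ G, 𝒢.priority v ≤ d) →
      𝒢.winningRegion G ℘ = (𝒢.solve ℘ G d G.card G.card : Finset V) ∧
      𝒢.winningRegion G ℘.opp = (G \ 𝒢.solve ℘ G d G.card G.card : Finset V)) ∧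
    -- the number of calls
    (∀ (V : Type*) [Fintype V] [DecidableEq V] [Nonempty V] (𝒢 : ParityGame V) (G : Finset V)
        (℘ : Player) (d p q ℓ : ℕ),
      𝒢.IsSubgame G → ℘.HasParity d → (∀ v ∈ G, 𝒢.priority v ≤ d) → 1 ≤ p → 1 ≤ q →
      ℓ = Nat.log 2 p + Nat.log 2 q →
      ((𝒢.calls ℘ G d p q).length : ℤ) ≤
        2 * (Fintype.card V : ℤ) ^ ℓ * ((d + ℓ).choose ℓ : ℤ) - 1) ∧
    -- memory and running time
    (∃ (P : RAM.Prog) (C : ℝ), ∀ (n m d : ℕ) (𝒢 : ParityGame (Fin n))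
        (edges : List (Fin n × Fin n)),
      1 ≤ n → (∀ v, 𝒢.priority v ≤ d) → 𝒢.IsEdgeList edges → m = edges.length →
      ∃ (w S t : ℕ) (s : RAM.State),
        RAM.Exec w S P (RAM.initial (𝒢.encodeGame d edges)) t s ∧
        s.out = 𝒢.expectedOutput d ∧
        (∀ x ∈ 𝒢.encodeGame d edges, x < 2 ^ w) ∧
        (𝒢.encodeGame d edges).length ≤ S ∧
        (w : ℝ) ≤ C * Real.logb 2 (n + d) ∧
        (S : ℝ) ≤ C * (m + n * Real.logb 2 n) ∧
        (t : ℝ) ≤ C * (m * (n : ℝ) ^ (2.9 + 2 * Real.logb 2 n +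
          2 * Real.logb 2 (1 + d / (2 * Real.logb 2 n)))) ∧
        (t : ℝ) ≤ (n : ℝ) ^ (C * (Real.logb 2 n + Real.logb 2 (1 + d / Real.logb 2 n))) ∧
        (d ≤ n → (t : ℝ) ≤ (n : ℝ) ^ (C * Real.logb 2 n))) := by
  refine ⟨fun V _ _ 𝒢 G ℘ d p q hG hd hle => ParityGame.solve_dominion hG hd hle,
    fun V _ _ 𝒢 G ℘ d hG hd hle => ParityGame.winningRegion_eq hG hd hle,
    fun V _ _ _ 𝒢 G ℘ d p q ℓ hG _ _ hp hq hℓ => ParityGame.length_calls_le_pow hG hp hq hℓ,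
    implementation⟩
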